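/- **Cost model.** Algorithms are programs for a random access machine with finitely many named registers and arrays of registers holding natural numbers (constants, array access, $+$, truncated $-$, $\times$, Euclidean quotient and remainder, tests for zero, loops, calls of external procedures). Write $|x|$ for the number of binary digits of $x$ plus one. Each instruction is charged the number of bit operations of the schoolbook method: $|a|+|b|$ for $a\pm b$, $|a|\,|b|$ for $ab$, $|a|+|b|\,|\lfloor a/b\rfloor|$ for a quotient or remainder, the lengths of the index and of the value for an array access, the length of the tested number for a test; reading the input and writing the output are charged their lengths, and a procedure call is charged the full cost of the procedure (in addition to the lengths of the two list sizes passed). Elements of $\mathbb Z/p^\lambda\mathbb Z$ are represented by their residues in $\{0,\dots,p^\lambda-1\}$; every input also contains $p$, $\lambda$, $p^\lambda$ and the size $n$. **Definitions.** Let $p$ be a prime. An approximation modulo $(p^\kappa,t^n)$ of $f=\sum a_it^i\in\mathbb Z_p[[t]]$ is a series $\sum b_it^i\in\mathbb Z_p[[t]]$ with $a_i\equiv b_i \pmod{p^\kappa}$ for all $i<n$. Consider any program that, for all $\lambda,n\ge 1$, multiplies two polynomials of degree at most $n$ over $\mathbb Z/p^\lambda\mathbb Z$, and let $M_{\mathbb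 Z}(p^\lambda,n)$ bound the number of its bit operations. For $h\in\mathbb Z_p[[t]]$, consider any program that, for all $\lambda,n\ge 1$ and all $f\in t\,\mathbb Z_p[[t]]$, computes $h(f)$ modulo $(p^\lambda,t^n)$ from $h$ and $f$ modulo $(p^\lambda,t^n)$, and let $C_h(p^\lambda,n)$ bound the number of its bit operations. **Theorem.** There are a program $\mathcal A$, calling a multiplication procedure and a composition procedure as above, and an absolute constant $K$ such that the following holds for every prime $p$, every $h\in\mathbb Z_p[[t]]$ with $h(0)=1$, and every choice of these two procedures with cost bounds $M_{\mathbb Z}$ and $C_h$. Let $n>0$ and $\kappa>0$ be integers, with $\kappa>1$ if $p=2$, and set $\lambda=\kappa+\lfloor\log_p n\rfloor$. Assume that $2M_{\mathbb Z}(p^\lambda,\lfloor m/2\rfloor)\le M_{\mathbb Z}(p^\lambda,m)$ and $2C_h(p^\lambda,\lfloor m/2\rfloor)\le C_h(p^\lambda,m)$ for all $m\ge 2$. Let $g\in\mathbb Z_p[[t]]$ with $g(0)\ne 0$, and suppose that the solution $y$ of $y'=g\cdot h(y)$, $y(0)=0$, has coefficients in $\mathbb Z_p$. Then, given any approximations of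 $g$ and $h$ modulo $(p^\lambda,t^n)$, the program $\mathcal A$ terminates and outputs $n+1$ integers that are the coefficients of an approximation of $y$ modulo $(p^\kappa,t^{n+1})$, using at most $K\,\bigl(M_{\mathbb Z}(p^\lambda,n)+C_h(p^\lambda,n)\bigr)$ bit operations. -/

import Mathlib

open scoped PowerSeries

/-! ## A random access machine with bit cost

The machine has scalar registers and arrays of registers, all holding natural numbers. A program
mentions finitely many registers and arrays by name; arrays are indexed through registers. Every
instruction is charged the number of bit operations that the schoolbook algorithm spends on it,
including the length of the addresses that it uses. -/

namespace BitRAM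

/-- The length charged for handling the number `x`: its number of binary digits, plus one. -/
def len (x : ℕ) : ℕ := Nat.size x + 1

/-- The length charged for handling a list of numbers. -/
def listLen (l : List ℕ) : ℕ := (l.map len).sum

/-- The arithmetic operations of the machine, on natural numbers. -/
inductive Op
  | add
  | sub
  | mul
  | div
  | mod

/-- The value of an operation: `sub` is truncated at zero, and `div`, `mod` are the Euclidean
quotient and remainder (with `a / 0 = 0` and `a % 0 = a`). -/
def Op.eval : Op → ℕ → ℕ → ℕ
  | .add, a, b => a + b
  | .sub, a, b => a - b
  | .mul, a, b => a * b
  | .div, a, b => a / b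
  | .mod, a, b => a % b

/-- The number of bit operations charged for an operation: linear for addition and subtraction,
the product of the lengths for multiplication, and for division the length of the dividend plus the
product of the lengths of the divisor and of the quotient. -/
def Op.cost : Op → ℕ → ℕ → ℕ
  | .add, a, b => len a + len b
  | .sub, a, b => len a + len b
  | .mul, a, b => len a * len b
  | .div, a, b => len a + len b * len (a / b)
  | .mod, a, b => len a + len b * len (a / b)

/-- Programs. Registers, arrays and external procedures are named by natural numbers. -/
inductive Prog
  /-- `const r c` : put the number `c` in register `r` -/
  | const (r c : ℕ)
  /-- `op o r a b` : put in register `r` the result of `o` on the registers `a` and `b` -/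
  | op (o : Op) (r a b : ℕ)
  /-- `load r A i` : put in register `r` the entry of array `A` at the index held by register `i` -/
  | load (r A i : ℕ)
  /-- `store A i r` : put the value of register `r` in array `A` at the index held by register `i` -/
  | store (A i r : ℕ)
  /-- `call k A a B b` : call procedure `k` on the list of the first entries of array `A`, as many as
  register `a` says; write its output at the beginning of array `B`, and the length of the output in
  register `b` -/
  | call (k A a B b : ℕ)
  /-- do nothing -/
  | skip
  /-- one program after the other -/
  | seq (P Q : Prog)
  /-- `branch r P Q` : execute `P` if register `r` is not zero, and `Q` otherwise -/
  | branch (r : ℕ) (P Q : Prog)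
  /-- `loop r P` : execute `P` as long as register `r` is not zero -/
  | loop (r : ℕ) (P : Prog)

/-- The contents of the memory. -/
structure Memory where
  /-- the scalar registers -/
  reg : ℕ → ℕ
  /-- the arrays: `arr A i` is the entry of array `A` at index `i` -/
  arr : ℕ → ℕ → ℕ

/-- Write `v` in register `r`. -/
def Memory.setReg (s : Memory) (r v : ℕ) : Memory :=
  { s with reg := Function.update s.reg r v }

/-- Write `v` in array `A` at index `i`. -/
def Memory.setArr (s : Memory) (A i v : ℕ) : Memory :=
  { s with arr := Function.update s.arr A (Function.update (s.arr A) i v) }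

/-- Write the list `l` at the beginning of array `A`. -/
def Memory.setList (s : Memory) (A : ℕ) (l : List ℕ) : Memory :=
  { s with arr := Function.update s.arr A (fun i => l.getD i (s.arr A i)) }

/-- The list of the first `n` entries of array `A`. -/
def Memory.getList (s : Memory) (A n : ℕ) : List ℕ := (List.range n).map (s.arr A)

/-- The behaviour of a procedure: `R input output cost` holds when the procedure terminates on
`input` with `output`, after `cost` bit operations. -/
abbrev Behaviour := List ℕ → List ℕ → ℕ → Prop

/-- `Exec env P s s' c` : with the behaviours `env` of the external procedures, the program `P`
started with the memory `s` terminates with the memory `s'` after `c` bit operations. -/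
inductive Exec (env : ℕ → Behaviour) : Prog → Memory → Memory → ℕ → Prop
  | const (s : Memory) (r c : ℕ) : Exec env (.const r c) s (s.setReg r c) (len c)
  | op (s : Memory) (o : Op) (r a b : ℕ) :
      Exec env (.op o r a b) s (s.setReg r (o.eval (s.reg a) (s.reg b)))
        (o.cost (s.reg a) (s.reg b))
  | load (s : Memory) (r A i : ℕ) :
      Exec env (.load r A i) s (s.setReg r (s.arr A (s.reg i)))
        (len (s.reg i) + len (s.arr A (s.reg i)))
  | store (s : Memory) (A i r : ℕ) :
      Exec env (.store A i r) s (s.setArr A (s.reg i) (s.reg r)) (len (s.reg i) + len (s.reg r))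
  | call (s : Memory) (k A a B b : ℕ) (out : List ℕ) (c : ℕ)
      (h : env k (s.getList A (s.reg a)) out c) :
      Exec env (.call k A a B b) s ((s.setList B out).setReg b out.length)
        (len (s.reg a) + c + len out.length)
  | skip (s : Memory) : Exec env .skip s s 1
  | seq (P Q : Prog) (s s' s'' : Memory) (c d : ℕ) (hP : Exec env P s s' c)
      (hQ : Exec env Q s' s'' d) : Exec env (.seq P Q) s s'' (c + d)
  | branchTrue (r : ℕ) (P Q : Prog) (s s' : Memory) (c : ℕ) (hr : s.reg r ≠ 0)
      (hP : Exec env P s s' c) : Exec env (.branch r P Q) s s' (len (s.reg r) + c)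
  | branchFalse (r : ℕ) (P Q : Prog) (s s' : Memory) (c : ℕ) (hr : s.reg r = 0)
      (hQ : Exec env Q s s' c) : Exec env (.branch r P Q) s s' (len (s.reg r) + c)
  | loopEnd (r : ℕ) (P : Prog) (s : Memory) (hr : s.reg r = 0) :
      Exec env (.loop r P) s s (len (s.reg r))
  | loopNext (r : ℕ) (P : Prog) (s s' s'' : Memory) (c d : ℕ) (hr : s.reg r ≠ 0)
      (hP : Exec env P s s' c) (hloop : Exec env (.loop r P) s' s'' d) :
      Exec env (.loop r P) s s'' (len (s.reg r) + c + d)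

/-- The memory at the start: the input is in array `0`, its length is in register `0`, and
everything else is zero. -/
def initial (inp : List ℕ) : Memory where
  reg := fun r => if r = 0 then inp.length else 0
  arr := fun A i => if A = 0 then inp.getD i 0 else 0

/-- The behaviour of the program `P`. At the end, the output is at the beginning of array `0`, and
its length is in register `0`. Reading the input and writing the output are charged. -/
def behaviour (env : ℕ → Behaviour) (P : Prog) : Behaviour := fun inp out cost =>
  ∃ (s : Memory) (c : ℕ), Exec env P (initial inp) s c ∧ out = s.getList 0 (s.reg 0) ∧
    cost = listLen inp + c + listLen out

/-- No external procedure is available (every call fails). -/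
def noProc : ℕ → Behaviour := fun _ _ _ _ => False

/-- The external procedures `0` and `1` are the programs `P` and `Q`, which call no procedure
themselves. Each execution works in a memory of its own. -/
def twoProcs (P Q : Prog) : ℕ → Behaviour
  | 0 => behaviour noProc P
  | 1 => behaviour noProc Q
  | _ => noProc 0

end BitRAM

/-! ## Polynomials and power series as data -/

/-- The list of the first `m` terms of a sequence of elements of `ℤ/qℤ`, each one represented by
its residue between `0` and `q - 1`. -/
def residues {q : ℕ} (m : ℕ) (a : ℕ → ZMod q) : List ℕ := (List.range m).map fun i => (a i).val

/-- A power series over `ℤ_p` given modulo `(p ^ ℓ, t ^ m)`. -/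
noncomputable def truncation {p : ℕ} [Fact p.Prime] (ℓ m : ℕ) (f : ℤ_[p]⟦X⟧) : List ℕ :=
  residues m fun i => PadicInt.toZModPow ℓ (PowerSeries.coeff i f)

/-- The numbers that describe the precision `(p ^ ℓ, t ^ m)`. -/
def precisionData (p ℓ m : ℕ) : List ℕ := [p, ℓ, p ^ ℓ, m]

/-- `f'` is an approximation modulo `(p ^ ℓ, t ^ m)` of `f`. -/
def IsApproximation {p : ℕ} [Fact p.Prime] (ℓ m : ℕ) (f f' : ℤ_[p]⟦X⟧) : Prop :=
  ∀ i < m, (p : ℤ_[p]) ^ ℓ ∣ PowerSeries.coeff i f - PowerSeries.coeff i f'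

/-- The power series with the coefficients listed in `l`. -/
noncomputable def ofList (p : ℕ) [Fact p.Prime] (l : List ℕ) : ℤ_[p]⟦X⟧ :=
  PowerSeries.mk fun i => (l.getD i 0 : ℤ_[p])

/-- The program `P` computes the product of two polynomials of degree (at most) `m` with
coefficients in `ℤ/p ^ ℓ ℤ`, using at most `M (p ^ ℓ) m` bit operations. -/
def MultipliesWithCost (p : ℕ) (P : BitRAM.Prog) (M : ℕ → ℕ → ℕ) : Prop :=
  ∀ ℓ m : ℕ, 1 ≤ ℓ → 1 ≤ m → ∀ a b : Polynomial (ZMod (p ^ ℓ)),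
    a.natDegree ≤ m → b.natDegree ≤ m →
    ∃ c ≤ M (p ^ ℓ) m, BitRAM.behaviour BitRAM.noProc P
      (precisionData p ℓ m ++ residues (m + 1) a.coeff ++ residues (m + 1) b.coeff)
      (residues (2 * m + 1) (a * b).coeff) c

/-- The program `P` computes the composition `h(f)` modulo `(p ^ ℓ, t ^ m)`, given modulo
`(p ^ ℓ, t ^ m)` the series `h` and any series `f` without constant term, using at most
`C (p ^ ℓ) m` bit operations. -/
def ComposesWithCost {p : ℕ} [Fact p.Prime] (h : ℤ_[p]⟦X⟧) (P : BitRAM.Prog)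
    (C : ℕ → ℕ → ℕ) : Prop :=
  ∀ ℓ m : ℕ, 1 ≤ ℓ → 1 ≤ m → ∀ f : ℤ_[p]⟦X⟧, PowerSeries.constantCoeff f = 0 →
    ∃ c ≤ C (p ^ ℓ) m, BitRAM.behaviour BitRAM.noProc P
      (precisionData p ℓ m ++ truncation ℓ m h ++ truncation ℓ m f)
      (truncation ℓ m (h.subst f)) c

/-- A cost function at least doubles when the size doubles. -/
def Doubling (T : ℕ → ℕ) : Prop := ∀ m, 2 ≤ m → 2 * T (m / 2) ≤ T m

/-! Correctness. With `φ = 1/h` the equation reads `φ(y) y' = g`, and an approximation `u` is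
improved to `u - h(u) ∫ (φ(u) u' - g)`. The integration divides by integers, so a naive count would
lose digits at every level. The losses do not add up, for the following reason. Put `e = y - u`.
Taylor expansion shows that the integral is `-∑ (φ^(j)(u)/j!) · e^(j+1)/(j+1)`, where `φ^(j)/j!` has
coefficients in `ℤ_p`. If `e = t^M a + p^κ b`, then modulo `t^(2M)` one has `e^j / j = (p^(κj)/j)
b^j + (p^κ b)^(j-1) t^M a`, and for `j ≥ 2` this is a multiple of `p^κ`, because `v_p(j) ≤ κ(j-1)`.
Hence the exact integral is congruent to `-φ(u) e` modulo `p^κ`, and the improved series is correct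
modulo `(p^κ, t^(2M))`: this is `exists_newton_correction`. In the computation `u` has natural
number coefficients and is regarded as an exact series, close to `y` modulo `p^κ` only. The
integrand attached to this `u` is computed modulo `p^ℓ`; dividing its coefficients by `i ≤ n` costs
at most `log_p n` digits and leaves `κ` of them (`newton_correction_residues`). The next level
starts afresh from the exact series so obtained. The inverse of `h(u)` is carried along and refined
by Newton steps of its own.

Cost. The sizes of the levels are `n, n/2, n/4, ...`, so by `Doubling.sum_le` the calls of the
procedures cost at most a constant times the call at size `n`. A multiplication procedure has to
read its input, hence `M(p^ℓ, m)` dominates `m` times the length of `p^ℓ`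
(`MultipliesWithCost.word_le`): a linear number of operations, each linear in the word length, is
harmless. So are `m` products modulo `p^ℓ`, since `m M(p^ℓ, 1) ≤ 2 M(p^ℓ, m)`
(`Doubling.succ_mul_le`). Schoolbook products and quotients of full words are quadratic in the word
length and cannot be afforded `n` times. Therefore modular products call the multiplication
procedure in degree one, and the divisions are arranged so that their costs add up to `O(n)` words.
The inverses of the integers up to `n` come from a linear sieve that divides `p^ℓ` by primes only;
the lengths of the primes up to `n` add up to `O(n)` by Chebyshev's bound on the primorial
(`sum_len_prime_le`). The lengths of the quotients `n / i` also add up to `O(n)` (`sum_len_div_le`),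
and so do those of the powers of `p` dividing the integers up to `n`, by Legendre's formula
(`sum_len_ordProj_le`). -/

/-! ## Congruences between power series -/

section Congruence

variable {A : Type*} [CommRing A]

/-- The power series that vanish modulo `(c, t ^ N)`. For `c = 0` this is the ideal `(t ^ N)`. -/
def congrIdeal (c : A) (N : ℕ) : Ideal A⟦X⟧ where
  carrier := {f | ∀ i < N, c ∣ PowerSeries.coeff i f}
  add_mem' hf hg i hi := by simpa using dvd_add (hf i hi) (hg i hi)
  zero_mem' i _ := by simp
  smul_mem' f g hg i hi := by
    simp only [smul_eq_mul, PowerSeries.coeff_mul]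
    refine Finset.dvd_sum fun x hx => Dvd.dvd.mul_left (hg _ ?_) _
    have := Finset.HasAntidiagonal.mem_antidiagonal.1 hx
    omega

theorem mem_congrIdeal {c : A} {N : ℕ} {f : A⟦X⟧} :
    f ∈ congrIdeal c N ↔ ∀ i < N, c ∣ PowerSeries.coeff i f := Iff.rfl

theorem mem_congrIdeal_zero {N : ℕ} {f : A⟦X⟧} :
    f ∈ congrIdeal (0 : A) N ↔ ∀ i < N, PowerSeries.coeff i f = 0 := by
  simp [mem_congrIdeal]

theorem congrIdeal_mono {c d : A} (h : c ∣ d) {M N : ℕ} (hMN : M ≤ N) :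
    congrIdeal d N ≤ congrIdeal c M :=
  fun _ hf i hi => h.trans (hf i (hi.trans_le hMN))

theorem congrIdeal_zero_le (c : A) (N : ℕ) : congrIdeal (0 : A) N ≤ congrIdeal c N :=
  congrIdeal_mono (dvd_zero c) le_rfl

theorem mem_congrIdeal_zero_iff_dvd {N : ℕ} {f : A⟦X⟧} :
    f ∈ congrIdeal (0 : A) N ↔ PowerSeries.X ^ N ∣ f := by
  rw [mem_congrIdeal_zero, PowerSeries.X_pow_dvd_iff]

theorem C_mul_mem_congrIdeal (c : A) (N : ℕ) (f : A⟦X⟧) :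
    PowerSeries.C c * f ∈ congrIdeal c N := fun i _ => by simp

/-- This splitting gives access to the powers of `f` modulo `t ^ (2 N)`: only the first two terms of
the binomial formula survive. -/
theorem exists_eq_of_mem_congrIdeal {c : A} {N : ℕ} {f : A⟦X⟧} (hf : f ∈ congrIdeal c N) :
    ∃ a b : A⟦X⟧, f = PowerSeries.X ^ N * a + PowerSeries.C c * b := by
  choose! g hg using hf
  refine ⟨PowerSeries.mk fun i => PowerSeries.coeff (i + N) f,
    PowerSeries.mk fun i => if i < N then g i else 0, ?_⟩
  ext i
  rcases lt_or_ge i N with hi | hi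
  · simp [PowerSeries.coeff_X_pow_mul', hi, hg i hi, not_le.2 hi]
  · simp [PowerSeries.coeff_X_pow_mul', hi, not_lt.2 hi]

theorem derivative_mem_congrIdeal {c : A} {N : ℕ} {f : A⟦X⟧} (hf : f ∈ congrIdeal c (N + 1)) :
    PowerSeries.derivative A f ∈ congrIdeal c N := fun i hi => by
  rw [PowerSeries.coeff_derivative]
  exact (hf _ (by omega)).mul_right _

theorem pow_mem_congrIdeal_zero {a : A⟦X⟧} (ha : PowerSeries.constantCoeff a = 0) {N k : ℕ}
    (h : N ≤ k) : a ^ k ∈ congrIdeal (0 : A) N := by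
  rw [mem_congrIdeal_zero_iff_dvd]
  exact (pow_dvd_pow _ h).trans (pow_dvd_pow_of_dvd (PowerSeries.X_dvd_iff.2 ha) _)

/-- Powers `a ^ k` with `k ≥ N` vanish modulo `t ^ N`. Substitution thus becomes a finite sum, to
which statements about single powers extend linearly. -/
theorem subst_sub_sum_mem_congrIdeal (h : A⟦X⟧) {a : A⟦X⟧}
    (ha : PowerSeries.constantCoeff a = 0) (N : ℕ) :
    h.subst a - ∑ k ∈ Finset.range N, PowerSeries.C (PowerSeries.coeff k h) * a ^ k
      ∈ congrIdeal (0 : A) N := by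
  rw [mem_congrIdeal_zero]
  intro i hi
  rw [map_sub, PowerSeries.coeff_subst' (PowerSeries.HasSubst.of_constantCoeff_zero' ha),
    finsum_eq_sum_of_support_subset (s := Finset.range N)]
  · simp
  · intro d hd
    by_contra hdN
    refine hd ?_
    have := mem_congrIdeal_zero.1 (pow_mem_congrIdeal_zero ha (N := N) (k := d) (by simpa using hdN))
    simp [this i hi]

theorem subst_sub_subst_mem_congrIdeal (h : A⟦X⟧) {a b : A⟦X⟧}
    (ha : PowerSeries.constantCoeff a = 0) (hb : PowerSeries.constantCoeff b = 0) {c : A} {N : ℕ}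
    (hab : a - b ∈ congrIdeal c N) : h.subst a - h.subst b ∈ congrIdeal c N := by
  have h1 := congrIdeal_zero_le c N (subst_sub_sum_mem_congrIdeal h ha N)
  have h2 := congrIdeal_zero_le c N (subst_sub_sum_mem_congrIdeal h hb N)
  have h3 : ∑ k ∈ Finset.range N, PowerSeries.C (PowerSeries.coeff k h) * a ^ k -
      ∑ k ∈ Finset.range N, PowerSeries.C (PowerSeries.coeff k h) * b ^ k ∈ congrIdeal c N := by
    rw [← Finset.sum_sub_distrib]
    refine Ideal.sum_mem _ fun k _ => ?_
    rw [← mul_sub]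
    exact Ideal.mul_mem_left _ _ (Ideal.mem_of_dvd _ (sub_dvd_pow_sub_pow a b k) hab)
  have := add_mem (sub_mem h1 h2) h3
  convert this using 1
  ring

end Congruence

/-! ## The Newton step for `y' = g · h(y)` over the `p`-adic integers -/

section Newton

variable {p : ℕ} [Fact p.Prime]

theorem PadicInt.isUnit_natCast_of_not_dvd {w : ℕ} (hw : ¬ p ∣ w) : IsUnit (w : ℤ_[p]) := by
  by_contra h
  rw [PadicInt.not_isUnit_iff] at h
  exact hw ((PadicInt.norm_natCast_lt_one_iff (p := p)).1 h)

/-- Here `c = p ^ (κ j) / j`. The part of `j` prime to `p` is a unit, and `v_p(j) ≤ j - 1 ≤ κ (j -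
1)` leaves a factor `p ^ κ`. -/
theorem exists_natCast_mul_eq_pow {κ j : ℕ} (hκ : 0 < κ) (hj : 2 ≤ j) :
    ∃ c : ℤ_[p], (p : ℤ_[p]) ^ κ ∣ c ∧ j * c = (p : ℤ_[p]) ^ (κ * j) := by
  have hp : p.Prime := Fact.out
  obtain ⟨w, hw⟩ := PadicInt.isUnit_natCast_of_not_dvd (p := p) (w := j / p ^ j.factorization p)
    (Nat.not_dvd_ordCompl hp (by omega))
  have hv : j.factorization p < j := Nat.factorization_lt p (by omega)
  have hle : j.factorization p + κ ≤ κ * j := by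
    obtain ⟨k, rfl⟩ : ∃ k, j = k + 1 := ⟨j - 1, by omega⟩
    nlinarith
  refine ⟨(p : ℤ_[p]) ^ (κ * j - j.factorization p) * (w⁻¹ : ℤ_[p]ˣ),
    Dvd.dvd.mul_right (pow_dvd_pow _ (by omega)) _, ?_⟩
  have hj' : (j : ℤ_[p]) = (p : ℤ_[p]) ^ j.factorization p * w := by
    rw [hw, ← Nat.cast_pow, ← Nat.cast_mul, Nat.ordProj_mul_ordCompl_eq_self]
  calc (j : ℤ_[p]) * _ = (p : ℤ_[p]) ^ j.factorization p * (p : ℤ_[p]) ^ (κ * j - j.factorization p)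
        * (w * (w⁻¹ : ℤ_[p]ˣ)) := by rw [hj']; ring
    _ = _ := by rw [← pow_add, Units.mul_inv, mul_one]; congr 1; omega

/-- `ε` plays the role of `e ^ j / j`. In the binomial expansion of `(p ^ κ b + t ^ M a) ^ j` modulo
`t ^ (2 M)`, the linear term already carries the factor `j`, and the term `(p ^ κ b) ^ j` is divided
with the preceding lemma. For `j ≥ 2` both quotients are multiples of `p ^ κ`. -/
theorem exists_natCast_mul_sub_pow_mem {κ j M : ℕ} (hκ : 0 < κ) (hj : 2 ≤ j) {e : ℤ_[p]⟦X⟧}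
    (he : e ∈ congrIdeal ((p : ℤ_[p]) ^ κ) M) (N : ℕ) :
    ∃ ε ∈ congrIdeal ((p : ℤ_[p]) ^ κ) N, j * ε - e ^ j ∈ congrIdeal (0 : ℤ_[p]) (2 * M) := by
  obtain ⟨a, b, rfl⟩ := exists_eq_of_mem_congrIdeal he
  obtain ⟨c, hc, hjc⟩ := exists_natCast_mul_eq_pow (p := p) hκ hj
  obtain ⟨k, hk⟩ := Polynomial.powAddExpansion (PowerSeries.C ((p : ℤ_[p]) ^ κ) * b)
    (PowerSeries.X ^ M * a) j
  refine ⟨PowerSeries.C c * b ^ j + (PowerSeries.C ((p : ℤ_[p]) ^ κ) * b) ^ (j - 1) *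
    (PowerSeries.X ^ M * a), add_mem ?_ ?_, ?_⟩
  · exact congrIdeal_mono hc le_rfl (C_mul_mem_congrIdeal c N _)
  · refine Ideal.mul_mem_right _ _ (Ideal.pow_mem_of_mem _ (C_mul_mem_congrIdeal _ _ _) _ ?_)
    omega
  · rw [mem_congrIdeal_zero_iff_dvd]
    refine ⟨-(k * a ^ 2), ?_⟩
    have h1 : (j : ℤ_[p]⟦X⟧) * (PowerSeries.C c * b ^ j)
        = (PowerSeries.C ((p : ℤ_[p]) ^ κ) * b) ^ j := by
      rw [mul_pow, ← map_pow, ← pow_mul, ← hjc]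
      simp [mul_assoc]
    rw [add_comm (PowerSeries.X ^ M * a), hk, mul_add, h1, pow_mul']
    ring

/-- The Newton step for `φ = t ^ k`. `Z` represents `(u ^ (k+1) - (u + e) ^ (k+1)) / (k+1)`: by
`choose (k+1) (j+1) / (k+1) = choose k j / (j+1)`, its binomial expansion involves `e` only through
`e ^ (j+1) / (j+1)`, for which `ε j` is substituted. All terms except `-u ^ k e`, from `j = 0`, are
multiples of `p ^ κ`. -/
theorem exists_antiderivative_pow {κ M N : ℕ} (hκ : 0 < κ) {u e : ℤ_[p]⟦X⟧}
    (he : e ∈ congrIdeal ((p : ℤ_[p]) ^ κ) M) (hN : N + 1 ≤ 2 * M) (k : ℕ) :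
    ∃ Z : ℤ_[p]⟦X⟧, Z + u ^ k * e ∈ congrIdeal ((p : ℤ_[p]) ^ κ) (N + 1) ∧
      PowerSeries.derivative ℤ_[p] Z - (u ^ k * PowerSeries.derivative ℤ_[p] u -
        (u + e) ^ k * PowerSeries.derivative ℤ_[p] (u + e)) ∈ congrIdeal (0 : ℤ_[p]) N := by
  have hε : ∀ j : ℕ, ∃ ε : ℤ_[p]⟦X⟧,
      (j + 1 : ℕ) * ε - e ^ (j + 1) ∈ congrIdeal (0 : ℤ_[p]) (N + 1) ∧
      (j = 0 → ε = e) ∧ (j ≠ 0 → ε ∈ congrIdeal ((p : ℤ_[p]) ^ κ) (N + 1)) := by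
    intro j
    rcases eq_or_ne j 0 with rfl | hj
    · exact ⟨e, by simp⟩
    · obtain ⟨ε, h1, h2⟩ := exists_natCast_mul_sub_pow_mem hκ (j := j + 1) (by omega) he (N + 1)
      exact ⟨ε, congrIdeal_mono dvd_rfl hN h2, by simp [hj], fun _ => h1⟩
  choose ε hε h0 h1 using hε
  set Z := -∑ j ∈ Finset.range (k + 1), (k.choose j : ℤ_[p]⟦X⟧) * u ^ (k - j) * ε j with hZ
  have hmul : ((k + 1 : ℕ) : ℤ_[p]⟦X⟧) * Z - (u ^ (k + 1) - (u + e) ^ (k + 1))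
      ∈ congrIdeal (0 : ℤ_[p]) (N + 1) := by
    have : ((k + 1 : ℕ) : ℤ_[p]⟦X⟧) * Z - (u ^ (k + 1) - (u + e) ^ (k + 1)) =
        -∑ j ∈ Finset.range (k + 1), ((k + 1).choose (j + 1) : ℤ_[p]⟦X⟧) * u ^ (k - j) *
          ((j + 1 : ℕ) * ε j - e ^ (j + 1)) := by
      rw [add_comm u e, add_pow, Finset.sum_range_succ', hZ, mul_neg, Finset.mul_sum]
      simp only [mul_sub, Finset.sum_sub_distrib]
      have : ∀ j, ((k + 1 : ℕ) : ℤ_[p]⟦X⟧) * ((k.choose j : ℤ_[p]⟦X⟧) * u ^ (k - j) * ε j) =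
          ((k + 1).choose (j + 1) : ℤ_[p]⟦X⟧) * u ^ (k - j) * ((j + 1 : ℕ) * ε j) := by
        intro j
        have := congrArg (Nat.cast : ℕ → ℤ_[p]⟦X⟧) (Nat.add_one_mul_choose_eq k j)
        push_cast at this ⊢
        linear_combination (u ^ (k - j) * ε j) * this
      simp only [this, Nat.add_sub_add_right]
      have : ∀ j, ((k + 1).choose (j + 1) : ℤ_[p]⟦X⟧) * u ^ (k - j) * e ^ (j + 1) =
          e ^ (j + 1) * u ^ (k - j) * ((k + 1).choose (j + 1) : ℤ_[p]⟦X⟧) := fun j => by ring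
      simp only [this]
      simp
      ring
    rw [this]
    exact neg_mem (Ideal.sum_mem _ fun j _ => Ideal.mul_mem_left _ _ (hε j))
  refine ⟨Z, ?_, ?_⟩
  · rw [hZ, Finset.sum_range_succ', h0 0 rfl]
    have : -(∑ j ∈ Finset.range k, (k.choose (j + 1) : ℤ_[p]⟦X⟧) * u ^ (k - (j + 1)) * ε (j + 1)
        + (k.choose 0 : ℤ_[p]⟦X⟧) * u ^ (k - 0) * e) + u ^ k * e =
        -∑ j ∈ Finset.range k, (k.choose (j + 1) : ℤ_[p]⟦X⟧) * u ^ (k - (j + 1)) * ε (j + 1) := by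
      simp
    rw [this]
    exact neg_mem (Ideal.sum_mem _ fun j _ => Ideal.mul_mem_left _ _ (h1 _ (by omega)))
  · have h2 := derivative_mem_congrIdeal hmul
    rw [mem_congrIdeal_zero] at h2 ⊢
    intro i hi
    have h3 := h2 i hi
    have h4 : PowerSeries.derivative ℤ_[p]
        (((k + 1 : ℕ) : ℤ_[p]⟦X⟧) * Z - (u ^ (k + 1) - (u + e) ^ (k + 1))) =
        PowerSeries.C ((k + 1 : ℕ) : ℤ_[p]) * (PowerSeries.derivative ℤ_[p] Z -
        (u ^ k * PowerSeries.derivative ℤ_[p] u -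
        (u + e) ^ k * PowerSeries.derivative ℤ_[p] (u + e))) := by
      rw [map_sub, map_sub, PowerSeries.derivative_pow, PowerSeries.derivative_pow,
        Derivation.leibniz]
      simp
      ring
    rw [h4, PowerSeries.coeff_C_mul] at h3
    -- The factor `k + 1` is cancelled in characteristic zero, so no power of `p` is lost here.
    exact (mul_eq_zero.1 h3).resolve_left (by exact_mod_cast Nat.succ_ne_zero k)

/-- The Newton step: if `u` approximates the solution `y` of `y' = g · h(y)` modulo
`(p ^ κ, t ^ M)`, then `u - h(u) ∫ (u' / h(u) - g)` approximates it modulo `(p ^ κ, t ^ (2 M))`. -/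
theorem exists_newton_correction {κ M N : ℕ} (hκ : 0 < κ) (hN : N + 1 ≤ 2 * M)
    {g h y u ψ : ℤ_[p]⟦X⟧} (h0 : PowerSeries.constantCoeff h = 1)
    (hy0 : PowerSeries.constantCoeff y = 0) (hu0 : PowerSeries.constantCoeff u = 0)
    (hy : PowerSeries.derivative ℤ_[p] y = g * h.subst y)
    (hu : y - u ∈ congrIdeal ((p : ℤ_[p]) ^ κ) M) (hψ : ψ * h.subst u = 1) :
    ∃ Z : ℤ_[p]⟦X⟧,
      PowerSeries.derivative ℤ_[p] Z - (PowerSeries.derivative ℤ_[p] u * ψ - g)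
        ∈ congrIdeal (0 : ℤ_[p]) N ∧
      Z + ψ * (y - u) ∈ congrIdeal ((p : ℤ_[p]) ^ κ) (N + 1) := by
  set φ := PowerSeries.invOfUnit h 1
  have hφ : h * φ = 1 := PowerSeries.mul_invOfUnit h 1 (by simpa using h0)
  have key : ∀ a : ℤ_[p]⟦X⟧, PowerSeries.constantCoeff a = 0 → h.subst a * φ.subst a = 1 := by
    intro a ha
    rw [← PowerSeries.subst_mul (PowerSeries.HasSubst.of_constantCoeff_zero' ha), hφ,
      ← PowerSeries.coe_substAlgHom (PowerSeries.HasSubst.of_constantCoeff_zero' ha), map_one]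
  have hψ' : ψ = φ.subst u := by
    linear_combination (φ.subst u) * hψ - ψ * key u hu0
  have hg : PowerSeries.derivative ℤ_[p] y * φ.subst y = g := by
    rw [hy, mul_assoc, key y hy0, mul_one]
  have hZ := fun k => exists_antiderivative_pow (u := u) hκ hu hN k
  simp only [add_sub_cancel] at hZ
  choose Z hZ1 hZ2 using hZ
  have hsu := subst_sub_sum_mem_congrIdeal φ hu0 (N + 1)
  have hsy := subst_sub_sum_mem_congrIdeal φ hy0 (N + 1)
  -- The solutions for the monomials `t ^ k` are combined with the coefficients of `φ = 1/h`; higher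
  -- monomials do not matter at this precision.
  refine ⟨∑ k ∈ Finset.range (N + 1), PowerSeries.C (PowerSeries.coeff k φ) * Z k, ?_, ?_⟩
  · have h1 : ∑ k ∈ Finset.range (N + 1), PowerSeries.C (PowerSeries.coeff k φ) *
        (PowerSeries.derivative ℤ_[p] (Z k) - (u ^ k * PowerSeries.derivative ℤ_[p] u -
        y ^ k * PowerSeries.derivative ℤ_[p] y)) ∈ congrIdeal (0 : ℤ_[p]) N :=
      Ideal.sum_mem _ fun k _ => Ideal.mul_mem_left _ _ (hZ2 k)
    have h2 := congrIdeal_mono dvd_rfl (Nat.le_succ N) (Ideal.mul_mem_left _ (PowerSeries.derivative ℤ_[p] u) hsu)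
    have h3 := congrIdeal_mono dvd_rfl (Nat.le_succ N) (Ideal.mul_mem_left _ (PowerSeries.derivative ℤ_[p] y) hsy)
    convert add_mem (sub_mem h1 h2) h3 using 1
    rw [hψ', ← hg]
    simp only [map_sum, Derivation.leibniz, mul_sub, Finset.sum_sub_distrib, Finset.mul_sum,
      PowerSeries.derivative_C, smul_eq_mul, mul_zero, add_zero]
    have : ∀ a : ℤ_[p]⟦X⟧, ∀ k, PowerSeries.C (PowerSeries.coeff k φ) *
        (a ^ k * PowerSeries.derivative ℤ_[p] a) = PowerSeries.derivative ℤ_[p] a *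
        (PowerSeries.C (PowerSeries.coeff k φ) * a ^ k) := fun a k => by ring
    simp only [this]
    ring
  · have h1 : ∑ k ∈ Finset.range (N + 1), PowerSeries.C (PowerSeries.coeff k φ) *
        (Z k + u ^ k * (y - u)) ∈ congrIdeal ((p : ℤ_[p]) ^ κ) (N + 1) :=
      Ideal.sum_mem _ fun k _ => Ideal.mul_mem_left _ _ (hZ1 k)
    have h2 := congrIdeal_zero_le ((p : ℤ_[p]) ^ κ) (N + 1) (Ideal.mul_mem_left _ (y - u) hsu)
    convert add_mem h1 h2 using 1
    rw [hψ']
    simp only [mul_add, Finset.sum_add_distrib, mul_sub, Finset.mul_sum]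
    have : ∀ k, PowerSeries.C (PowerSeries.coeff k φ) * (u ^ k * y) =
        y * (PowerSeries.C (PowerSeries.coeff k φ) * u ^ k) := fun k => by ring
    have : ∀ k, PowerSeries.C (PowerSeries.coeff k φ) * (u ^ k * u) =
        u * (PowerSeries.C (PowerSeries.coeff k φ) * u ^ k) := fun k => by ring
    simp only [*, sub_mul, Finset.sum_sub_distrib]
    ring

end Newton

/-! ### The Newton step on residues modulo `p ^ ℓ`. -/

section Residues

variable {p : ℕ} [Fact p.Prime]

theorem toZModPow_eq_zero_iff {ℓ : ℕ} {a : ℤ_[p]} :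
    PadicInt.toZModPow ℓ a = 0 ↔ (p : ℤ_[p]) ^ ℓ ∣ a := by
  rw [← RingHom.mem_ker, PadicInt.ker_toZModPow, Ideal.mem_span_singleton]

theorem pow_dvd_sub_val {ℓ : ℕ} {a : ℤ_[p]} {x : ZMod (p ^ ℓ)} (h : PadicInt.toZModPow ℓ a = x) :
    (p : ℤ_[p]) ^ ℓ ∣ a - x.val := by
  have : NeZero (p ^ ℓ) := ⟨pow_ne_zero _ (Fact.out : p.Prime).ne_zero⟩
  rw [← toZModPow_eq_zero_iff, map_sub, h, map_natCast, ZMod.natCast_zmod_val, sub_self]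

/-- Division of a residue modulo `p ^ ℓ` by `i = d * w`, where `d` is a power of `p`. -/
theorem pow_dvd_div_mul_sub {κ ℓ v w : ℕ} (hv : κ + v ≤ ℓ) {r : ZMod (p ^ ℓ)} {a b : ℤ_[p]}
    (hr : PadicInt.toZModPow ℓ a = r) (hab : a = b * (p ^ v * w : ℕ)) {c : ZMod (p ^ ℓ)}
    (hc : c * w = 1) :
    (p : ℤ_[p]) ^ κ ∣ ((((r.val / p ^ v : ℕ) : ZMod (p ^ ℓ)) * c).val : ℤ_[p]) - b := by
  have : NeZero (p ^ ℓ) := ⟨pow_ne_zero _ (Fact.out : p.Prime).ne_zero⟩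
  have hp : (p : ℤ_[p]) ≠ 0 := by exact_mod_cast (Fact.out : p.Prime).ne_zero
  obtain ⟨x, hx⟩ := pow_dvd_sub_val hr
  have hpl : (p : ℤ_[p]) ^ ℓ = (p : ℤ_[p]) ^ v * (p : ℤ_[p]) ^ (ℓ - v) := by
    rw [← pow_add]; congr 1; omega
  -- `p ^ v` divides both `a` and `p ^ ℓ`, so the integer division of the representative is exact.
  -- Its quotient determines `b w` modulo `p ^ (ℓ - v)` only, which suffices because `κ ≤ ℓ - v`.
  have hdvd : p ^ v ∣ r.val := by
    have h1 : (p : ℤ_[p]) ^ v ∣ (r.val : ℤ_[p]) := by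
      refine ⟨b * w - (p : ℤ_[p]) ^ (ℓ - v) * x, ?_⟩
      rw [hab, hpl] at hx
      push_cast at hx
      linear_combination -hx
    rw [← toZModPow_eq_zero_iff, map_natCast] at h1
    exact (ZMod.natCast_eq_zero_iff _ _).1 h1
  obtain ⟨s, hs⟩ := hdvd
  have hsd : r.val / p ^ v = s := by
    rw [hs, Nat.mul_div_cancel_left _ (pow_pos (Fact.out : p.Prime).pos _)]
  rw [hsd]
  have hsb : (s : ℤ_[p]) = b * w - (p : ℤ_[p]) ^ (ℓ - v) * x := by
    refine mul_left_cancel₀ (pow_ne_zero v hp) ?_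
    rw [hab, hpl, hs] at hx
    push_cast at hx
    linear_combination -hx
  obtain ⟨t, ht⟩ := pow_dvd_sub_val (p := p) (ℓ := ℓ) (a := (s * c.val : ℕ)) (x := s * c)
    (by simp)
  obtain ⟨t', ht'⟩ := pow_dvd_sub_val (p := p) (ℓ := ℓ) (a := (c.val * w : ℕ)) (x := c * w)
    (by simp)
  rw [hc] at ht'
  have h1 : (p : ℤ_[p]) ^ κ ∣ (p : ℤ_[p]) ^ ℓ := pow_dvd_pow _ (by omega)
  have h2 : (p : ℤ_[p]) ^ κ ∣ (p : ℤ_[p]) ^ (ℓ - v) := pow_dvd_pow _ (by omega)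
  -- Only a congruence: for `ℓ = 0` the representative of `1` is `0`.
  have hone : (p : ℤ_[p]) ^ ℓ ∣ ((1 : ZMod (p ^ ℓ)).val : ℤ_[p]) - 1 := by
    obtain ⟨t, ht⟩ := pow_dvd_sub_val (p := p) (ℓ := ℓ) (a := 1) (x := 1) (by simp)
    exact ⟨-t, by linear_combination -ht⟩
  obtain ⟨t'', ht''⟩ := hone
  have : (((s : ZMod (p ^ ℓ)) * c).val : ℤ_[p]) - b =
      (p : ℤ_[p]) ^ ℓ * (b * (t' + t'') - t) - (p : ℤ_[p]) ^ (ℓ - v) * (x * c.val) := by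
    push_cast at ht ht'
    linear_combination -ht + b * ht' + b * ht'' + (c.val : ℤ_[p]) * hsb
  rw [this]
  exact dvd_sub (h1.mul_right _) (h2.mul_right _)

/-- The series `u` is close to `y` modulo `p ^ κ` only, yet `h(u)`, `u'` and `g` enter modulo `p ^
ℓ`. Division by `i ≤ n` loses `v_p(i) ≤ log_p n` digits, which is exactly the excess of `ℓ` over
`κ`. -/
theorem newton_correction_residues {κ ℓ n m : ℕ} (hκ : 0 < κ) (hℓ : ℓ = κ + Nat.log p n)
    (hm : m ≤ n) {g h y u : ℤ_[p]⟦X⟧} (h0 : PowerSeries.constantCoeff h = 1)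
    (hy0 : PowerSeries.constantCoeff y = 0) (hu0 : PowerSeries.constantCoeff u = 0)
    (hy : PowerSeries.derivative ℤ_[p] y = g * h.subst y)
    (hu : y - u ∈ congrIdeal ((p : ℤ_[p]) ^ κ) (m / 2 + 1))
    {f v z : (ZMod (p ^ ℓ))⟦X⟧}
    (hf : PowerSeries.map (PadicInt.toZModPow ℓ) (h.subst u) - f ∈ congrIdeal 0 m)
    (hv : f * v - 1 ∈ congrIdeal 0 m) {r inv : ℕ → ZMod (p ^ ℓ)}
    (hr : ∀ i < m, r i = PowerSeries.coeff i
      (PowerSeries.derivative _ (PowerSeries.map (PadicInt.toZModPow ℓ) u) * v -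
        PowerSeries.map (PadicInt.toZModPow ℓ) g))
    (hinv : ∀ i, 1 ≤ i → i ≤ m → inv i * (ordCompl[p] i : ℕ) = 1)
    (hz0 : PowerSeries.coeff 0 z = 0)
    (hz : ∀ i < m, PowerSeries.coeff (i + 1) z =
      (((r i).val / ordProj[p] (i + 1) : ℕ) : ZMod (p ^ ℓ)) * inv (i + 1)) :
    ∀ j ≤ m, (p : ℤ_[p]) ^ κ ∣ PowerSeries.coeff j y - PowerSeries.coeff j u +
      ((PowerSeries.coeff j (f * z)).val : ℤ_[p]) := by
  have hp : p.Prime := Fact.out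
  have : NeZero (p ^ ℓ) := ⟨pow_ne_zero _ hp.ne_zero⟩
  set π := PadicInt.toZModPow (p := p) ℓ
  obtain ⟨ψ, hψ⟩ : ∃ ψ : ℤ_[p]⟦X⟧, ψ * h.subst u = 1 := by
    have hs := PowerSeries.HasSubst.of_constantCoeff_zero' hu0
    refine ⟨(PowerSeries.invOfUnit h 1).subst u, ?_⟩
    rw [mul_comm, ← PowerSeries.subst_mul hs,
      PowerSeries.mul_invOfUnit h 1 (by simpa using h0), ← PowerSeries.coe_substAlgHom hs, map_one]
  obtain ⟨Z, hZ1, hZ2⟩ := exists_newton_correction (N := m) hκ (by omega) h0 hy0 hu0 hy hu hψ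
  have hψ' : PowerSeries.map π ψ * PowerSeries.map π (h.subst u) = 1 := by
    rw [← map_mul, hψ, map_one]
  have hvψ : v - PowerSeries.map π ψ ∈ congrIdeal 0 m := by
    have : v - PowerSeries.map π ψ = PowerSeries.map π ψ *
        (v * (PowerSeries.map π (h.subst u) - f) + (f * v - 1)) := by
      linear_combination (-v) * hψ'
    rw [this]
    exact Ideal.mul_mem_left _ _ (add_mem (Ideal.mul_mem_left _ _ hf) hv)
  have hrZ : ∀ i < m, π (PowerSeries.coeff (i + 1) Z * (i + 1 : ℕ)) = r i := by
    intro i hi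
    have h1 := mem_congrIdeal_zero.1 hZ1 i hi
    rw [map_sub, PowerSeries.coeff_derivative, sub_eq_zero] at h1
    have h2 := mem_congrIdeal_zero.1 (Ideal.mul_mem_left _ (PowerSeries.derivative _
      (PowerSeries.map π u)) hvψ) i hi
    have h3 : PowerSeries.derivative _ (PowerSeries.map π u) =
        PowerSeries.map π (PowerSeries.derivative _ u) := by
      ext k; simp [PowerSeries.coeff_derivative]
    push_cast
    rw [hr i hi, h1, ← sub_eq_zero, ← PowerSeries.coeff_map, map_sub, map_mul, ← h3, ← map_sub,
      ← neg_eq_zero, ← map_neg]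
    convert h2 using 2
    ring
  set z' : ℤ_[p]⟦X⟧ := PowerSeries.mk fun i => ((PowerSeries.coeff i z).val : ℤ_[p])
  have hzz' : PowerSeries.map π z' = z := by
    ext i; simp [z', π]
  have hz'Z : z' - Z ∈ congrIdeal ((p : ℤ_[p]) ^ κ) (m + 1) := by
    intro i hi
    rcases i with _ | i
    -- The antiderivative `Z` is not normalized at `0`, but its constant term is a multiple of `p ^
    -- κ` because `y - u` has none.
    · have h1 := hZ2 0 (by omega)
      have h2 : PowerSeries.coeff 0 (ψ * (y - u)) = 0 := by simp [hy0, hu0]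
      rw [map_add, h2, add_zero] at h1
      rw [map_sub]
      exact dvd_sub (by simp only [z', PowerSeries.coeff_mk, hz0]; simp) h1
    · rw [map_sub, PowerSeries.coeff_mk, hz i (by omega)]
      refine pow_dvd_div_mul_sub ?_ (hrZ i (by omega)) ?_ (hinv (i + 1) (by omega) (by omega))
      · have : (i + 1).factorization p ≤ Nat.log p n :=
          Nat.le_log_of_pow_le hp.one_lt ((Nat.ordProj_le p (by omega)).trans (by omega))
        omega
      · rw [Nat.ordProj_mul_ordCompl_eq_self]
  have hfz : ∀ j ≤ m, π (PowerSeries.coeff j (h.subst u * z')) = PowerSeries.coeff j (f * z) := by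
    intro j hj
    rw [← PowerSeries.coeff_map, map_mul, hzz', ← sub_eq_zero, ← map_sub, ← sub_mul]
    -- `f` is known modulo `t ^ m` only; the vanishing constant term of `z` provides the coefficient
    -- of degree `m`.
    have h1 := mul_dvd_mul (mem_congrIdeal_zero_iff_dvd.1 hf)
      (PowerSeries.X_dvd_iff.2 (by simpa using hz0))
    rw [← pow_succ, ← mem_congrIdeal_zero_iff_dvd] at h1
    exact mem_congrIdeal_zero.1 h1 j (by omega)
  intro j hj
  have h1 := pow_dvd_sub_val (hfz j hj)
  have h2 : y - u + h.subst u * z' ∈ congrIdeal ((p : ℤ_[p]) ^ κ) (m + 1) := by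
    have := add_mem (Ideal.mul_mem_left _ (h.subst u) hZ2) (Ideal.mul_mem_left _ (h.subst u) hz'Z)
    convert this using 1
    linear_combination (-(y - u)) * hψ
  have h3 := h2 j (by omega)
  rw [map_add, map_sub] at h3
  have h4 : (p : ℤ_[p]) ^ κ ∣ (p : ℤ_[p]) ^ ℓ := pow_dvd_pow _ (by omega)
  convert dvd_sub h3 (h4.trans h1) using 1
  ring

end Residues

namespace BitRAM

/-! ## Reasoning about programs -/

/-- The program `P`, started with the memory `s`, terminates with a memory and a cost that
satisfy `Q`. -/
def wp (env : ℕ → Behaviour) (P : Prog) (s : Memory) (Q : Memory → ℕ → Prop) : Prop :=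
  ∃ s' c, Exec env P s s' c ∧ Q s' c

/-- Programs executed one after the other. -/
def block (l : List Prog) : Prog := l.foldr .seq .skip

section wp

variable {env : ℕ → Behaviour} {s : Memory} {Q R : Memory → ℕ → Prop}

theorem wp.mono {P : Prog} (h : wp env P s Q) (hQ : ∀ s' c, Q s' c → R s' c) : wp env P s R := by
  obtain ⟨s', c, h1, h2⟩ := h
  exact ⟨s', c, h1, hQ _ _ h2⟩

@[simp] theorem wp_const {r c : ℕ} :
    wp env (.const r c) s Q ↔ Q (s.setReg r c) (len c) :=
  ⟨by rintro ⟨_, _, ⟨⟩, h⟩; exact h, fun h => ⟨_, _, .const s r c, h⟩⟩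

@[simp] theorem wp_op {o : Op} {r a b : ℕ} :
    wp env (.op o r a b) s Q ↔
      Q (s.setReg r (o.eval (s.reg a) (s.reg b))) (o.cost (s.reg a) (s.reg b)) :=
  ⟨by rintro ⟨_, _, ⟨⟩, h⟩; exact h, fun h => ⟨_, _, .op s o r a b, h⟩⟩

@[simp] theorem wp_load {r A i : ℕ} :
    wp env (.load r A i) s Q ↔
      Q (s.setReg r (s.arr A (s.reg i))) (len (s.reg i) + len (s.arr A (s.reg i))) :=
  ⟨by rintro ⟨_, _, ⟨⟩, h⟩; exact h, fun h => ⟨_, _, .load s r A i, h⟩⟩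

@[simp] theorem wp_store {A i r : ℕ} :
    wp env (.store A i r) s Q ↔
      Q (s.setArr A (s.reg i) (s.reg r)) (len (s.reg i) + len (s.reg r)) :=
  ⟨by rintro ⟨_, _, ⟨⟩, h⟩; exact h, fun h => ⟨_, _, .store s A i r, h⟩⟩

@[simp] theorem wp_skip : wp env .skip s Q ↔ Q s 1 :=
  ⟨by rintro ⟨_, _, ⟨⟩, h⟩; exact h, fun h => ⟨_, _, .skip s, h⟩⟩

theorem wp_seq {P P' : Prog} :
    wp env (.seq P P') s Q ↔ wp env P s fun s' c => wp env P' s' fun s'' d => Q s'' (c + d) := by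
  constructor
  · rintro ⟨_, _, ⟨⟩, h⟩
    exact ⟨_, _, ‹_›, _, _, ‹_›, h⟩
  · rintro ⟨_, _, h1, _, _, h2, h⟩
    exact ⟨_, _, .seq _ _ _ _ _ _ _ h1 h2, h⟩

@[simp] theorem wp_block_nil : wp env (block []) s Q ↔ Q s 1 := wp_skip

@[simp] theorem wp_block_cons {P : Prog} {l : List Prog} :
    wp env (block (P :: l)) s Q ↔
      wp env P s fun s' c => wp env (block l) s' fun s'' d => Q s'' (c + d) := wp_seq

theorem wp_branch {P P' : Prog} {r : ℕ} :
    wp env (.branch r P P') s Q ↔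
      if s.reg r = 0 then wp env P' s fun s' c => Q s' (len (s.reg r) + c)
      else wp env P s fun s' c => Q s' (len (s.reg r) + c) := by
  split_ifs with h0
  · constructor
    · rintro ⟨_, _, h, hQ⟩
      cases h
      · exact absurd h0 ‹_›
      · exact ⟨_, _, ‹_›, hQ⟩
    · rintro ⟨_, _, h, hQ⟩
      exact ⟨_, _, .branchFalse _ _ _ _ _ _ h0 h, hQ⟩
  · constructor
    · rintro ⟨_, _, h, hQ⟩
      cases h
      · exact ⟨_, _, ‹_›, hQ⟩
      · exact absurd ‹_› h0
    · rintro ⟨_, _, h, hQ⟩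
      exact ⟨_, _, .branchTrue _ _ _ _ _ _ h0 h, hQ⟩

theorem wp_loop_of_eq_zero {P : Prog} {r : ℕ} (h : s.reg r = 0) (hQ : Q s (len 0)) :
    wp env (.loop r P) s Q :=
  ⟨_, _, .loopEnd _ _ _ h, by rwa [h]⟩

theorem wp_loop_of_ne_zero {P : Prog} {r : ℕ} (h : s.reg r ≠ 0)
    (hP : wp env P s fun s' c => wp env (.loop r P) s' fun s'' d => Q s'' (len (s.reg r) + c + d)) :
    wp env (.loop r P) s Q := by
  obtain ⟨_, _, h1, _, _, h2, hQ⟩ := hP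
  exact ⟨_, _, .loopNext _ _ _ _ _ _ _ h h1 h2, hQ⟩

theorem wp_call {k A a B b : ℕ} {out : List ℕ} {c : ℕ} (h : env k (s.getList A (s.reg a)) out c)
    (hQ : Q ((s.setList B out).setReg b out.length) (len (s.reg a) + c + len out.length)) :
    wp env (.call k A a B b) s Q :=
  ⟨_, _, .call _ _ _ _ _ _ _ _ h, hQ⟩

end wp

@[simp] theorem Memory.reg_setReg (s : Memory) (r v r' : ℕ) :
    (s.setReg r v).reg r' = if r' = r then v else s.reg r' := by
  simp [setReg, Function.update_apply]

@[simp] theorem Memory.arr_setReg (s : Memory) (r v : ℕ) : (s.setReg r v).arr = s.arr := rfl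

@[simp] theorem Memory.reg_setArr (s : Memory) (A i v : ℕ) : (s.setArr A i v).reg = s.reg := rfl

@[simp] theorem Memory.arr_setArr (s : Memory) (A i v A' : ℕ) :
    (s.setArr A i v).arr A' = if A' = A then Function.update (s.arr A) i v else s.arr A' := by
  change Function.update _ _ _ _ = _
  rw [Function.update_apply]

@[simp] theorem Memory.reg_setList (s : Memory) (A : ℕ) (l : List ℕ) :
    (s.setList A l).reg = s.reg := rfl

@[simp] theorem Memory.arr_setList (s : Memory) (A : ℕ) (l : List ℕ) (A' : ℕ) :
    (s.setList A l).arr A' = if A' = A then fun i => l.getD i (s.arr A i) else s.arr A' := by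
  change Function.update _ _ _ _ = _
  rw [Function.update_apply]

/-! ## Lengths -/

theorem len_mono {a b : ℕ} (h : a ≤ b) : len a ≤ len b :=
  Nat.succ_le_succ (Nat.size_le_size h)

theorem len_le_add_two (a : ℕ) : len a ≤ a + 2 := by
  have : Nat.size a ≤ a := Nat.size_le.2 Nat.lt_two_pow_self
  unfold len
  omega

@[simp] theorem len_zero : len 0 = 1 := by simp [len]

@[simp] theorem len_one : len 1 = 2 := by simp [len]

/-- A bound for the length of the numbers up to `8 * q`. -/
def word (q : ℕ) : ℕ := Nat.size q + 4

theorem len_le_word {q x : ℕ} (h : x ≤ 8 * q) : len x ≤ word q := by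
  have : Nat.size x ≤ Nat.size q + 3 := by
    rw [Nat.size_le, pow_add]
    have := Nat.lt_size_self q
    omega
  unfold len word
  omega

theorem four_le_word (q : ℕ) : 4 ≤ word q := Nat.le_add_left _ _

/-! ## Counted loops -/

/-- Execute `body` as many times as register `k` says; register `i` is increased each time.
Register `44` has to contain `1`. -/
def forLoop (i k : ℕ) (body : Prog) : Prog :=
  .loop k (block [body, .op .add i i 44, .op .sub k k 44])

/-- The invariant must hold for arbitrary values of the two counters, since the loop itself
overwrites them after the body. Seven words per round pay for the test, the two updates and the
sequencing. -/
theorem wp_forLoop {env : ℕ → Behaviour} {i k : ℕ} {body : Prog} (hik : i ≠ k) (hi : i ≠ 44)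
    (hk : k ≠ 44) {q a N : ℕ} (haN : a + N + 1 ≤ 8 * q) (Inv : ℕ → Memory → Prop) (f : ℕ → ℕ)
    (step : ∀ j < N, ∀ s, Inv j s → s.reg i = a + j → s.reg k = N - j → s.reg 44 = 1 →
      wp env body s fun s' c => c ≤ f j ∧ s'.reg i = a + j ∧ s'.reg k = N - j ∧ s'.reg 44 = 1 ∧
        ∀ x y, Inv (j + 1) ((s'.setReg i x).setReg k y))
    {s : Memory} (hs : Inv 0 s) (hsi : s.reg i = a) (hsk : s.reg k = N) (hs1 : s.reg 44 = 1) :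
    wp env (forLoop i k body) s fun s' c =>
      c ≤ ∑ j ∈ Finset.range N, (f j + 7 * word q) + word q ∧ Inv N s' := by
  suffices H : ∀ d j, j + d = N → ∀ s, Inv j s → s.reg i = a + j → s.reg k = d → s.reg 44 = 1 →
      wp env (forLoop i k body) s fun s' c =>
        c ≤ ∑ x ∈ Finset.range d, (f (j + x) + 7 * word q) + word q ∧ Inv N s' by
    simpa using H N 0 (zero_add N) s hs (by simpa using hsi) hsk hs1
  have hword := four_le_word q
  intro d
  induction d with
  | zero =>
    intro j hj s hs hsi hsk hs1
    have hjN : j = N := hj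
    refine wp_loop_of_eq_zero hsk ⟨?_, hjN ▸ hs⟩
    rw [len_zero]
    omega
  | succ d ih =>
    intro j hj s hs hsi hsk hs1
    refine wp_loop_of_ne_zero (by omega) ?_
    rw [wp_block_cons]
    refine (step j (by omega) s hs hsi (by omega) hs1).mono ?_
    rintro s' c ⟨hc, h1, h2, h3, h4⟩
    simp only [wp_block_cons, wp_block_nil, wp_op, Op.eval, Op.cost, Memory.reg_setReg, h1, h2, h3,
      hik.symm, hi.symm, if_false, hsk, len_one]
    refine (ih (j + 1) (by omega) _ (h4 _ _) ?_ ?_ ?_).mono ?_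
    · simp [hik]
      omega
    · simp
      omega
    · simp [hi.symm, hk.symm, h3]
    · rintro s'' c' ⟨hc', hI⟩
      refine ⟨?_, hI⟩
      rw [Finset.sum_range_succ']
      simp only [add_zero, add_assoc, add_comm 1] at hc' ⊢
      have h5 : len (d + 1) ≤ word q := len_le_word (by omega)
      have h6 : len (a + j) ≤ word q := len_le_word (by omega)
      have h7 : len (N - j) ≤ word q := len_le_word (by omega)
      omega

/-- The memories `s` and `s'` agree on the registers from `r₀` on and on the arrays that are not
listed in `l`. -/
def Agree (r₀ : ℕ) (l : List ℕ) (s s' : Memory) : Prop :=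
  (∀ r, r₀ ≤ r → s'.reg r = s.reg r) ∧ ∀ A, A ∉ l → s'.arr A = s.arr A

theorem Agree.refl (r₀ : ℕ) (l : List ℕ) (s : Memory) : Agree r₀ l s s :=
  ⟨fun _ _ => rfl, fun _ _ => rfl⟩

theorem Agree.trans {r₀ r₁ r₂ : ℕ} {l₁ l₂ l : List ℕ} {s s' s'' : Memory} (h₁ : Agree r₁ l₁ s s')
    (h₂ : Agree r₂ l₂ s' s'') (hr₁ : r₁ ≤ r₀ := by norm_num) (hr₂ : r₂ ≤ r₀ := by norm_num)
    (hl₁ : l₁ ⊆ l := by simp) (hl₂ : l₂ ⊆ l := by simp) : Agree r₀ l s s'' :=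
  ⟨fun r hr => (h₂.1 r (hr₂.trans hr)).trans (h₁.1 r (hr₁.trans hr)),
    fun A hA => (h₂.2 A fun h => hA (hl₂ h)).trans (h₁.2 A fun h => hA (hl₁ h))⟩

/-- A loop that fills the entries `a, ..., a + N - 1` of array `B` with the values of `v`, using
registers `18` and `19` as counters. -/
theorem wp_forLoop_fill {env : ℕ → Behaviour} {body : Prog} {q a N B : ℕ}
    (haN : a + N + 1 ≤ 8 * q) (v f : ℕ → ℕ) (s : Memory) (l : List ℕ)
    (step : ∀ j < N, ∀ s', Agree 20 (B :: l) s s' → s'.reg 18 = a + j →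
      wp env body s' fun s'' c => c ≤ f j ∧ Agree 18 (B :: l) s' s'' ∧
        s''.arr B = Function.update (s'.arr B) (a + j) (v (a + j)))
    (hs1 : s.reg 44 = 1) (hsi : s.reg 18 = a) (hsk : s.reg 19 = N) :
    wp env (forLoop 18 19 body) s fun s' c =>
      c ≤ ∑ j ∈ Finset.range N, (f j + 7 * word q) + word q ∧ Agree 20 (B :: l) s s' ∧
      ∀ x, s'.arr B x = if a ≤ x ∧ x < a + N then v x else s.arr B x := by
  refine (wp_forLoop (i := 18) (k := 19) (by norm_num) (by norm_num) (by norm_num) haN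
    (fun j s' => Agree 20 (B :: l) s s' ∧
      ∀ x, s'.arr B x = if a ≤ x ∧ x < a + j then v x else s.arr B x) f ?_ ?_ hsi hsk hs1).mono ?_
  · rintro j hj s' ⟨hA, hB⟩ h18 h19 h44
    refine (step j hj s' hA h18).mono ?_
    rintro s'' c ⟨hc, hA', hB'⟩
    refine ⟨hc, by rw [hA'.1 18 (by norm_num), h18], by rw [hA'.1 19 (by norm_num), h19],
      by rw [hA'.1 44 (by norm_num), h44], fun x y => ⟨?_, fun z => ?_⟩⟩
    · refine hA.trans (s'' := _) (r₂ := 20) (l₂ := B :: l) ⟨fun r hr => ?_, fun A hA => ?_⟩ le_rfl le_rfl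
        (List.Subset.refl _) (List.Subset.refl _)
      · have h1 : r ≠ 18 := by omega
        have h2 : r ≠ 19 := by omega
        simp [h1, h2, hA'.1 r (by omega)]
      · simp [hA'.2 A hA]
    · simp only [Memory.arr_setReg, hB', Function.update_apply, hB]
      split_ifs <;> first | rfl | omega | (subst z; rfl)
  · exact ⟨Agree.refl _ _ _, fun x => by simp⟩
  · rintro s' c ⟨h1, h2, h3⟩
    exact ⟨h1, h2, h3⟩

/-- The constants that the registers `40, ..., 46` hold during the computation: `p`, `ℓ`, `p ^ ℓ`,
`n`, `1`, `2` and `0`. -/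
structure Globals (p ℓ n : ℕ) (s : Memory) : Prop where
  reg_p : s.reg 40 = p
  reg_l : s.reg 41 = ℓ
  reg_q : s.reg 42 = p ^ ℓ
  reg_n : s.reg 43 = n
  reg_one : s.reg 44 = 1
  reg_two : s.reg 45 = 2
  reg_zero : s.reg 46 = 0

/-- Registers are used in layers: those below `10` are scratch, `18` and `19` count loops,
polynomial operations stay below `30`, the Newton iteration controls `30` to `33`, and the constants
live from `40` on. The bound in `Agree` records the layers that a subroutine may touch. -/
theorem Globals.of_agree {p ℓ n r₀ : ℕ} {l : List ℕ} {s s' : Memory} (hg : Globals p ℓ n s)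
    (h : Agree r₀ l s s') (hr : r₀ ≤ 40 := by norm_num) : Globals p ℓ n s' := by
  constructor <;> rw [h.1 _ (by omega)]
  exacts [hg.1, hg.2, hg.3, hg.4, hg.5, hg.6, hg.7]

/-! ### Elementary subroutines: modular products, copying, headers of calls. -/

/-- Procedure `0` multiplies polynomials of degree at most `m` over `ℤ/p ^ ℓ ℤ` at cost `T m`. -/
def CanMultiply (env : ℕ → Behaviour) (p ℓ : ℕ) (T : ℕ → ℕ) : Prop :=
  ∀ m : ℕ, 1 ≤ m → ∀ a b : Polynomial (ZMod (p ^ ℓ)), a.natDegree ≤ m → b.natDegree ≤ m →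
    ∃ c ≤ T m, env 0 (precisionData p ℓ m ++ residues (m + 1) a.coeff ++ residues (m + 1) b.coeff)
      (residues (2 * m + 1) (a * b).coeff) c

/-- Write `p`, `ℓ`, `p ^ ℓ` and the content of register `m` at the beginning of array `1`. -/
def header (m : ℕ) : Prog :=
  block [.const 1 0, .store 1 1 40, .const 1 1, .store 1 1 41, .const 1 2, .store 1 1 42,
    .const 1 3, .store 1 1 m]

/-- Put in register `9` the product modulo `p ^ ℓ` of the registers `x` and `y`. -/
def mulMod (x y : ℕ) : Prog :=
  block [header 44, .const 1 4, .store 1 1 x, .const 1 5, .store 1 1 46, .const 1 6, .store 1 1 y,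
    .const 1 7, .store 1 1 46, .const 1 8, .call 0 1 1 2 2, .const 1 0, .load 9 2 1]

theorem bounds_pow {p ℓ : ℕ} [Fact p.Prime] (hℓ : 1 ≤ ℓ) :
    2 ≤ p ^ ℓ ∧ p ≤ p ^ ℓ ∧ ℓ ≤ p ^ ℓ :=
  have hp : p.Prime := Fact.out
  have h : p ≤ p ^ ℓ := Nat.le_self_pow (by omega) p
  ⟨hp.two_le.trans h, h, (Nat.lt_pow_self hp.one_lt).le⟩

/-- The instruction for products has quadratic cost, which is not known to be bounded by the cost of
the multiplication procedure. The factors are passed to that procedure as constant polynomials, in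
the smallest allowed degree bound `1`; the output has three coefficients. -/
theorem wp_mulMod {env : ℕ → Behaviour} {p ℓ n : ℕ} [Fact p.Prime] {T : ℕ → ℕ}
    (hT : CanMultiply env p ℓ T) (hℓ : 1 ≤ ℓ) {s : Memory} (hg : Globals p ℓ n s)
    {x y : ℕ} (hx : 10 ≤ x) (hy : 10 ≤ y) (hxq : s.reg x < p ^ ℓ) (hyq : s.reg y < p ^ ℓ) :
    wp env (mulMod x y) s fun s' c => c ≤ T 1 + 60 * word (p ^ ℓ) ∧
      s'.reg 9 = s.reg x * s.reg y % p ^ ℓ ∧ Agree 10 [1, 2] s s' := by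
  have : NeZero (p ^ ℓ) := ⟨pow_ne_zero _ (Fact.out : p.Prime).ne_zero⟩
  obtain ⟨c, hc, hcall⟩ := hT 1 le_rfl (Polynomial.C (s.reg x : ZMod (p ^ ℓ)))
    (Polynomial.C (s.reg y : ZMod (p ^ ℓ))) (by simp) (by simp)
  simp [precisionData, residues, List.range_succ, ZMod.val_mul] at hcall
  simp only [mulMod, header, wp_block_cons, wp_const, wp_store, wp_block_nil]
  obtain ⟨hq2, hqp, hql⟩ := bounds_pow (p := p) hℓ
  have hx1 : x ≠ 1 := by omega
  have hy1 : y ≠ 1 := by omega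
  refine wp_call (out := [s.reg x * s.reg y % p ^ ℓ, 0, 0]) (c := c) ?_ ?_
  · simpa [Memory.getList, List.range_succ, hg.1, hg.2, hg.3, hg.5, hg.7, hx1, hy1,
      Nat.mod_eq_of_lt hxq, Nat.mod_eq_of_lt hyq] using hcall
  · simp only [Memory.reg_setReg, Memory.reg_setArr, hx1, hy1, hg.1, hg.2, hg.3, hg.5, hg.7]
    norm_num
    have h := fun k (hk : k ≤ 8) => len_le_word (q := p ^ ℓ) (x := k) (by omega)
    have h2 := h 2 (by norm_num)
    have h3 := h 3 (by norm_num)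
    have h4 := h 4 (by norm_num)
    have h5 := h 5 (by norm_num)
    have h6 := h 6 (by norm_num)
    have h7 := h 7 (by norm_num)
    have h8 := h 8 (by norm_num)
    have hp := len_le_word (q := p ^ ℓ) (x := p) (by omega)
    have hl := len_le_word (q := p ^ ℓ) (x := ℓ) (by omega)
    have hq := len_le_word (q := p ^ ℓ) (x := p ^ ℓ) (by omega)
    have hx := len_le_word (q := p ^ ℓ) (x := s.reg x) (by omega)
    have hy := len_le_word (q := p ^ ℓ) (x := s.reg y) (by omega)
    have hxy := len_le_word (q := p ^ ℓ) (x := s.reg x * s.reg y % p ^ ℓ)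
      ((Nat.mod_lt _ (by omega)).le.trans (by omega))
    have hw := four_le_word (p ^ ℓ)
    refine ⟨by omega, fun r hr => ?_, fun A hA => ?_⟩
    · have : ∀ k < 10, r ≠ k := fun k hk => by omega
      simp [this]
    · simp only [List.mem_cons, List.not_mem_nil, or_false, not_or] at hA
      simp [hA]

/-- Copy to array `B`, from the index in register `b` on, the entries of array `A` from the index in
register `a` on, as many as register `k` says. -/
def copy (A a B b k : ℕ) : Prog :=
  block [.op .add 18 b 46, .op .add 19 k 46,
    forLoop 18 19 (block [.op .sub 1 18 b, .op .add 1 1 a, .load 2 A 1, .store B 18 2])]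

theorem wp_copy {env : ℕ → Behaviour} {A a B b k q : ℕ} (hAB : A ≠ B) (ha : 20 ≤ a) (hb : 20 ≤ b)
    (hk : 20 ≤ k) {s : Memory} (h44 : s.reg 44 = 1) (h46 : s.reg 46 = 0)
    (hak : s.reg a + s.reg k ≤ 8 * q) (hbk : s.reg b + s.reg k + 1 ≤ 8 * q)
    (hA : ∀ x < s.reg k, s.arr A (s.reg a + x) ≤ 8 * q) :
    wp env (copy A a B b k) s fun s' c => c ≤ 20 * ((s.reg k + 1) * word q) ∧ Agree 20 [B] s s' ∧
      ∀ x, s'.arr B x = if s.reg b ≤ x ∧ x < s.reg b + s.reg k then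
        s.arr A (s.reg a + (x - s.reg b)) else s.arr B x := by
  have ha1 : ∀ j < 20, a ≠ j := fun j hj => by omega
  have hb1 : ∀ j < 20, b ≠ j := fun j hj => by omega
  have hk1 : ∀ j < 20, k ≠ j := fun j hj => by omega
  have hw := four_le_word q
  simp only [copy, wp_block_cons, wp_op, Op.eval, Op.cost, Memory.reg_setReg, h46]
  have hfill := wp_forLoop_fill (env := env) (q := q) (a := s.reg b) (N := s.reg k) (B := B)
    (body := block [.op .sub 1 18 b, .op .add 1 1 a, .load 2 A 1, .store B 18 2])
    (s := (s.setReg 18 (s.reg b)).setReg 19 (s.reg k))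
    hbk (fun x => s.arr A (s.reg a + (x - s.reg b))) (fun _ => 9 * word q) [] ?_
    (by simpa using h44) (by simp) (by simp)
  · simp [hk1] at hfill ⊢
    refine hfill.mono ?_
    rintro s' c ⟨hc, hA', hB'⟩
    have h1 := len_le_word (q := q) (x := s.reg b) (by omega)
    have h2 := len_le_word (q := q) (x := s.reg k) (by omega)
    refine ⟨?_, ⟨fun r hr => ?_, fun A'' h => ?_⟩, hB'⟩
    · have : s.reg k * (9 * word q + 7 * word q) = 16 * (s.reg k * word q) := by ring
      rw [this] at hc
      have : 20 * ((s.reg k + 1) * word q) = 20 * (s.reg k * word q) + 20 * word q := by ring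
      omega
    · have : ∀ k < 20, r ≠ k := fun k hk => by omega
      simpa [this] using hA'.1 r hr
    · simpa using hA'.2 A'' h
  · rintro j hj s' hA' h18
    have e1 : s'.reg a = s.reg a := by simpa [ha1] using hA'.1 a ha
    have e2 : s'.reg b = s.reg b := by simpa [hb1] using hA'.1 b hb
    have e3 : s'.arr A = s.arr A := by simpa using hA'.2 A (by simpa using hAB)
    have h1 := len_le_word (q := q) (x := s.reg b + j) (by omega)
    have h2 := len_le_word (q := q) (x := s.reg b) (by omega)
    have h3 := len_le_word (q := q) (x := j) (by omega)
    have h4 := len_le_word (q := q) (x := s.reg a) (by omega)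
    have h5 := len_le_word (q := q) (x := j + s.reg a) (by omega)
    have h6 := len_le_word (hA j hj)
    simp [Op.eval, Op.cost, h18, ha1, e1, e2, e3, add_comm j]
    rw [add_comm j] at h5
    refine ⟨by omega, fun r hr => ?_, fun A'' h => ?_⟩
    · have : ∀ k < 10, r ≠ k := fun k hk => by omega
      simp [this]
    · simp only [List.mem_cons, List.not_mem_nil, or_false] at h
      simp [h]

theorem wp_header {env : ℕ → Behaviour} {p ℓ n : ℕ} [Fact p.Prime] (hℓ : 1 ≤ ℓ) {s : Memory}
    (hg : Globals p ℓ n s) {r : ℕ} (hr : 10 ≤ r) (hrq : s.reg r ≤ 8 * p ^ ℓ) :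
    wp env (header r) s fun s' c => c ≤ 20 * word (p ^ ℓ) ∧ Agree 10 [1] s s' ∧
      ∀ x < 4, s'.arr 1 x = (precisionData p ℓ (s.reg r)).getD x 0 := by
  obtain ⟨hq2, hqp, hql⟩ := bounds_pow (p := p) hℓ
  have hr1 : r ≠ 1 := by omega
  simp [header, hg.1, hg.2, hg.3, hr1, precisionData]
  have h := fun k (hk : k ≤ 8) => len_le_word (q := p ^ ℓ) (x := k) (by omega)
  have h2 := h 2 (by norm_num)
  have h3 := h 3 (by norm_num)
  have hp := len_le_word (q := p ^ ℓ) (x := p) (by omega)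
  have hl := len_le_word (q := p ^ ℓ) (x := ℓ) (by omega)
  have hq := len_le_word (q := p ^ ℓ) (x := p ^ ℓ) (by omega)
  have hx := len_le_word hrq
  have hw := four_le_word (p ^ ℓ)
  refine ⟨by omega, ⟨fun r hr => ?_, fun A hA => ?_⟩, fun x hx => ?_⟩
  · have : ∀ k < 10, r ≠ k := fun k hk => by omega
    simp [this]
  · simp only [List.mem_cons, List.not_mem_nil, or_false] at hA
    simp [hA]
  · interval_cases x <;> simp

/-! ## Lists -/

theorem residues_getD {q : ℕ} (m : ℕ) (a : ℕ → ZMod q) (i d : ℕ) :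
    (residues m a).getD i d = if i < m then (a i).val else d := by
  unfold residues
  split_ifs with h <;> simp [List.getD_eq_getElem?_getD, h]

@[simp] theorem length_residues {q : ℕ} (m : ℕ) (a : ℕ → ZMod q) : (residues m a).length = m := by
  simp [residues]

theorem Memory.getList_eq {s : Memory} {A k : ℕ} {l : List ℕ} (hl : l.length = k)
    (h : ∀ i < k, s.arr A i = l.getD i 0) : s.getList A k = l := by
  refine List.ext_getElem (by simp [getList, hl]) fun i h1 h2 => ?_
  simp [getList, h i (by omega), List.getD_eq_getElem?_getD, h2]

theorem residues_congr {q m : ℕ} {a b : ℕ → ZMod q} (h : ∀ i < m, a i = b i) :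
    residues m a = residues m b :=
  List.map_congr_left fun i hi => by rw [h i (List.mem_range.1 hi)]

/-- Array `A` holds the coefficients of `F` up to degree `m`. -/
def Holds {q : ℕ} (s : Memory) (A m : ℕ) (F : (ZMod q)⟦X⟧) : Prop :=
  ∀ i ≤ m, s.arr A i = (PowerSeries.coeff i F).val

theorem Holds.le {q : ℕ} [NeZero q] {s : Memory} {A m : ℕ} {F : (ZMod q)⟦X⟧} (h : Holds s A m F)
    {i : ℕ} (hi : i ≤ m) : s.arr A i < q := by
  rw [h i hi]
  exact ZMod.val_lt _

theorem getD_input {p ℓ m k : ℕ} {l l' : List ℕ} (hl : l.length = k) (f : ℕ → ℕ)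
    (h0 : ∀ x < 4, f x = (precisionData p ℓ m).getD x 0)
    (h1 : ∀ x < k, f (4 + x) = l.getD x 0) (h2 : ∀ x < l'.length, f (4 + k + x) = l'.getD x 0) :
    ∀ i < 4 + k + l'.length, f i = (precisionData p ℓ m ++ l ++ l').getD i 0 := by
  intro i hi
  have h4 : (precisionData p ℓ m).length = 4 := rfl
  rcases lt_or_ge i 4 with h | h
  · rw [h0 i h, List.append_assoc, List.getD_append _ _ _ _ (by omega)]
  rcases lt_or_ge i (4 + k) with h' | h'
  · rw [List.append_assoc, List.getD_append_right _ _ _ _ (by omega),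
      List.getD_append _ _ _ _ (by omega), h4, ← h1 _ (by omega)]
    congr 1
    omega
  · rw [List.getD_append_right _ _ _ _ (by simp; omega), List.length_append, h4, hl,
      ← h2 _ (by omega)]
    congr 1
    omega

/-! ### Calls of the multiplication and composition procedures. -/

/-- Put at the beginning of array `2` the coefficients of the product of the polynomials in the
arrays `A` and `B`, whose degree is bounded by the content of register `30`. -/
def polyMul (A B : ℕ) : Prog :=
  block [header 30, .op .add 20 30 44, .const 21 4, .const 22 0, copy A 22 1 21 20,
    .op .add 21 21 20, copy B 22 1 21 20, .op .add 21 21 20, .call 0 1 21 2 1]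

theorem wp_polyMul {env : ℕ → Behaviour} {p ℓ n : ℕ} [Fact p.Prime] {T : ℕ → ℕ}
    (hT : CanMultiply env p ℓ T) (hℓ : 1 ≤ ℓ) {s : Memory} (hg : Globals p ℓ n s) {A B m : ℕ}
    (hA : A ≠ 1) (hB : B ≠ 1) (hm : 1 ≤ m) (hmq : m < p ^ ℓ) (hm30 : s.reg 30 = m)
    {F G : (ZMod (p ^ ℓ))⟦X⟧} (hF : Holds s A m F) (hG : Holds s B m G) :
    wp env (polyMul A B) s fun s' c => c ≤ T m + 100 * ((m + 1) * word (p ^ ℓ)) ∧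
      Agree 30 [1, 2] s s' ∧ Holds s' 2 m (F * G) := by
  have : NeZero (p ^ ℓ) := ⟨pow_ne_zero _ (Fact.out : p.Prime).ne_zero⟩
  obtain ⟨hq2, hqp, hql⟩ := bounds_pow (p := p) hℓ
  obtain ⟨c, hc, hcall⟩ := hT m hm (PowerSeries.trunc (m + 1) F) (PowerSeries.trunc (m + 1) G)
    (Nat.lt_succ_iff.1 (PowerSeries.natDegree_trunc_lt F m))
    (Nat.lt_succ_iff.1 (PowerSeries.natDegree_trunc_lt G m))
  rw [polyMul, wp_block_cons]
  refine (wp_header hℓ hg (r := 30) (by norm_num) (by omega)).mono ?_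
  rintro s1 c1 ⟨hc1, ha1, h1⟩
  have hg1 := hg.of_agree ha1
  rw [hm30] at h1
  have e30 : s1.reg 30 = m := by rw [ha1.1 30 (by norm_num), hm30]
  simp only [wp_block_cons, wp_op, wp_const, Op.eval, Op.cost]
  refine (wp_copy (q := p ^ ℓ) hA (by norm_num) (by norm_num) (by norm_num) ?_ ?_ ?_ ?_ ?_).mono ?_
  · simp [hg1.5]
  · simp [hg1.7]
  · simp [e30, hg1.5]; omega
  · simp [e30, hg1.5]; omega
  · simp [e30, hg1.5]
    intro x hx
    rw [ha1.2 A (by simpa using hA)]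
    exact (hF.le (by omega)).le.trans (by omega)
  simp [e30, hg1.5]
  intro s2 c2 hc2 ha2 h2
  have hg2 : Globals p ℓ n s2 := by
    constructor <;> rw [ha2.1 _ (by norm_num)] <;> simp [hg1.1, hg1.2, hg1.3, hg1.4, hg1.5, hg1.6,
      hg1.7]
  have e20 : s2.reg 20 = m + 1 := by simp [ha2.1]
  have e21 : s2.reg 21 = 4 := by simp [ha2.1]
  have e22 : s2.reg 22 = 0 := by simp [ha2.1]
  refine (wp_copy (q := p ^ ℓ) hB (by norm_num) (by norm_num) (by norm_num) ?_ ?_ ?_ ?_ ?_).mono ?_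
  · simp [hg2.5]
  · simp [hg2.7]
  · simp [e20, e22]; omega
  · simp [e20, e21]; omega
  · simp [e20, e22]
    intro x hx
    rw [ha2.2 B (by simpa using hB), Memory.arr_setReg, Memory.arr_setReg, Memory.arr_setReg,
      ha1.2 B (by simpa using hB)]
    exact (hG.le (by omega)).le.trans (by omega)
  simp [e20, e21, e22]
  intro s3 c3 hc3 ha3 h3
  have e20' : s3.reg 20 = m + 1 := by simp [ha3.1, e20]
  have e21' : s3.reg 21 = 4 + (m + 1) := by simp [ha3.1]
  refine wp_call (c := c) (out := residues (2 * m + 1)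
    ((PowerSeries.trunc (m + 1) F) * (PowerSeries.trunc (m + 1) G)).coeff) ?_ ?_
  · convert hcall using 1
    refine Memory.getList_eq (by simp [e20', e21', precisionData]; omega) ?_
    have := getD_input (p := p) (ℓ := ℓ) (m := m) (k := m + 1)
      (l := residues (m + 1) (PowerSeries.trunc (m + 1) F).coeff)
      (l' := residues (m + 1) (PowerSeries.trunc (m + 1) G).coeff) (by simp) (s3.arr 1) ?_ ?_ ?_
    · simpa [e20', e21'] using this
    · intro x hx
      rw [h3, if_neg (by omega), h2, if_neg (by omega)]
      exact h1 x hx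
    · intro x hx
      rw [h3, if_neg (by omega), h2, if_pos (by omega), residues_getD, if_pos hx,
        ha1.2 A (by simpa using hA), Nat.add_sub_cancel_left, hF x (by omega),
        PowerSeries.coeff_trunc, if_pos hx]
    · intro x hx
      rw [length_residues] at hx
      rw [h3, if_pos (by omega), residues_getD, if_pos hx, ha2.2 B (by simpa using hB),
        Nat.add_sub_cancel_left]
      simp only [Memory.arr_setReg]
      rw [ha1.2 B (by simpa using hB), hG x (by omega), PowerSeries.coeff_trunc, if_pos hx]
  · simp [e20', e21']
    refine ⟨?_, ⟨fun r hr => ?_, fun A' h => ?_⟩, fun i hi => ?_⟩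
    · have h4 := len_le_word (q := p ^ ℓ) (x := 4) (by omega)
      have h5 := len_le_word (q := p ^ ℓ) (x := m) (by omega)
      have h6 := len_le_word (q := p ^ ℓ) (x := m + 1) (by omega)
      have h7 := len_le_word (q := p ^ ℓ) (x := 4 + (m + 1)) (by omega)
      have h8 := len_le_word (q := p ^ ℓ) (x := 4 + (m + 1) + (m + 1)) (by omega)
      have h9 := len_le_word (q := p ^ ℓ) (x := 2 * m + 1) (by omega)
      have hw := four_le_word (p ^ ℓ)
      have e1 : (m + 1 + 1) * word (p ^ ℓ) = m * word (p ^ ℓ) + 2 * word (p ^ ℓ) := by ring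
      have e2 : (m + 1) * word (p ^ ℓ) = m * word (p ^ ℓ) + word (p ^ ℓ) := by ring
      have e3 : word (p ^ ℓ) ≤ m * word (p ^ ℓ) := Nat.le_mul_of_pos_left _ hm
      omega
    · have : ∀ k < 30, r ≠ k := fun k hk => by omega
      simp [this, ha3.1 r (by omega), ha2.1 r (by omega), ha1.1 r (by omega)]
    · simp only [List.mem_cons, List.not_mem_nil, or_false, not_or] at h
      simp [h, ha3.2, ha2.2, ha1.2]
    · have : ∀ l : List ℕ, l[i]?.getD (s3.arr 2 i) = l.getD i (s3.arr 2 i) :=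
        fun l => List.getD_eq_getElem?_getD.symm
      simp only [Memory.arr_setReg, Memory.arr_setList, if_true]
      rw [residues_getD, if_pos (by omega),
        PowerSeries.coeff_mul_eq_coeff_trunc_mul_trunc F G (Nat.lt_succ_iff.2 hi),
        ← Polynomial.coeff_coe, Polynomial.coe_mul]

/-- Procedure `1` computes the composition of `h` with a series modulo `(p ^ ℓ, t ^ m)` at cost
`T m`. -/
def CanCompose (env : ℕ → Behaviour) {p : ℕ} [Fact p.Prime] (ℓ : ℕ) (h : ℤ_[p]⟦X⟧) (T : ℕ → ℕ) :
    Prop :=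
  ∀ m : ℕ, 1 ≤ m → ∀ f : ℤ_[p]⟦X⟧, PowerSeries.constantCoeff f = 0 →
    ∃ c ≤ T m, env 1 (precisionData p ℓ m ++ truncation ℓ m h ++ truncation ℓ m f)
      (truncation ℓ m (h.subst f)) c

/-- The coefficients of a series `h` modulo `p ^ ℓ` are in array `0`, from the index `4 + n` on, and
those of a series `f` in array `7`. Put at the beginning of array `9` those of the composition
`h(f)`, modulo `t ^ m` where `m` is the content of register `30`, followed by `0`. -/
def compose : Prog :=
  block [header 30, .const 20 4, .op .add 21 20 43, copy 0 21 1 20 30, .op .add 20 20 30,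
    copy 7 46 1 20 30, .op .add 20 20 30, .call 1 1 20 9 1, .store 9 30 46]

/-- Composition works with `m` coefficients and multiplication with `m + 1`; the final zero makes
the result a legitimate argument of `polyMul`. -/
theorem wp_compose {env : ℕ → Behaviour} {p ℓ n : ℕ} [Fact p.Prime] {h : ℤ_[p]⟦X⟧} {T : ℕ → ℕ}
    (hT : CanCompose env ℓ h T) (hℓ : 1 ≤ ℓ) (hn : n < p ^ ℓ) {s : Memory} (hg : Globals p ℓ n s)
    {m : ℕ} (hm : 1 ≤ m) (hmn : m ≤ n) (hm30 : s.reg 30 = m)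
    (hh : ∀ i < n, s.arr 0 (4 + n + i) = (PadicInt.toZModPow ℓ (PowerSeries.coeff i h)).val)
    {f : ℤ_[p]⟦X⟧} (hf0 : PowerSeries.constantCoeff f = 0)
    (hf : ∀ i < m, s.arr 7 i = (PadicInt.toZModPow ℓ (PowerSeries.coeff i f)).val) :
    wp env compose s fun s' c => c ≤ T m + 100 * ((m + 1) * word (p ^ ℓ)) ∧
      Agree 30 [1, 9] s s' ∧ ∀ i ≤ m, s'.arr 9 i =
        if i < m then (PadicInt.toZModPow ℓ (PowerSeries.coeff i (h.subst f))).val else 0 := by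
  have : NeZero (p ^ ℓ) := ⟨pow_ne_zero _ (Fact.out : p.Prime).ne_zero⟩
  obtain ⟨hq2, hqp, hql⟩ := bounds_pow (p := p) hℓ
  obtain ⟨c, hc, hcall⟩ := hT m hm f hf0
  have hlt : ∀ a : ZMod (p ^ ℓ), a.val ≤ 8 * p ^ ℓ := fun a => (ZMod.val_lt a).le.trans (by omega)
  rw [compose, wp_block_cons]
  refine (wp_header hℓ hg (r := 30) (by norm_num) (by omega)).mono ?_
  rintro s1 c1 ⟨hc1, ha1, h1⟩
  have hg1 := hg.of_agree ha1
  rw [hm30] at h1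
  have e30 : s1.reg 30 = m := by rw [ha1.1 30 (by norm_num), hm30]
  simp only [wp_block_cons, wp_op, wp_const, Op.eval, Op.cost]
  refine (wp_copy (q := p ^ ℓ) (by norm_num) (by norm_num) (by norm_num) (by norm_num)
    ?_ ?_ ?_ ?_ ?_).mono ?_
  · simp [hg1.5]
  · simp [hg1.7]
  · simp [e30, hg1.4]; omega
  · simp [e30]; omega
  · simp [e30, hg1.4]
    intro x hx
    rw [ha1.2 0 (by simp), hh x (by omega)]
    exact hlt _
  simp [e30, hg1.4]
  intro s2 c2 hc2 ha2 h2
  have hg2 : Globals p ℓ n s2 := by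
    constructor <;> rw [ha2.1 _ (by norm_num)] <;> simp [hg1.1, hg1.2, hg1.3, hg1.4, hg1.5, hg1.6,
      hg1.7]
  have e20 : s2.reg 20 = 4 := by simp [ha2.1]
  have e30' : s2.reg 30 = m := by simp [ha2.1, e30]
  have h27 : s2.arr 7 = s.arr 7 := by simp [ha2.2, ha1.2]
  refine (wp_copy (q := p ^ ℓ) (by norm_num) (by norm_num) (by norm_num) (by norm_num)
    ?_ ?_ ?_ ?_ ?_).mono ?_
  · simp [hg2.5]
  · simp [hg2.7]
  · simp [e30', hg2.7]; omega
  · simp [e20, e30']; omega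
  · simp [e30', hg2.7]
    intro x hx
    rw [h27, hf x hx]
    exact hlt _
  simp [e20, e30', hg2.7]
  intro s3 c3 hc3 ha3 h3
  have e20' : s3.reg 20 = 4 + m := by simp [ha3.1]
  have e30'' : s3.reg 30 = m := by simp [ha3.1, e30']
  have e46 : s3.reg 46 = 0 := by simp [ha3.1, hg2.7]
  refine wp_call (c := c) (out := truncation ℓ m (h.subst f)) ?_ ?_
  · convert hcall using 1
    refine Memory.getList_eq (by simp [e20', e30'', precisionData, truncation]; omega) ?_
    have := getD_input (p := p) (ℓ := ℓ) (m := m) (k := m)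
      (l := truncation ℓ m h) (l' := truncation ℓ m f) (by simp [truncation]) (s3.arr 1) ?_ ?_ ?_
    · simpa [e20', e30'', truncation] using this
    · intro x hx
      rw [h3, if_neg (by omega), h2, if_neg (by omega)]
      exact h1 x hx
    · intro x hx
      rw [h3, if_neg (by omega), h2, if_pos (by omega), truncation, residues_getD, if_pos hx,
        ha1.2 0 (by simp), Nat.add_sub_cancel_left, hh x (by omega)]
    · intro x hx
      rw [truncation, length_residues] at hx
      rw [h3, if_pos (by omega), truncation, residues_getD, if_pos hx,
        Nat.add_sub_cancel_left, h27, hf x hx]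
  · simp [e20', e30'', e46]
    refine ⟨?_, ⟨fun r hr => ?_, fun A' h => ?_⟩, fun i hi => ?_⟩
    · have h4 := len_le_word (q := p ^ ℓ) (x := 4) (by omega)
      have h5 := len_le_word (q := p ^ ℓ) (x := m) (by omega)
      have h6 := len_le_word (q := p ^ ℓ) (x := n) (by omega)
      have h7 := len_le_word (q := p ^ ℓ) (x := 4 + m) (by omega)
      have h8 := len_le_word (q := p ^ ℓ) (x := 4 + m + m) (by omega)
      have h9 := len_le_word (q := p ^ ℓ) (x := (truncation ℓ m (h.subst f)).length)
        (by simp only [truncation, length_residues]; omega)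
      have hw := four_le_word (p ^ ℓ)
      have e2 : (m + 1) * word (p ^ ℓ) = m * word (p ^ ℓ) + word (p ^ ℓ) := by ring
      have e3 : word (p ^ ℓ) ≤ m * word (p ^ ℓ) := Nat.le_mul_of_pos_left _ hm
      omega
    · have : ∀ k < 30, r ≠ k := fun k hk => by omega
      simp [this, ha3.1 r (by omega), ha2.1 r (by omega), ha1.1 r (by omega)]
    · simp only [List.mem_cons, List.not_mem_nil, or_false, not_or] at h
      simp [h, ha3.2, ha2.2, ha1.2]
    · have : ∀ l : List ℕ, l[i]?.getD (s3.arr 9 i) = l.getD i (s3.arr 9 i) :=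
        fun l => List.getD_eq_getElem?_getD.symm
      simp only [this, Function.update_apply]
      split_ifs with h1 h2 h2
      · omega
      · rfl
      · rw [truncation, residues_getD, if_pos h2]
      · omega

/-! ## Estimates for the linear sieve -/

/-- Halving `n` shortens each nonzero quotient by one digit, and at most `n` quotients are nonzero.
So the sum for `n` exceeds the sum for `n / 2` by at most `n`. -/
theorem sum_size_div_le (n N : ℕ) : ∑ i ∈ Finset.range N, Nat.size (n / (i + 1)) ≤ 2 * n := by
  induction n using Nat.strong_induction_on generalizing N with
  | _ n ih =>
    rcases Nat.eq_zero_or_pos n with rfl | hn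
    · simp
    have hstep : ∀ i, Nat.size (n / (i + 1)) ≤
        Nat.size (n / 2 / (i + 1)) + if i < n then 1 else 0 := by
      intro i
      split_ifs with hi
      · rw [Nat.div_div_eq_div_mul, mul_comm, ← Nat.div_div_eq_div_mul, Nat.size_le, pow_succ]
        have := Nat.lt_size_self (n / (i + 1) / 2)
        omega
      · simp [Nat.div_eq_of_lt (show n < i + 1 by omega)]
    calc ∑ i ∈ Finset.range N, Nat.size (n / (i + 1))
        ≤ ∑ i ∈ Finset.range N, (Nat.size (n / 2 / (i + 1)) + if i < n then 1 else 0) :=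
          Finset.sum_le_sum fun i _ => hstep i
      _ ≤ 2 * (n / 2) + n := by
          rw [Finset.sum_add_distrib]
          refine add_le_add (ih _ (by omega) N) ?_
          rw [← Finset.card_filter]
          calc _ ≤ (Finset.range n).card :=
                Finset.card_le_card fun x hx => by simp at hx ⊢; exact hx.2
            _ = n := Finset.card_range n
      _ ≤ 2 * n := by omega

theorem sum_len_div_le (n : ℕ) : ∑ j ∈ Finset.range (n - 1), len (n / (2 + j)) ≤ 3 * n := by
  have h1 : ∑ j ∈ Finset.range (n - 1), len (n / (2 + j)) ≤
      ∑ j ∈ Finset.range (n - 1), Nat.size (n / (j + 1)) + (n - 1) := by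
    simp only [len, Finset.sum_add_distrib, Finset.sum_const, Finset.card_range, smul_eq_mul,
      mul_one]
    refine Nat.add_le_add_right (Finset.sum_le_sum fun j _ => Nat.size_le_size ?_) _
    exact Nat.div_le_div_left (by omega) (by omega)
  have h2 := sum_size_div_le n (n - 1)
  omega

/-- A prime `r` is at least `2 ^ (size r - 1)`, and the product of the primes up to `n` is at most
`4 ^ n`. Comparing exponents bounds the sum of `size r - 1`, and `len r ≤ 3 (size r - 1)` because
`size r ≥ 2`. -/
theorem sum_len_prime_le (n : ℕ) :
    ∑ j ∈ Finset.range (n - 1), (if (2 + j).Prime then len (2 + j) else 0) ≤ 6 * n := by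
  have hpow : ∀ r : ℕ, 2 ≤ r → 2 ^ (Nat.size r - 1) ≤ r ∧ len r ≤ 3 * (Nat.size r - 1) := by
    intro r hr
    have h1 : 1 < Nat.size r := Nat.lt_size.2 (by simpa using hr)
    exact ⟨Nat.lt_size.1 (by omega), by unfold len; omega⟩
  set S := (Finset.range (n - 1)).filter fun j => (2 + j).Prime
  have h1 : 2 ^ (∑ j ∈ S, (Nat.size (2 + j) - 1)) ≤ 2 ^ (2 * n) := by
    rw [← Finset.prod_pow_eq_pow_sum]
    calc ∏ j ∈ S, 2 ^ (Nat.size (2 + j) - 1) ≤ ∏ j ∈ S, (2 + j) :=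
          Finset.prod_le_prod' fun j _ => (hpow _ (by omega)).1
      _ = ∏ r ∈ S.image (2 + ·), r := (Finset.prod_image (f := fun r => r) fun a _ b _ h => by simpa using h).symm
      _ ≤ primorial n := by
          refine Finset.prod_le_prod_of_subset_of_one_le' (fun r hr => ?_) fun r hr _ => ?_
          · simp only [S, Finset.mem_image, Finset.mem_filter, Finset.mem_range] at hr ⊢
            obtain ⟨j, ⟨hj, hp⟩, rfl⟩ := hr
            exact ⟨by omega, hp⟩
          · exact (Finset.mem_filter.1 hr).2.one_le
      _ ≤ 4 ^ n := primorial_le_four_pow n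
      _ = 2 ^ (2 * n) := by rw [pow_mul]; norm_num
  have h2 := (Nat.pow_le_pow_iff_right (by norm_num)).1 h1
  rw [← Finset.sum_filter]
  calc ∑ j ∈ S, len (2 + j) ≤ ∑ j ∈ S, 3 * (Nat.size (2 + j) - 1) :=
        Finset.sum_le_sum fun j _ => (hpow _ (by omega)).2
    _ ≤ 6 * n := by rw [← Finset.mul_sum]; omega

/-- The number of multiples of `i` that the linear sieve marks. -/
noncomputable def strikes (n i : ℕ) : ℕ := Nat.count Nat.Prime (min i.minFac (n / i) + 1)

theorem lt_strikes_iff {n i j : ℕ} :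
    j < strikes n i ↔ Nat.nth Nat.Prime j ≤ i.minFac ∧ Nat.nth Nat.Prime j ≤ n / i := by
  refine (Nat.lt_nth_iff_count_lt Nat.infinite_setOfPred_prime).trans ?_
  change Nat.nth Nat.Prime j < _ ↔ _
  omega

theorem minFac_mul_of_le {i r : ℕ} (hi : 2 ≤ i) (hr : r.Prime) (h : r ≤ i.minFac) :
    (i * r).minFac = r := by
  refine le_antisymm (Nat.minFac_le_of_dvd hr.two_le (dvd_mul_left r i)) ?_
  have hne : i * r ≠ 1 := by
    have := hr.two_le
    nlinarith
  rcases (Nat.minFac_prime hne).dvd_mul.1 (Nat.minFac_dvd (i * r)) with h1 | h1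
  · exact h.trans (Nat.minFac_le_of_dvd (Nat.minFac_prime hne).two_le h1)
  · exact ((Nat.prime_dvd_prime_iff_eq (Nat.minFac_prime hne) hr).1 h1).ge

/-- The sieve marks `i r` only for primes `r ≤ minFac i`, so `r` is the least prime factor of `i r`.
The marked number determines `r` and `i`: no number up to `n` is marked twice. -/
theorem sum_strikes_le (n : ℕ) : ∑ j ∈ Finset.range (n - 1), strikes n (2 + j) ≤ n := by
  have h1 : ∑ j ∈ Finset.range (n - 1), strikes n (2 + j) = ((Finset.range (n - 1)).sigma fun j =>
      (Finset.range (min (2 + j).minFac (n / (2 + j)) + 1)).filter Nat.Prime).card := by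
    rw [Finset.card_sigma]
    exact Finset.sum_congr rfl fun j _ => Nat.count_eq_card_filter_range _ _
  have hmem : ∀ x : (_ : ℕ) × ℕ, x ∈ ((Finset.range (n - 1)).sigma fun j =>
      (Finset.range (min (2 + j).minFac (n / (2 + j)) + 1)).filter Nat.Prime) →
      x.2.Prime ∧ x.2 ≤ (2 + x.1).minFac ∧ (2 + x.1) * x.2 ≤ n := by
    rintro ⟨j, r⟩ hx
    simp only [Finset.mem_sigma, Finset.mem_range, Finset.mem_filter] at hx ⊢
    refine ⟨hx.2.2, by omega, ?_⟩
    rw [mul_comm]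
    exact (Nat.le_div_iff_mul_le (by omega)).1 (by omega)
  rw [h1]
  refine (Finset.card_le_card_of_injOn (t := Finset.Ioc 0 n) (fun x => (2 + x.1) * x.2)
    (fun x hx => ?_) ?_).trans (by simp)
  · obtain ⟨h1, _, h2⟩ := hmem x hx
    simp only [Finset.coe_Ioc, Set.mem_Ioc]
    exact ⟨Nat.mul_pos (by omega) h1.pos, h2⟩
  · rintro ⟨j, r⟩ hx ⟨j', r'⟩ hx' heq
    obtain ⟨h1, h2, _⟩ := hmem _ hx
    obtain ⟨h1', h2', _⟩ := hmem _ hx'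
    simp only at h1 h2 h1' h2' heq
    have hr : r = r' := by
      rw [← minFac_mul_of_le (by omega) h1 h2, heq, minFac_mul_of_le (by omega) h1' h2']
    subst hr
    have := Nat.eq_of_mul_eq_mul_right h1.pos heq
    obtain rfl : j = j' := by omega
    rfl

/-- From `p ≤ 2 ^ (p - 1)` one gets `len (p ^ v) ≤ (p - 1) v + 2`, and Legendre's formula gives `(p
- 1) v_p(m!) ≤ m`. The bound does not depend on `p`. -/
theorem sum_len_ordProj_le (p : ℕ) [hp : Fact p.Prime] (m : ℕ) :
    ∑ i ∈ Finset.range m, len (ordProj[p] (i + 1)) ≤ 3 * m := by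
  have hp2 := hp.out.two_le
  have h1 : ∀ v : ℕ, len (p ^ v) ≤ (p - 1) * v + 2 := by
    intro v
    have : Nat.size (p ^ v) ≤ (p - 1) * v + 1 := by
      rw [Nat.size_le, pow_succ, pow_mul]
      have h : p ≤ 2 ^ (p - 1) := by
        have := Nat.lt_two_pow_self (n := p - 1)
        omega
      have := Nat.pow_le_pow_left h v
      have : 0 < (2 ^ (p - 1)) ^ v := by positivity
      omega
    unfold len
    omega
  have h2 : ∑ i ∈ Finset.range m, (p - 1) * (i + 1).factorization p ≤ m := by
    have h3 : m.factorial.factorization p = ∑ i ∈ Finset.range m, (i + 1).factorization p := by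
      rw [← Finset.prod_range_add_one_eq_factorial, Nat.factorization_prod (by simp)]
      simp
    rw [← Finset.mul_sum, ← h3, Nat.factorization_def _ hp.out, sub_one_mul_padicValNat_factorial]
    exact Nat.sub_le _ _
  calc _ ≤ ∑ i ∈ Finset.range m, ((p - 1) * (i + 1).factorization p + 2) :=
        Finset.sum_le_sum fun i _ => h1 _
    _ ≤ 3 * m := by
      rw [Finset.sum_add_distrib, Finset.sum_const, Finset.card_range, smul_eq_mul]
      omega

/-! ## The linear sieve

For `m ≤ n`, the sieve puts in array `3` the least prime factor of `m`, in array `5` the inverse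
modulo `p ^ ℓ` of the largest factor of `m` prime to `p`, and in array `6` the largest power of `p`
that divides `m`. Array `4` lists the primes. -/

/-- The entries of the tables at `m` are correct. -/
def Entry (p q : ℕ) (s : Memory) (m : ℕ) : Prop :=
  (2 ≤ m → s.arr 3 m = m.minFac) ∧ s.arr 5 m < q ∧
    (s.arr 5 m : ZMod q) * (ordCompl[p] m : ℕ) = 1 ∧ s.arr 6 m = ordProj[p] m

/-- The entries of the tables are correct at the numbers satisfying `K`, and the others are not
marked. -/
def Table (p q : ℕ) (K : ℕ → Prop) (s : Memory) : Prop :=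
  (∀ m, K m → Entry p q s m) ∧ ∀ m, 2 ≤ m → ¬ K m → s.arr 3 m = 0

theorem Entry.congr {p q m : ℕ} {s s' : Memory} (h : Entry p q s m) (h3 : s'.arr 3 m = s.arr 3 m)
    (h5 : s'.arr 5 m = s.arr 5 m) (h6 : s'.arr 6 m = s.arr 6 m) : Entry p q s' m := by
  unfold Entry
  rw [h3, h5, h6]
  exact h

theorem Table.congr {p q : ℕ} {K K' : ℕ → Prop} {s s' : Memory} (h : Table p q K s)
    (hK : ∀ m, K' m ↔ K m) (h3 : s'.arr 3 = s.arr 3) (h5 : s'.arr 5 = s.arr 5)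
    (h6 : s'.arr 6 = s.arr 6) : Table p q K' s' := by
  refine ⟨fun m hm => (h.1 m ((hK m).1 hm)).congr ?_ ?_ ?_, fun m hm hmK => ?_⟩
  · rw [h3]
  · rw [h5]
  · rw [h6]
  · rw [h3]
    exact h.2 m hm (mt (hK m).2 hmK)

theorem Table.update {p q x v₃ v₅ v₆ : ℕ} {K K' : ℕ → Prop} {s s' : Memory} (h : Table p q K s)
    (hK : ∀ m, K' m ↔ K m ∨ m = x) (h3 : s'.arr 3 = Function.update (s.arr 3) x v₃)
    (h5 : s'.arr 5 = Function.update (s.arr 5) x v₅)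
    (h6 : s'.arr 6 = Function.update (s.arr 6) x v₆) (hv₃ : v₃ = x.minFac) (hv₅ : v₅ < q)
    (hv₅' : (v₅ : ZMod q) * (ordCompl[p] x : ℕ) = 1) (hv₆ : v₆ = ordProj[p] x) :
    Table p q K' s' := by
  refine ⟨fun m hm => ?_, fun m hm hmK => ?_⟩
  · rcases eq_or_ne m x with rfl | hmx
    · unfold Entry
      rw [h3, h5, h6]
      simp only [Function.update_self]
      exact ⟨fun _ => hv₃, hv₅, hv₅', hv₆⟩
    · exact (h.1 m (((hK m).1 hm).resolve_right hmx)).congr (by simp [h3, hmx]) (by simp [h5, hmx])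
        (by simp [h6, hmx])
  · rw [hK, not_or] at hmK
    rw [h3, Function.update_of_ne hmK.2]
    exact h.2 m hm hmK.1

/-- For a number `i > 1` prime to `p` in register `20`, put in register `10` a number `X` and in
register `12` a number `c < i` prime to `p` such that `X i = c` modulo `p ^ ℓ`. -/
def ratio : Prog :=
  block [.op .div 10 42 20, .op .mod 12 42 20, .load 1 6 12, .op .sub 1 1 44,
    .branch 1 (block [.op .add 10 10 44, .op .sub 12 20 12]) (.op .sub 10 42 10)]

/-- Write `q = a i + c` with `0 < c < i`. Then `(-a) i = c` and `(a + 1) i = i - c` modulo `q`; when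
`p` divides `c` the second relation is used, since then `i - c` is prime to `p` like `i`. This
reduces the inverse of `i` to that of a smaller number, already in the table. The division costs
about `len i` words, which is affordable for primes `i` only. -/
theorem wp_ratio {env : ℕ → Behaviour} {p ℓ n : ℕ} [Fact p.Prime] (hℓ : 1 ≤ ℓ) (hn : n < p ^ ℓ)
    {s : Memory} (hg : Globals p ℓ n s) {i : ℕ} (hi2 : 2 ≤ i) (hin : i ≤ n) (hpi : ¬ p ∣ i)
    (h20 : s.reg 20 = i) (hT : ∀ m, 1 ≤ m → m < i → Entry p (p ^ ℓ) s m) :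
    wp env ratio s fun s' cost => cost ≤ 20 * word (p ^ ℓ) + 2 * (len i * word (p ^ ℓ)) ∧
      Agree 20 [] s s' ∧ s'.reg 10 < p ^ ℓ ∧ 1 ≤ s'.reg 12 ∧ s'.reg 12 < i ∧ ¬ p ∣ s'.reg 12 ∧
      (s'.reg 10 : ZMod (p ^ ℓ)) * i = s'.reg 12 := by
  have hp : p.Prime := Fact.out
  obtain ⟨hq2, hqp, hql⟩ := bounds_pow (p := p) hℓ
  set q := p ^ ℓ with hq
  have hdm := Nat.div_add_mod q i
  have hmod := Nat.mod_lt q (show 0 < i by omega)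
  obtain ⟨a, hadef⟩ : ∃ a, q / i = a := ⟨_, rfl⟩
  obtain ⟨c, hcdef⟩ : ∃ c, q % i = c := ⟨_, rfl⟩
  rw [hadef, hcdef] at hdm
  rw [hcdef] at hmod
  have hcop : Nat.Coprime i q := (Nat.Coprime.pow_right ℓ ((hp.coprime_iff_not_dvd.2 hpi).symm))
  have hc1 : 1 ≤ c := by
    by_contra h
    have : i ∣ q := Nat.dvd_of_mod_eq_zero (by omega)
    have := Nat.Coprime.eq_one_of_dvd hcop this
    omega
  have ha : 2 * a ≤ q := by nlinarith
  have hE := hT c hc1 hmod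
  have l1 := len_le_word (q := q) (x := q) (by omega)
  have l2 := len_le_word (q := q) (x := a) (by omega)
  have l3 := len_le_word (q := q) (x := c) (by omega)
  have l4 := len_le_word (q := q) (x := i) (by omega)
  have l5 := len_le_word (q := q) (x := ordProj[p] c)
    ((Nat.ordProj_le p (by omega)).trans (by omega))
  have l6 := len_le_word (q := q) (x := ordProj[p] c - 1)
    ((Nat.sub_le _ _).trans ((Nat.ordProj_le p (by omega)).trans (by omega)))
  have l7 : len i * len a ≤ len i * word q := Nat.mul_le_mul_left _ l2
  have hw := four_le_word q
  have hcast : (i : ZMod q) * a + c = 0 := by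
    rw [← Nat.cast_mul, ← Nat.cast_add, hdm, ZMod.natCast_self]
  simp [ratio, wp_branch, Op.eval, Op.cost, hg.3, h20, hg.5, ← hq, hadef, hcdef, hE.2.2.2]
  -- The tested register holds `ordProj[p] c - 1`, which vanishes exactly when `p` does not divide
  -- `c`.
  split_ifs with h
  · have hpc : ¬ p ∣ c := by
      intro hdvd
      have : 0 < c.factorization p := hp.factorization_pos_of_dvd (by omega) hdvd
      have : p ^ 1 ≤ ordProj[p] c := Nat.pow_le_pow_right hp.pos this
      rw [pow_one] at this
      have := hp.two_le
      omega
    refine ⟨?_, ⟨fun r hr => ?_, fun A hA => rfl⟩, ?_, hc1, hmod, hpc, ?_⟩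
    · omega
    · have : ∀ k < 20, r ≠ k := fun k hk => by omega
      simp [this]
    · have : 1 ≤ a := by
        rw [← hadef]
        exact Nat.div_pos (by omega) (by omega)
      omega
    · rw [Nat.cast_sub (by omega), ZMod.natCast_self]
      linear_combination -hcast
  · have hpc : p ∣ c := by
      by_contra hdvd
      rw [Nat.factorization_eq_zero_of_not_dvd hdvd] at h
      simp at h
    have l8 := len_le_word (q := q) (x := i - c) (by omega)
    refine ⟨?_, ⟨fun r hr => ?_, fun A hA => rfl⟩, ?_, ?_, ?_, ?_, ?_⟩
    · omega
    · have : ∀ k < 20, r ≠ k := fun k hk => by omega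
      simp [this]
    -- `a + 1 < q` follows from `2 a ≤ q` unless `q = 2`, which `2 ≤ i ≤ n < q` excludes.
    · have : q ≠ 2 ∨ 2 * a < q := by
        by_contra hcon
        have hq2' : q = 2 := by omega
        have : c = 0 ∨ i = 1 ∨ 2 < i := by omega
        rcases this with h | h | h
        · omega
        · omega
        · omega
      omega
    · omega
    · omega
    · exact fun h => hpi ((Nat.dvd_sub_iff_left hmod.le hpc).1 h)
    · rw [Nat.cast_sub hmod.le]
      linear_combination hcast

/-- Compute the entries of the arrays `5` and `6` for a prime number `i` in register `20`. -/
def primeEntry : Prog :=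
  block [.op .sub 1 20 40, .op .sub 2 40 20, .op .add 1 1 2,
    .branch 1
      (block [.store 6 20 44, ratio, .load 11 5 12, mulMod 10 11, .store 5 20 9])
      (block [.store 5 20 44, .store 6 20 20])]

theorem wp_primeEntry {env : ℕ → Behaviour} {p ℓ n : ℕ} [Fact p.Prime] {T : ℕ → ℕ}
    (hMul : CanMultiply env p ℓ T) (hℓ : 1 ≤ ℓ) (hn : n < p ^ ℓ) {s : Memory}
    (hg : Globals p ℓ n s) {i : ℕ} (hi : i.Prime) (hin : i ≤ n)
    (h20 : s.reg 20 = i) (hT : ∀ m, 1 ≤ m → m < i → Entry p (p ^ ℓ) s m) :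
    wp env primeEntry s fun s' cost => cost ≤ T 1 + 120 * word (p ^ ℓ) + 2 * (len i * word (p ^ ℓ)) ∧
      Agree 20 [1, 2, 5, 6] s s' ∧ ∃ v₅ v₆, s'.arr 5 = Function.update (s.arr 5) i v₅ ∧
        s'.arr 6 = Function.update (s.arr 6) i v₆ ∧ v₅ < p ^ ℓ ∧
        (v₅ : ZMod (p ^ ℓ)) * (ordCompl[p] i : ℕ) = 1 ∧ v₆ = ordProj[p] i := by
  have hp : p.Prime := Fact.out
  obtain ⟨hq2, hqp, hql⟩ := bounds_pow (p := p) hℓ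
  have hw := four_le_word (p ^ ℓ)
  have l1 := len_le_word (q := p ^ ℓ) (x := i) (by omega)
  have l2 := len_le_word (q := p ^ ℓ) (x := p) (by omega)
  have l3 := len_le_word (q := p ^ ℓ) (x := i - p) (by omega)
  have l4 := len_le_word (q := p ^ ℓ) (x := p - i) (by omega)
  have l5 := len_le_word (q := p ^ ℓ) (x := i - p + (p - i)) (by omega)
  simp only [primeEntry, wp_block_cons, wp_block_nil, wp_op, Op.eval, Op.cost, wp_branch,
    Memory.reg_setReg, h20, hg.1]
  norm_num only [if_true, if_false]
  -- With truncated subtraction, `(i - p) + (p - i)` is zero exactly when `i = p`.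
  split_ifs with hip
  · obtain rfl : i = p := by omega
    simp only [wp_store, Memory.reg_setReg, Memory.reg_setArr]
    norm_num only [if_true, if_false, h20, hg.5, len_one]
    refine ⟨by omega, ⟨fun r hr => ?_, fun A hA => ?_⟩, 1, i, ?_, ?_, by omega, ?_, ?_⟩
    · have : ∀ k < 20, r ≠ k := fun k hk => by omega
      simp [this]
    · simp only [List.mem_cons, List.not_mem_nil, or_false, not_or] at hA
      simp [hA]
    · simp
    · simp
    · rw [hp.factorization_self, pow_one, Nat.div_self hp.pos]
      simp
    · rw [hp.factorization_self, pow_one]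
  · have hpi : ¬ p ∣ i := fun h => by
      have := (Nat.prime_dvd_prime_iff_eq hp hi).1 h
      omega
    have hf : i.factorization p = 0 := Nat.factorization_eq_zero_of_not_dvd hpi
    simp only [wp_store, Memory.reg_setReg]
    norm_num only [if_true, if_false]
    refine (wp_ratio hℓ hn ?_ hi.two_le hin hpi ?_ ?_).mono ?_
    · constructor <;> simp [hg.1, hg.2, hg.3, hg.4, hg.5, hg.6, hg.7]
    · simp [h20]
    · intro m hm hmi
      exact (hT m hm hmi).congr (by simp) (by simp) (by simp [h20, hmi.ne])
    intro s1 c1 ⟨hc1, ha1, hX, hc, hci, hpc, hXc⟩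
    have hg1 : Globals p ℓ n s1 := by
      constructor <;> rw [ha1.1 _ (by norm_num)] <;> simp [hg.1, hg.2, hg.3, hg.4, hg.5, hg.6,
        hg.7]
    have e20 : s1.reg 20 = i := by simp [ha1.1, h20]
    have e5 : s1.arr 5 = s.arr 5 := by simp [ha1.2]
    have e6 : s1.arr 6 = Function.update (s.arr 6) i 1 := by simp [ha1.2, h20, hg.5]
    have hE := hT _ hc hci
    have hfc : (s1.reg 12).factorization p = 0 := Nat.factorization_eq_zero_of_not_dvd hpc
    have hEI := hE.2.2.1
    rw [hfc, pow_zero, Nat.div_one] at hEI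
    simp only [wp_load, e5]
    refine (wp_mulMod hMul hℓ (n := n) ?_ (by norm_num) (by norm_num) ?_ ?_).mono ?_
    · constructor <;> simp [hg1.1, hg1.2, hg1.3, hg1.4, hg1.5, hg1.6, hg1.7]
    · simpa using hX
    · simpa using hE.2.1
    intro s2 c2 ⟨hc2, hv, ha2⟩
    have e20' : s2.reg 20 = i := by simp [ha2.1, e20]
    have e5' : s2.arr 5 = s.arr 5 := by simp [ha2.2, e5]
    have e6' : s2.arr 6 = Function.update (s.arr 6) i 1 := by simp [ha2.2, e6]
    simp only [Memory.reg_setReg] at hv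
    norm_num only [if_true, if_false] at hv
    have hv1 : s2.reg 9 < p ^ ℓ := hv ▸ Nat.mod_lt _ (by omega)
    simp only [h20, hg.5, e20', len_one]
    refine ⟨?_, ⟨fun r hr => ?_, fun A hA => ?_⟩, s2.reg 9, 1, ?_, ?_, hv1, ?_, ?_⟩
    · have l6 := len_le_word (q := p ^ ℓ) (x := s1.reg 12) (by omega)
      have l7 := len_le_word (q := p ^ ℓ) (x := s.arr 5 (s1.reg 12)) (by have := hE.2.1; omega)
      have l8 := len_le_word (q := p ^ ℓ) (x := s2.reg 9) (by omega)
      omega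
    · have : ∀ k < 20, r ≠ k := fun k hk => by omega
      simp [ha2.1 r (by omega), this, ha1.1 r hr]
    · simp only [List.mem_cons, List.not_mem_nil, or_false, not_or] at hA
      simp [hA, ha2.2, ha1.2]
    · simp [e5']
    · simp [e6']
    · rw [hf, pow_zero, Nat.div_one, hv, ZMod.natCast_mod]
      push_cast
      linear_combination (s.arr 5 (s1.reg 12) : ZMod (p ^ ℓ)) * hXc + hEI
    · rw [hf, pow_zero]

/-- Fill the entries at `i r`, where registers `20` and `27` contain `i` and a prime `r`. -/
def strike : Prog :=
  block [mulMod 20 27, .op .add 13 9 46, .store 3 13 27, .load 10 5 20, .load 11 5 27,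
    mulMod 10 11, .store 5 13 9, .load 10 6 20, .load 11 6 27, mulMod 10 11, .store 6 13 9]

/-- The `p`-part and the inverse of the part prime to `p` are multiplicative, so the entries at `i
r` are products of known entries. Computing `i r` and its `p`-part modulo `p ^ ℓ` changes nothing,
as both are at most `n < p ^ ℓ`. -/
theorem wp_strike {env : ℕ → Behaviour} {p ℓ n : ℕ} [Fact p.Prime] {T : ℕ → ℕ}
    (hMul : CanMultiply env p ℓ T) (hℓ : 1 ≤ ℓ) (hn : n < p ^ ℓ) {s : Memory}
    (hg : Globals p ℓ n s) {i r : ℕ} (hi2 : 2 ≤ i) (hr : r.Prime) (hri : r ≤ i.minFac)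
    (hirn : i * r ≤ n) (h20 : s.reg 20 = i) (h27 : s.reg 27 = r) {K K' : ℕ → Prop}
    (hT : Table p (p ^ ℓ) K s) (hKi : K i) (hKr : K r) (hK' : ∀ m, K' m ↔ K m ∨ m = i * r) :
    wp env strike s fun s' cost => cost ≤ 3 * T 1 + 230 * word (p ^ ℓ) ∧
      Agree 20 [1, 2, 3, 5, 6] s s' ∧ Table p (p ^ ℓ) K' s' := by
  have hp : p.Prime := Fact.out
  obtain ⟨hq2, hqp, hql⟩ := bounds_pow (p := p) hℓ
  have hw := four_le_word (p ^ ℓ)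
  have hr2 := hr.two_le
  have hin : i ≤ n := (Nat.le_mul_of_pos_right i hr.pos).trans hirn
  have hrn : r ≤ n := (Nat.le_mul_of_pos_left r (by omega)).trans hirn
  have hEi := hT.1 i hKi
  have hEr := hT.1 r hKr
  have hPi : ordProj[p] i ≤ i := Nat.ordProj_le p (by omega)
  have hPr : ordProj[p] r ≤ r := Nat.ordProj_le p (by omega)
  have hPir : ordProj[p] i * ordProj[p] r = ordProj[p] (i * r) :=
    (Nat.ordProj_mul p (by omega) (by omega)).symm
  have hPirn : ordProj[p] (i * r) ≤ n := (Nat.ordProj_le p (by positivity)).trans hirn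
  have l1 := len_le_word (q := p ^ ℓ) (x := i) (by omega)
  have l2 := len_le_word (q := p ^ ℓ) (x := r) (by omega)
  have l3 := len_le_word (q := p ^ ℓ) (x := i * r) (by omega)
  have l4 := len_le_word (q := p ^ ℓ) (x := s.arr 5 i) (by have := hEi.2.1; omega)
  have l5 := len_le_word (q := p ^ ℓ) (x := s.arr 5 r) (by have := hEr.2.1; omega)
  have l6 := len_le_word (q := p ^ ℓ) (x := ordProj[p] i) (by omega)
  have l7 := len_le_word (q := p ^ ℓ) (x := ordProj[p] r) (by omega)
  have l8 := len_le_word (q := p ^ ℓ) (x := ordProj[p] (i * r)) (by omega)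
  simp only [strike, wp_block_cons, wp_block_nil]
  refine (wp_mulMod hMul hℓ hg (by norm_num) (by norm_num) (by omega) (by omega)).mono ?_
  intro s1 c1 ⟨hc1, hv1, ha1⟩
  have hg1 := hg.of_agree ha1
  rw [h20, h27, Nat.mod_eq_of_lt (by omega)] at hv1
  have e20 : s1.reg 20 = i := by simp [ha1.1, h20]
  have e27 : s1.reg 27 = r := by simp [ha1.1, h27]
  have e5 : s1.arr 5 = s.arr 5 := by simp [ha1.2]
  simp only [wp_op, wp_store, wp_load, Op.eval, Op.cost, Memory.reg_setReg, Memory.reg_setArr, hv1,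
    hg1.7, Memory.arr_setReg, Memory.arr_setArr]
  norm_num only [if_true, if_false, e20, e27, e5]
  refine (wp_mulMod hMul hℓ (n := n) ?_ (by norm_num) (by norm_num) ?_ ?_).mono ?_
  · constructor <;> simp [hg1.1, hg1.2, hg1.3, hg1.4, hg1.5, hg1.6, hg1.7]
  · simpa using hEi.2.1
  · simpa using hEr.2.1
  intro s2 c2 ⟨hc2, hv2, ha2⟩
  simp only [Memory.reg_setReg] at hv2
  norm_num only [if_true, if_false] at hv2
  have f20 : s2.reg 20 = i := by simp [ha2.1, e20]
  have f27 : s2.reg 27 = r := by simp [ha2.1, e27]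
  have f13 : s2.reg 13 = i * r := by simp [ha2.1]
  have f6 : s2.arr 6 = s.arr 6 := by simp [ha2.2, ha1.2]
  have hv2' : s2.reg 9 < p ^ ℓ := hv2 ▸ Nat.mod_lt _ (by omega)
  simp only [f20, f27,
    f13]
  norm_num only [if_true, if_false, f6, hEi.2.2.2, hEr.2.2.2, f27]
  refine (wp_mulMod hMul hℓ (n := n) ?_ (by norm_num) (by norm_num) ?_ ?_).mono ?_
  · constructor <;> simp [ha2.1, hg1.1, hg1.2, hg1.3, hg1.4, hg1.5, hg1.6, hg1.7]
  · simp; omega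
  · simp; omega
  intro s3 c3 ⟨hc3, hv3, ha3⟩
  simp only [Memory.reg_setReg] at hv3
  norm_num only [if_true, if_false] at hv3
  rw [hPir, Nat.mod_eq_of_lt (by omega)] at hv3
  have g13 : s3.reg 13 = i * r := by simp [ha3.1, f13]
  have l9 := len_le_word (q := p ^ ℓ) (x := s2.reg 9) (by omega)
  simp only [g13, hv3]
  refine ⟨?_, ⟨fun k hk => ?_, fun A hA => ?_⟩, ?_⟩
  · simp only [len_zero, add_zero]
    omega
  · have : ∀ j < 20, k ≠ j := fun j hj => by omega
    simp [this, ha3.1 k (by omega), ha2.1 k (by omega), ha1.1 k (by omega)]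
  · simp only [List.mem_cons, List.not_mem_nil, or_false, not_or] at hA
    simp [hA, ha3.2, ha2.2, ha1.2]
  · refine hT.update hK' (v₃ := r) (v₅ := s2.reg 9) (v₆ := ordProj[p] (i * r)) ?_ ?_ ?_
      (minFac_mul_of_le hi2 hr hri).symm hv2' ?_ rfl
    · simp [ha3.2, ha2.2, ha1.2]
    · simp [ha3.2, ha2.2, ha1.2]
    · simp [ha3.2, ha2.2, ha1.2]
    · rw [hv2, ZMod.natCast_mod, Nat.ordCompl_mul]
      push_cast
      linear_combination (s.arr 5 r : ZMod (p ^ ℓ)) * (ordCompl[p] r : ℕ) * hEi.2.2.1 + hEr.2.2.1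

/-- The numbers whose entries are known before the sieve comes to `i`. -/
def Known (n i m : ℕ) : Prop := 1 ≤ m ∧ m ≤ n ∧ (m < i ∨ (¬ m.Prime ∧ m / m.minFac < i))

/-- The numbers whose entries are known after `j` multiples of `i` have been marked. -/
def Struck (n i j m : ℕ) : Prop := Known n i m ∨ m = i ∨ ∃ k < j, m = i * Nat.nth Nat.Prime k

theorem struck_zero {n i m : ℕ} : Struck n i 0 m ↔ Known n i m ∨ m = i := by
  simp [Struck]

theorem struck_succ {n i j m : ℕ} :
    Struck n i (j + 1) m ↔ Struck n i j m ∨ m = i * Nat.nth Nat.Prime j := by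
  simp only [Struck, Nat.lt_succ_iff_lt_or_eq, or_and_right, exists_or, exists_eq_left, or_assoc]

/-- This is how primes are recognized: a composite `i` was marked at the earlier stage `i / minFac
i`. -/
theorem known_self {n i : ℕ} (hi2 : 2 ≤ i) (hin : i ≤ n) : Known n i i ↔ ¬ i.Prime := by
  have : i / i.minFac < i :=
    Nat.div_lt_self (by omega) (Nat.minFac_prime (by omega)).one_lt
  simp only [Known, lt_irrefl, false_or, this, and_true, hin, true_and, and_iff_right_iff_imp]
  intro _
  omega

/-- A composite `m` has to be marked at stage `i = m / minFac m`. Its cofactor `r = minFac m` is a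
prime with `r ≤ minFac i` and `r ≤ n / i`, and every such prime arises in this way. -/
theorem struck_strikes {n i m : ℕ} (hi2 : 2 ≤ i) (hin : i ≤ n) :
    Struck n i (strikes n i) m ↔ Known n (i + 1) m := by
  constructor
  · rintro (⟨h1, h2, h3⟩ | rfl | ⟨k, hk, rfl⟩)
    · exact ⟨h1, h2, h3.imp (by omega) (And.imp_right (by omega))⟩
    · exact ⟨by omega, hin, Or.inl (by omega)⟩
    · obtain ⟨h1, h2⟩ := lt_strikes_iff.1 hk
      have hr := Nat.prime_nth_prime k
      rw [Nat.le_div_iff_mul_le (by omega), mul_comm] at h2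
      refine ⟨Nat.mul_pos (by omega) hr.pos, h2, Or.inr ⟨?_, ?_⟩⟩
      · exact Nat.not_prime_mul (by omega) hr.ne_one
      · rw [minFac_mul_of_le hi2 hr h1, Nat.mul_div_cancel _ hr.pos]
        omega
  · rintro ⟨h1, h2, h3⟩
    rcases Nat.lt_trichotomy m i with h | h | h
    · exact Or.inl ⟨h1, h2, Or.inl h⟩
    · exact Or.inr (Or.inl h)
    · obtain ⟨h3, h4⟩ := h3.resolve_left (by omega)
      rcases lt_or_eq_of_le (Nat.lt_succ_iff.1 h4) with h5 | h5
      · exact Or.inl ⟨h1, h2, Or.inr ⟨h3, h5⟩⟩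
      · have hr := Nat.minFac_prime (show m ≠ 1 by omega)
        have hmi : i * m.minFac = m := by
          rw [← h5]
          exact Nat.div_mul_cancel (Nat.minFac_dvd m)
        refine Or.inr (Or.inr ⟨Nat.count Nat.Prime m.minFac, ?_, ?_⟩)
        · rw [lt_strikes_iff, Nat.nth_count hr, Nat.le_div_iff_mul_le (by omega), mul_comm, hmi]
          refine ⟨Nat.minFac_le_of_dvd (Nat.minFac_prime (by omega)).two_le ?_, h2⟩
          exact (Nat.minFac_dvd i).trans ⟨_, hmi.symm⟩
        · rw [Nat.nth_count hr, hmi]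

/-- Take the next prime for the multiples of the number `i` in register `20`, whose least prime
factor is in register `24`; register `26` becomes zero if no more multiples have to be marked. -/
def nextPrime : Prog :=
  block [.op .sub 1 24 27,
    .branch 1 (block [.op .add 25 25 44, .load 27 4 25, .op .add 1 23 44, .op .sub 26 1 27])
      (.const 26 0)]

/-- The memory after `j` multiples of `i` have been marked. -/
structure StrikeState (p ℓ n i c j : ℕ) (s₀ s : Memory) : Prop where
  globals : Globals p ℓ n s
  reg_i : s.reg 20 = i
  reg_count : s.reg 21 = c
  reg_primes : s.reg 22 = Nat.count Nat.Prime (i + 1)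
  reg_lim : s.reg 23 = n / i
  reg_minFac : s.reg 24 = i.minFac
  reg_j : j < strikes n i → s.reg 25 = j
  reg_prime : j < strikes n i → s.reg 27 = Nat.nth Nat.Prime j
  reg_go : s.reg 26 ≠ 0 ↔ j < strikes n i
  reg_go_le : s.reg 26 ≤ n + 1
  primes : ∀ k < Nat.count Nat.Prime (i + 1), s.arr 4 k = Nat.nth Nat.Prime k
  table : Table p (p ^ ℓ) (Struck n i j) s
  arr_eq : ∀ A, A ∉ [1, 2, 3, 4, 5, 6] → s.arr A = s₀.arr A

theorem wp_strike_nextPrime {env : ℕ → Behaviour} {p ℓ n : ℕ} [Fact p.Prime] {T : ℕ → ℕ}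
    (hMul : CanMultiply env p ℓ T) (hℓ : 1 ≤ ℓ) (hn : n < p ^ ℓ) {i : ℕ} (hi2 : 2 ≤ i)
    (hin : i ≤ n) {c j : ℕ} {s₀ s : Memory} (hs : StrikeState p ℓ n i c j s₀ s)
    (hj : j < strikes n i) :
    wp env (block [strike, nextPrime]) s fun s' cost => cost ≤ 3 * T 1 + 280 * word (p ^ ℓ) ∧
      StrikeState p ℓ n i c (j + 1) s₀ s' := by
  obtain ⟨hq2, hqp, hql⟩ := bounds_pow (p := p) hℓ
  have hw := four_le_word (p ^ ℓ)
  obtain ⟨hr1, hr2⟩ := lt_strikes_iff.1 hj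
  have hr := Nat.prime_nth_prime j
  have hmono : StrictMono (Nat.nth Nat.Prime) := Nat.nth_strictMono Nat.infinite_setOfPred_prime
  have hmfi : i.minFac ≤ i := Nat.minFac_le (by omega)
  have hmf : i.minFac.Prime := Nat.minFac_prime (by omega)
  have hir : i * Nat.nth Nat.Prime j ≤ n := by
    rwa [Nat.le_div_iff_mul_le (by omega), mul_comm] at hr2
  have hKr : Struck n i j (Nat.nth Nat.Prime j) := by
    rcases lt_or_eq_of_le (hr1.trans hmfi) with h | h
    · exact Or.inl ⟨hr.one_le, by omega, Or.inl h⟩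
    · exact Or.inr (Or.inl h)
  rw [wp_block_cons]
  refine (wp_strike hMul hℓ hn hs.globals hi2 hr hr1 hir hs.reg_i (hs.reg_prime hj) hs.table
    (Or.inr (Or.inl rfl)) hKr (fun m => struck_succ)).mono ?_
  intro s1 c1 ⟨hc1, ha1, hT⟩
  have hg1 := hs.globals.of_agree ha1
  have e20 : s1.reg 20 = i := by simp [ha1.1, hs.reg_i]
  have e21 : s1.reg 21 = c := by simp [ha1.1, hs.reg_count]
  have e22 : s1.reg 22 = Nat.count Nat.Prime (i + 1) := by simp [ha1.1, hs.reg_primes]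
  have e23 : s1.reg 23 = n / i := by simp [ha1.1, hs.reg_lim]
  have e24 : s1.reg 24 = i.minFac := by simp [ha1.1, hs.reg_minFac]
  have e25 : s1.reg 25 = j := by simp [ha1.1, hs.reg_j hj]
  have e27 : s1.reg 27 = Nat.nth Nat.Prime j := by simp [ha1.1, hs.reg_prime hj]
  have e4 : s1.arr 4 = s.arr 4 := by simp [ha1.2]
  have hni : n / i ≤ n := Nat.div_le_self _ _
  have hjle : j ≤ Nat.nth Nat.Prime j := hmono.le_apply
  have l1 := len_le_word (q := p ^ ℓ) (x := i.minFac) (by omega)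
  have l2 := len_le_word (q := p ^ ℓ) (x := Nat.nth Nat.Prime j) (by omega)
  have l3 := len_le_word (q := p ^ ℓ) (x := i.minFac - Nat.nth Nat.Prime j) (by omega)
  have l4 := len_le_word (q := p ^ ℓ) (x := j) (by omega)
  have l5 := len_le_word (q := p ^ ℓ) (x := j + 1) (by omega)
  have l6 := len_le_word (q := p ^ ℓ) (x := n / i) (by omega)
  have l7 := len_le_word (q := p ^ ℓ) (x := n / i + 1) (by omega)
  simp only [nextPrime, wp_block_cons, wp_block_nil, wp_op, Op.eval, Op.cost, wp_branch,
    Memory.reg_setReg]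
  norm_num only [if_true, if_false, e24, e27, e25, e23, hg1.5]
  split_ifs with h
  · have heq : Nat.nth Nat.Prime j = i.minFac := by omega
    have hnot : ¬ j + 1 < strikes n i := by
      rw [lt_strikes_iff, ← heq, not_and_or]
      exact Or.inl (not_le.2 (hmono (Nat.lt_succ_self j)))
    simp only [wp_const, len_zero]
    refine ⟨by omega, ?_⟩
    constructor
    · constructor <;> simp [hg1.1, hg1.2, hg1.3, hg1.4, hg1.5, hg1.6, hg1.7]
    · simp [e20]
    · simp [e21]
    · simp [e22]
    · simp [e23]
    · simp [e24]
    · exact fun h => absurd h hnot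
    · exact fun h => absurd h hnot
    · simp [hnot]
    · simp
    · simpa [e4] using hs.primes
    · exact hT.congr (fun _ => Iff.rfl) rfl rfl rfl
    · intro A hA
      rw [← hs.arr_eq A hA]
      simp only [List.mem_cons, List.not_mem_nil, or_false, not_or] at hA
      simp [hA, ha1.2]
  · have hlt : Nat.nth Nat.Prime j < i.minFac := by omega
    have hj1 : Nat.nth Nat.Prime (j + 1) ≤ i.minFac := by
      rw [← Nat.nth_count hmf] at hlt ⊢
      exact hmono.monotone (hmono.lt_iff_lt.1 hlt)
    -- The next prime is at most `minFac i ≤ i`, hence already in the list.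
    have hj2 : j + 1 < Nat.count Nat.Prime (i + 1) := by
      refine (Nat.lt_nth_iff_count_lt Nat.infinite_setOfPred_prime).2 ?_
      change Nat.nth Nat.Prime (j + 1) < i + 1
      omega
    have e4j := hs.primes _ hj2
    simp only [wp_load, Memory.reg_setReg, Memory.arr_setReg]
    norm_num only [if_true, if_false, e4, e4j, e23, hg1.5, e25]
    have hpn : Nat.nth Nat.Prime (j + 1) ≤ n := by omega
    have l8 := len_le_word (q := p ^ ℓ) (x := Nat.nth Nat.Prime (j + 1)) (by omega)
    refine ⟨by simp only [len_one]; omega, ?_⟩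
    constructor
    · constructor <;> simp [hg1.1, hg1.2, hg1.3, hg1.4, hg1.5, hg1.6, hg1.7]
    · simp [e20]
    · simp [e21]
    · simp [e22]
    · simp [e23]
    · simp [e24]
    · simp
    · simp
    · simp only [Memory.reg_setReg]
      norm_num only [if_true, if_false]
      rw [lt_strikes_iff]
      omega
    · simp only [Memory.reg_setReg]
      norm_num only [if_true, if_false]
      omega
    · simpa [e4] using hs.primes
    · exact hT.congr (fun _ => Iff.rfl) rfl rfl rfl
    · intro A hA
      rw [← hs.arr_eq A hA]
      simp only [List.mem_cons, List.not_mem_nil, or_false, not_or] at hA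
      simp [hA, ha1.2]

theorem wp_strike_loop {env : ℕ → Behaviour} {p ℓ n : ℕ} [Fact p.Prime] {T : ℕ → ℕ}
    (hMul : CanMultiply env p ℓ T) (hℓ : 1 ≤ ℓ) (hn : n < p ^ ℓ) {i : ℕ} (hi2 : 2 ≤ i)
    (hin : i ≤ n) {c : ℕ} {s₀ : Memory} (d : ℕ) {j : ℕ} {s : Memory} (hd : j + d = strikes n i)
    (hs : StrikeState p ℓ n i c j s₀ s) :
    wp env (.loop 26 (block [strike, nextPrime])) s fun s' cost =>
      cost ≤ d * (3 * T 1 + 290 * word (p ^ ℓ)) + word (p ^ ℓ) ∧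
      StrikeState p ℓ n i c (strikes n i) s₀ s' := by
  have hw := four_le_word (p ^ ℓ)
  induction d generalizing j s with
  | zero =>
    obtain rfl : j = strikes n i := by omega
    refine wp_loop_of_eq_zero ?_ ⟨by rw [len_zero]; omega, hs⟩
    by_contra h
    exact lt_irrefl _ (hs.reg_go.1 h)
  | succ d ih =>
    have hj : j < strikes n i := by omega
    refine wp_loop_of_ne_zero (hs.reg_go.2 hj) ?_
    refine (wp_strike_nextPrime hMul hℓ hn hi2 hin hs hj).mono ?_
    intro s1 c1 ⟨hc1, hs1⟩
    refine (ih (by omega) hs1).mono ?_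
    intro s2 c2 ⟨hc2, hs2⟩
    refine ⟨?_, hs2⟩
    have := len_le_word (q := p ^ ℓ) (x := s.reg 26) (hs.reg_go_le.trans (by omega))
    rw [Nat.succ_mul]
    omega

/-- The memory before the sieve comes to `i`. -/
structure SieveState (p ℓ n i : ℕ) (s₀ s : Memory) : Prop where
  globals : Globals p ℓ n s
  reg_primes : s.reg 22 = Nat.count Nat.Prime i
  primes : ∀ k < Nat.count Nat.Prime i, s.arr 4 k = Nat.nth Nat.Prime k
  table : Table p (p ^ ℓ) (Known n i) s
  arr_eq : ∀ A, A ∉ [1, 2, 3, 4, 5, 6] → s.arr A = s₀.arr A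

/-- If the number in register `20` is not marked, add it to the list of primes. -/
def enterPrime : Prog :=
  block [.load 1 3 20,
    .branch 1 .skip (block [.store 3 20 20, .store 4 22 20, .op .add 22 22 44, primeEntry])]

theorem wp_enterPrime {env : ℕ → Behaviour} {p ℓ n : ℕ} [Fact p.Prime] {T : ℕ → ℕ}
    (hMul : CanMultiply env p ℓ T) (hℓ : 1 ≤ ℓ) (hn : n < p ^ ℓ) {i : ℕ} (hi2 : 2 ≤ i)
    (hin : i ≤ n) {s₀ s : Memory} (hs : SieveState p ℓ n i s₀ s) (h20 : s.reg 20 = i) :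
    wp env enterPrime s fun s' cost => cost ≤ T 1 + 140 * word (p ^ ℓ) +
        2 * ((if i.Prime then len i else 0) * word (p ^ ℓ)) ∧
      Globals p ℓ n s' ∧ s'.reg 20 = i ∧ s'.reg 21 = s.reg 21 ∧
      s'.reg 22 = Nat.count Nat.Prime (i + 1) ∧
      (∀ k < Nat.count Nat.Prime (i + 1), s'.arr 4 k = Nat.nth Nat.Prime k) ∧
      Table p (p ^ ℓ) (Struck n i 0) s' ∧ ∀ A, A ∉ [1, 2, 3, 4, 5, 6] → s'.arr A = s₀.arr A := by
  obtain ⟨hq2, hqp, hql⟩ := bounds_pow (p := p) hℓ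
  have hw := four_le_word (p ^ ℓ)
  have hg := hs.globals
  have l1 := len_le_word (q := p ^ ℓ) (x := i) (by omega)
  simp only [enterPrime, wp_block_cons, wp_block_nil, wp_load, wp_branch, Memory.reg_setReg, h20]
  norm_num only [if_true, if_false]
  by_cases hi : i.Prime
  · have h3 : s.arr 3 i = 0 := hs.table.2 i hi2 fun h => (known_self hi2 hin).1 h hi
    have hcount : Nat.count Nat.Prime i ≤ i := Nat.count_le _
    have l2 := len_le_word (q := p ^ ℓ) (x := Nat.count Nat.Prime i) (by omega)
    rw [if_pos h3]
    simp only [wp_store, wp_op, Op.eval, Op.cost, Memory.reg_setReg,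
      Memory.reg_setArr, h20, h3, hs.reg_primes, hg.5]
    norm_num only [if_true, if_false]
    refine (wp_primeEntry hMul hℓ hn ?_ hi hin ?_ ?_).mono ?_
    · constructor <;> simp [hg.1, hg.2, hg.3, hg.4, hg.5, hg.6, hg.7]
    · simp [h20]
    · intro m hm hmi
      exact (hs.table.1 m ⟨hm, by omega, Or.inl hmi⟩).congr (by simp [hmi.ne]) (by simp) (by simp)
    intro s1 c1 ⟨hc1, ha1, v₅, v₆, h5, h6, hv₅, hv₅', hv₆⟩
    have hc : Nat.count Nat.Prime (i + 1) = Nat.count Nat.Prime i + 1 := by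
      rw [Nat.count_succ, if_pos hi]
    rw [if_pos hi]
    refine ⟨?_, ?_, ?_, ?_, ?_, ?_, ?_, ?_⟩
    · simp only [len_zero, len_one]
      omega
    · constructor <;> rw [ha1.1 _ (by norm_num)] <;> simp [hg.1, hg.2, hg.3, hg.4, hg.5, hg.6,
        hg.7]
    · simp [ha1.1, h20]
    · simp [ha1.1]
    · simp [ha1.1, hc]
    · intro k hk
      have e4 : s1.arr 4 = Function.update (s.arr 4) (Nat.count Nat.Prime i) i := by
        simp [ha1.2]
      rw [e4, Function.update_apply]
      split_ifs with hki
      · rw [hki, Nat.nth_count hi]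
      · exact hs.primes k (by omega)
    · refine hs.table.update (fun m => struck_zero) (v₃ := i) (v₅ := v₅) (v₆ := v₆) ?_ ?_ ?_
        hi.minFac_eq.symm hv₅ hv₅' hv₆
      · simp [ha1.2]
      · simpa using h5
      · simpa using h6
    · intro A hA
      rw [← hs.arr_eq A hA]
      simp only [List.mem_cons, List.not_mem_nil, or_false, not_or] at hA
      simp [hA, ha1.2]
  · have hK : Known n i i := (known_self hi2 hin).2 hi
    have h3 : s.arr 3 i = i.minFac := (hs.table.1 i hK).1 hi2
    have hmf := (Nat.minFac_prime (show i ≠ 1 by omega)).two_le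
    have hmfi : i.minFac ≤ i := Nat.minFac_le (by omega)
    have hc : Nat.count Nat.Prime (i + 1) = Nat.count Nat.Prime i := by
      rw [Nat.count_succ, if_neg hi, add_zero]
    have l2 := len_le_word (q := p ^ ℓ) (x := i.minFac) (by omega)
    rw [if_neg (by omega), wp_skip, h3, if_neg hi, hc]
    refine ⟨by omega, ?_, by simp [h20], by simp, by simp [hs.reg_primes], by simpa using hs.primes,
      ?_, by simpa using hs.arr_eq⟩
    · constructor <;> simp [hg.1, hg.2, hg.3, hg.4, hg.5, hg.6, hg.7]
    · refine hs.table.congr (fun m => ?_) rfl rfl rfl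
      rw [struck_zero, or_iff_left_iff_imp]
      rintro rfl
      exact hK

/-- One stage of the sieve. -/
def sieveBody : Prog :=
  block [enterPrime, .op .div 23 43 20, .load 24 3 20, .const 25 0, .load 27 4 25,
    .op .add 1 23 44, .op .sub 26 1 27, .loop 26 (block [strike, nextPrime])]

theorem wp_sieveBody {env : ℕ → Behaviour} {p ℓ n : ℕ} [Fact p.Prime] {T : ℕ → ℕ}
    (hMul : CanMultiply env p ℓ T) (hℓ : 1 ≤ ℓ) (hn : n < p ^ ℓ) {i : ℕ} (hi2 : 2 ≤ i)
    (hin : i ≤ n) {s₀ s : Memory} (hs : SieveState p ℓ n i s₀ s) (h20 : s.reg 20 = i) :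
    wp env sieveBody s fun s' cost => cost ≤ T 1 + 160 * word (p ^ ℓ) +
        2 * ((if i.Prime then len i else 0) * word (p ^ ℓ)) + len (n / i) * word (p ^ ℓ) +
        strikes n i * (3 * T 1 + 290 * word (p ^ ℓ)) ∧
      s'.reg 20 = i ∧ s'.reg 21 = s.reg 21 ∧ SieveState p ℓ n (i + 1) s₀ s' := by
  obtain ⟨hq2, hqp, hql⟩ := bounds_pow (p := p) hℓ
  have hw := four_le_word (p ^ ℓ)
  rw [sieveBody, wp_block_cons]
  refine (wp_enterPrime hMul hℓ hn hi2 hin hs h20).mono ?_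
  intro s1 c1 ⟨hc1, hg1, e20, e21, e22, hp4, hT, hA1⟩
  have e3 : s1.arr 3 i = i.minFac := (hT.1 i (Or.inr (Or.inl rfl))).1 hi2
  have hmf := (Nat.minFac_prime (show i ≠ 1 by omega)).two_le
  have hmfi : i.minFac ≤ i := Nat.minFac_le (by omega)
  have hcount : 0 < Nat.count Nat.Prime (i + 1) := by
    refine (Nat.lt_nth_iff_count_lt Nat.infinite_setOfPred_prime).2 ?_
    change Nat.nth Nat.Prime 0 < i + 1
    rw [Nat.nth_prime_zero_eq_two]
    omega
  have e4 : s1.arr 4 0 = 2 := by rw [hp4 0 hcount, Nat.nth_prime_zero_eq_two]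
  have hni : n / i ≤ n := Nat.div_le_self _ _
  simp only [wp_block_cons, wp_block_nil, wp_load, wp_const, wp_op, Op.eval, Op.cost,
    Memory.reg_setReg, Memory.arr_setReg]
  norm_num only [if_true, if_false, e20, hg1.4, e3, e4, hg1.5]
  refine (wp_strike_loop hMul hℓ hn hi2 hin (c := s.reg 21) (s₀ := s₀) (strikes n i)
    (zero_add _) ?_).mono ?_
  · constructor
    · constructor <;> simp [hg1.1, hg1.2, hg1.3, hg1.4, hg1.5, hg1.6, hg1.7]
    · simp [e20]
    · simp [e21]
    · simp [e22]
    · simp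
    · simp
    · simp
    · simp [Nat.nth_prime_zero_eq_two]
    -- The first prime `2` never exceeds `minFac i`, so only its comparison with `n / i` has to be
    -- coded in register `26`.
    · simp only [Memory.reg_setReg, lt_strikes_iff, Nat.nth_prime_zero_eq_two]
      norm_num only [if_true, if_false]
      omega
    · simp
      omega
    · simpa using hp4
    · exact hT.congr (fun _ => Iff.rfl) rfl rfl rfl
    · simpa using hA1
  · intro s2 c2 ⟨hc2, hs2⟩
    refine ⟨?_, hs2.reg_i, hs2.reg_count, hs2.globals, hs2.reg_primes, hs2.primes, ?_, hs2.arr_eq⟩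
    · have l1 := len_le_word (q := p ^ ℓ) (x := i) (by omega)
      have l2 := len_le_word (q := p ^ ℓ) (x := n) (by omega)
      have l3 := len_le_word (q := p ^ ℓ) (x := i.minFac) (by omega)
      have l4 := len_le_word (q := p ^ ℓ) (x := n / i) (by omega)
      have l5 := len_le_word (q := p ^ ℓ) (x := n / i + 1) (by omega)
      have l6 := len_le_word (q := p ^ ℓ) (x := 2) (by omega)
      have l7 : len i * len (n / i) ≤ len (n / i) * word (p ^ ℓ) := by
        rw [mul_comm]
        exact Nat.mul_le_mul_left _ l1
      simp only [len_zero, len_one]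
      omega
    · exact hs2.table.congr (fun m => (struck_strikes hi2 hin).symm) rfl rfl rfl

/-- Compute the least prime factors, the inverses of the factors prime to `p`, and the powers of
`p` in the numbers up to the content of register `43`. -/
def sieve : Prog :=
  block [.const 1 1, .store 5 1 1, .store 6 1 1, .const 22 0, .const 20 2, .op .sub 21 43 44,
    forLoop 20 21 sieveBody]

theorem wp_sieve {env : ℕ → Behaviour} {p ℓ n : ℕ} [Fact p.Prime] {T : ℕ → ℕ}
    (hMul : CanMultiply env p ℓ T) (hℓ : 1 ≤ ℓ) (hn0 : 1 ≤ n) (hn : n < p ^ ℓ) {s : Memory}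
    (hg : Globals p ℓ n s) (h3 : ∀ m, s.arr 3 m = 0) :
    wp env sieve s fun s' cost => cost ≤ 600 * (n * T 1) + 600 * (n * word (p ^ ℓ)) ∧
      Globals p ℓ n s' ∧ (∀ A, A ∉ [1, 2, 3, 4, 5, 6] → s'.arr A = s.arr A) ∧
      ∀ m, 1 ≤ m → m ≤ n → s'.arr 5 m < p ^ ℓ ∧
        (s'.arr 5 m : ZMod (p ^ ℓ)) * (ordCompl[p] m : ℕ) = 1 ∧ s'.arr 6 m = ordProj[p] m := by
  obtain ⟨hq2, hqp, hql⟩ := bounds_pow (p := p) hℓ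
  have hw := four_le_word (p ^ ℓ)
  simp only [sieve, wp_block_cons, wp_block_nil, wp_store, wp_const, wp_op, Op.eval, Op.cost,
    Memory.reg_setReg, Memory.reg_setArr]
  norm_num only [if_true, if_false, hg.4, hg.5]
  refine (wp_forLoop (q := p ^ ℓ) (a := 2) (N := n - 1) (by norm_num) (by norm_num) (by norm_num)
    (by omega) (fun j s' => SieveState p ℓ n (2 + j) s s')
    (fun j => T 1 + 160 * word (p ^ ℓ) +
        2 * ((if (2 + j).Prime then len (2 + j) else 0) * word (p ^ ℓ)) +
        len (n / (2 + j)) * word (p ^ ℓ) +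
        strikes n (2 + j) * (3 * T 1 + 290 * word (p ^ ℓ))) ?_ ?_ ?_ ?_ ?_).mono ?_
  · intro j hj s1 hs1 h20 h21 h44
    refine (wp_sieveBody hMul hℓ hn (by omega) (by omega) hs1 h20).mono ?_
    intro s2 c2 ⟨hc2, e20, e21, hs2⟩
    change SieveState p ℓ n (2 + (j + 1)) s s2 at hs2
    refine ⟨hc2, e20, e21.trans h21, hs2.globals.5, fun x y => ?_⟩
    have hg2 := hs2.globals
    constructor
    · constructor <;> simp [hg2.1, hg2.2, hg2.3, hg2.4, hg2.5, hg2.6, hg2.7]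
    · simpa using hs2.reg_primes
    · simpa using hs2.primes
    · exact hs2.table.congr (fun _ => Iff.rfl) rfl rfl rfl
    · simpa using hs2.arr_eq
  · constructor
    · constructor <;> simp [hg.1, hg.2, hg.3, hg.4, hg.5, hg.6, hg.7]
    · simp [Nat.count_eq_card_filter_range]
      decide
    · intro k hk
      have : Nat.count Nat.Prime (2 + 0) = 0 := by decide
      omega
    · refine ⟨fun m hm => ?_, fun m _ _ => by simp [h3]⟩
      -- Before stage `2` only `1` is known: if `m / minFac m < 2` with `m > 1`, then `m` equals its
      -- least prime factor and is not composite.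
      obtain rfl : m = 1 := by
        obtain ⟨h1, h2, h3 | ⟨h3, h4⟩⟩ := hm
        · omega
        · by_contra hne
          have h5 := Nat.minFac_prime hne
          have h6 : m / m.minFac = 1 := by
            have := Nat.div_pos (Nat.minFac_le (show 0 < m by omega)) h5.pos
            omega
          have h7 := Nat.div_mul_cancel (Nat.minFac_dvd m)
          rw [h6, one_mul] at h7
          exact h3 (h7 ▸ h5)
      refine ⟨by omega, ?_, ?_, ?_⟩
      · simp
        omega
      · simp
      · simp
    · intro A hA
      simp only [List.mem_cons, List.not_mem_nil, or_false, not_or] at hA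
      simp [hA]
  · simp
  · simp
  · simp [hg.5]
  · intro s1 c1 ⟨hc1, hs1⟩
    refine ⟨?_, hs1.globals, hs1.arr_eq, fun m hm hmn =>
      (hs1.table.1 m ⟨hm, hmn, Or.inl (by omega)⟩).2⟩
    -- The stages have unequal costs; prime entries, quotients `n / i` and marks are each summed
    -- over all stages.
    have b1 := Nat.mul_le_mul_right (word (p ^ ℓ)) (sum_len_prime_le n)
    have b2 := Nat.mul_le_mul_right (word (p ^ ℓ)) (sum_len_div_le n)
    have b3 := Nat.mul_le_mul_right (3 * T 1 + 290 * word (p ^ ℓ)) (sum_strikes_le n)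
    simp only [Finset.sum_add_distrib, Finset.sum_const, Finset.card_range, smul_eq_mul,
      ← Finset.mul_sum, ← Finset.sum_mul] at hc1
    have l1 := len_le_word (q := p ^ ℓ) (x := n) (by omega)
    have l2 := len_le_word (q := p ^ ℓ) (x := 2) (by omega)
    have e1 : (n - 1) * T 1 ≤ n * T 1 := Nat.mul_le_mul_right _ (Nat.sub_le _ _)
    have e2 : (n - 1) * word (p ^ ℓ) ≤ n * word (p ^ ℓ) := Nat.mul_le_mul_right _ (Nat.sub_le _ _)
    have e3 : word (p ^ ℓ) ≤ n * word (p ^ ℓ) := Nat.le_mul_of_pos_left _ hn0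
    have e4 : (n - 1) * (160 * word (p ^ ℓ)) = 160 * ((n - 1) * word (p ^ ℓ)) := by ring
    have e5 : (n - 1) * (7 * word (p ^ ℓ)) = 7 * ((n - 1) * word (p ^ ℓ)) := by ring
    have e6 : n * (3 * T 1 + 290 * word (p ^ ℓ)) = 3 * (n * T 1) + 290 * (n * word (p ^ ℓ)) := by
      ring
    have e7 : 6 * n * word (p ^ ℓ) = 6 * (n * word (p ^ ℓ)) := by ring
    have e8 : 3 * n * word (p ^ ℓ) = 3 * (n * word (p ^ ℓ)) := by ring
    simp only [len_zero, len_one]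
    omega

/-! ## The Newton iteration -/

theorem holds_mk {q : ℕ} {s : Memory} {A m : ℕ} (h : ∀ i ≤ m, s.arr A i < q) :
    Holds s A m (PowerSeries.mk fun i => (s.arr A i : ZMod q)) := fun i hi => by
  rw [PowerSeries.coeff_mk, ZMod.val_natCast, Nat.mod_eq_of_lt (h i hi)]

theorem Holds.mk_sub_mem {q : ℕ} [NeZero q] {s : Memory} {A m : ℕ} {F : (ZMod q)⟦X⟧}
    (h : Holds s A m F) :
    (PowerSeries.mk fun i => (s.arr A i : ZMod q)) - F ∈ congrIdeal (0 : ZMod q) (m + 1) := by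
  rw [mem_congrIdeal_zero]
  intro i hi
  rw [map_sub, PowerSeries.coeff_mk, h i (by omega), ZMod.natCast_zmod_val, sub_self]

/-- Put in array `B` the negatives of entries of array `2`, from the index in register `18` on, as
many as register `19` says. -/
def negate (B : ℕ) : Prog :=
  forLoop 18 19 (block [.load 1 2 18, .op .sub 1 42 1, .op .mod 1 1 42, .store B 18 1])

theorem len_div_le_two {a q : ℕ} (h : a < 2 * q) : len (a / q) ≤ 2 := by
  have : a / q ≤ 1 := Nat.le_of_lt_succ (Nat.div_lt_of_lt_mul (by omega))
  exact (len_mono this).trans (by simp)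

/-- A reduction whose quotient is bounded is linear in the word length; those in `negate`,
`residual` and `inverseStep` are of this kind. -/
theorem len_mul_len_div_le {a q : ℕ} (h : a < 2 * q) : len q * len (a / q) ≤ 2 * word q := by
  have := Nat.mul_le_mul (len_le_word (q := q) (x := q) (by omega)) (len_div_le_two h)
  omega

theorem wp_negate {env : ℕ → Behaviour} {p ℓ n : ℕ} [Fact p.Prime] (hℓ : 1 ≤ ℓ) {s : Memory}
    (hg : Globals p ℓ n s) {B a N m : ℕ} (hB : B ≠ 2) (haN : a + N = m + 1) (hm : m < p ^ ℓ)
    (h18 : s.reg 18 = a) (h19 : s.reg 19 = N) {F : (ZMod (p ^ ℓ))⟦X⟧} (hF : Holds s 2 m F) :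
    wp env (negate B) s fun s' c => c ≤ 20 * ((m + 1) * word (p ^ ℓ)) + word (p ^ ℓ) ∧
      Agree 20 [B] s s' ∧ ∀ x, s'.arr B x =
        if a ≤ x ∧ x < a + N then (-PowerSeries.coeff x F).val else s.arr B x := by
  have : NeZero (p ^ ℓ) := ⟨pow_ne_zero _ (Fact.out : p.Prime).ne_zero⟩
  obtain ⟨hq2, hqp, hql⟩ := bounds_pow (p := p) hℓ
  have hw := four_le_word (p ^ ℓ)
  refine (wp_forLoop_fill (q := p ^ ℓ) (B := B) (by omega) (fun x => (-PowerSeries.coeff x F).val)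
    (fun _ => 13 * word (p ^ ℓ)) s [] ?_ hg.5 h18 h19).mono ?_
  · intro j hj s1 ha1 e18
    have e2 : s1.arr 2 = s.arr 2 := ha1.2 2 (by simpa using hB.symm)
    have e42 : s1.reg 42 = p ^ ℓ := by rw [ha1.1 42 (by norm_num), hg.3]
    have hlt := hF.le (i := a + j) (by omega)
    have hv : (p ^ ℓ - s.arr 2 (a + j)) % p ^ ℓ = (-PowerSeries.coeff (a + j) F).val := by
      rw [hF _ (by omega), ZMod.neg_val']
    have hvlt : (-PowerSeries.coeff (a + j) F).val < p ^ ℓ := ZMod.val_lt _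
    simp only [wp_block_cons, wp_block_nil, wp_load, wp_store, wp_op, Op.eval, Op.cost,
      Memory.reg_setReg]
    norm_num only [if_true, if_false, e18, e2, e42, hv]
    refine ⟨?_, ⟨fun r hr => ?_, fun A hA => ?_⟩, by simp⟩
    · have l1 := len_le_word (q := p ^ ℓ) (x := a + j) (by omega)
      have l2 := len_le_word (q := p ^ ℓ) (x := s.arr 2 (a + j)) (by omega)
      have l3 := len_le_word (q := p ^ ℓ) (x := p ^ ℓ) (by omega)
      have l4 := len_le_word (q := p ^ ℓ) (x := p ^ ℓ - s.arr 2 (a + j)) (by omega)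
      have l5 := len_le_word (q := p ^ ℓ) (x := (-PowerSeries.coeff (a + j) F).val) (by omega)
      have l6 := len_mul_len_div_le (a := p ^ ℓ - s.arr 2 (a + j)) (q := p ^ ℓ) (by omega)
      omega
    · have : ∀ k < 10, r ≠ k := fun k hk => by omega
      simp [this]
    · simp only [List.mem_cons, List.not_mem_nil, or_false] at hA
      simp [hA]
  · intro s1 c1 ⟨hc1, ha1, h1⟩
    refine ⟨?_, ha1, h1⟩
    rw [Finset.sum_const, Finset.card_range, smul_eq_mul] at hc1
    have : N * (13 * word (p ^ ℓ) + 7 * word (p ^ ℓ)) ≤ 20 * ((m + 1) * word (p ^ ℓ)) := by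
      have := Nat.mul_le_mul_right (20 * word (p ^ ℓ)) (show N ≤ m + 1 by omega)
      linarith
    omega

/-- The Newton step for the inverse of the polynomial in array `9`: replace the content `V` of
array `8` by `V (2 - F V)`. -/
def inverseStep : Prog :=
  block [polyMul 9 8, .const 18 0, .op .add 19 30 44, negate 10, .load 1 10 46, .op .add 1 1 45,
    .op .mod 1 1 42, .store 10 46 1, polyMul 8 10, .op .add 20 30 44, copy 2 46 8 46 20]

theorem wp_inverseStep {env : ℕ → Behaviour} {p ℓ n : ℕ} [Fact p.Prime] {T : ℕ → ℕ}
    (hT : CanMultiply env p ℓ T) (hℓ : 1 ≤ ℓ) {s : Memory} (hg : Globals p ℓ n s) {m : ℕ}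
    (hm : 1 ≤ m) (hmq : m < p ^ ℓ) (hm30 : s.reg 30 = m)
    {f v : (ZMod (p ^ ℓ))⟦X⟧} (hf : Holds s 9 m f) (hv : Holds s 8 m v) :
    wp env inverseStep s fun s' c => c ≤ 2 * T m + 300 * ((m + 1) * word (p ^ ℓ)) ∧
      Agree 30 [1, 2, 8, 10] s s' ∧ Holds s' 8 m (v * (2 - f * v)) ∧
      ∀ x, m < x → s'.arr 8 x = s.arr 8 x := by
  have : NeZero (p ^ ℓ) := ⟨pow_ne_zero _ (Fact.out : p.Prime).ne_zero⟩
  obtain ⟨hq2, hqp, hql⟩ := bounds_pow (p := p) hℓ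
  have hw := four_le_word (p ^ ℓ)
  rw [inverseStep, wp_block_cons]
  refine (wp_polyMul hT hℓ hg (by norm_num) (by norm_num) hm hmq hm30 hf hv).mono ?_
  intro s1 c1 ⟨hc1, ha1, h1⟩
  have hg1 := hg.of_agree ha1
  have e30 : s1.reg 30 = m := by rw [ha1.1 30 (by norm_num), hm30]
  simp only [wp_block_cons, wp_block_nil, wp_op, wp_const, Op.eval, Op.cost, Memory.reg_setReg]
  norm_num only [if_true, if_false, e30, hg1.5]
  refine (wp_negate (B := 10) (a := 0) (N := m + 1) (m := m) (F := f * v) hℓ (n := n) ?_ (by norm_num)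
    (by omega) hmq ?_ ?_ ?_).mono ?_
  · constructor <;> simp [hg1.1, hg1.2, hg1.3, hg1.4, hg1.5, hg1.6, hg1.7]
  · simp
  · simp
  · exact h1
  intro s2 c2 ⟨hc2, ha2, h2⟩
  have hg2 : Globals p ℓ n s2 := by
    constructor <;> rw [ha2.1 _ (by norm_num)] <;>
      simp [hg1.1, hg1.2, hg1.3, hg1.4, hg1.5, hg1.6, hg1.7]
  have f30 : s2.reg 30 = m := by simp [ha2.1, e30]
  have f8 : s2.arr 8 = s.arr 8 := by simp [ha2.2, ha1.2]
  have h20 := h2 0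
  rw [if_pos (by omega)] at h20
  have hlt0 := ZMod.val_lt (-PowerSeries.coeff 0 (f * v))
  simp only [wp_load, wp_store, Memory.reg_setReg]
  norm_num only [if_true, if_false, hg2.7, hg2.6, hg2.3, h20]
  refine (wp_polyMul (F := v) (G := 2 - f * v) hT hℓ (n := n) ?_ (by norm_num) (by norm_num) hm hmq
    ?_ ?_ ?_).mono ?_
  · constructor <;> simp [hg2.1, hg2.2, hg2.3, hg2.4, hg2.5, hg2.6, hg2.7]
  · simp [f30]
  · intro i hi
    simpa [f8] using hv i hi
  · intro i hi
    simp only [Memory.arr_setReg, Memory.arr_setArr, if_true, Function.update_apply]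
    have hC : PowerSeries.coeff i (2 : (ZMod (p ^ ℓ))⟦X⟧) = if i = 0 then 2 else 0 :=
      PowerSeries.coeff_C i 2
    rw [map_sub, hC]
    split_ifs with h0
    · subst h0
      rw [show 2 - PowerSeries.coeff 0 (f * v) =
        (((-PowerSeries.coeff 0 (f * v)).val + 2 : ℕ) : ZMod (p ^ ℓ)) by push_cast; simp; ring,
        ZMod.val_natCast]
    · rw [h2, if_pos (by omega), zero_sub]
  intro s3 c3 ⟨hc3, ha3, h3⟩
  have hg3 : Globals p ℓ n s3 := by
    constructor <;> rw [ha3.1 _ (by norm_num)] <;>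
      simp [hg2.1, hg2.2, hg2.3, hg2.4, hg2.5, hg2.6, hg2.7]
  have g30 : s3.reg 30 = m := by simp [ha3.1, f30]
  refine (wp_copy (q := p ^ ℓ) (by norm_num) (by norm_num) (by norm_num) (by norm_num)
    ?_ ?_ ?_ ?_ ?_).mono ?_
  · simp [hg3.5]
  · simp [hg3.7]
  · simp [hg3.7, g30, hg3.5]; omega
  · simp [hg3.7, g30, hg3.5]; omega
  · simp [hg3.7, g30, hg3.5]
    intro x hx
    exact (h3.le (by omega)).le.trans (by omega)
  intro s4 c4 ⟨hc4, ha4, h4⟩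
  simp only [Memory.reg_setReg] at hc4 h4
  norm_num only [if_true, if_false, hg3.7, g30, hg3.5] at hc4 h4
  norm_num only [g30, hg3.5]
  refine ⟨?_, ⟨fun r hr => ?_, fun A hA => ?_⟩, fun i hi => ?_, fun i hi => ?_⟩
  · have l1 := len_le_word (q := p ^ ℓ) (x := m) (by omega)
    have l2 := len_le_word (q := p ^ ℓ) (x := 2) (by omega)
    have l3 := len_le_word (q := p ^ ℓ) (x := p ^ ℓ) (by omega)
    have l4 := len_le_word (q := p ^ ℓ) (x := (-PowerSeries.coeff 0 (f * v)).val) (by omega)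
    have l5 := len_le_word (q := p ^ ℓ) (x := (-PowerSeries.coeff 0 (f * v)).val + 2) (by omega)
    have l6 := len_le_word (q := p ^ ℓ) (x := ((-PowerSeries.coeff 0 (f * v)).val + 2) % p ^ ℓ)
      ((Nat.mod_le _ _).trans (by omega))
    have l7 : len (p ^ ℓ) * len (((-PowerSeries.coeff 0 (f * v)).val + 2) / p ^ ℓ) ≤
        3 * word (p ^ ℓ) := by
      have h : ((-PowerSeries.coeff 0 (f * v)).val + 2) / p ^ ℓ ≤ 3 :=
        Nat.le_of_lt_succ (Nat.div_lt_of_lt_mul (by omega))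
      have := Nat.mul_le_mul l3 (len_mono h)
      rw [show len 3 = 3 by decide] at this
      omega
    have e2 : (m + 1) * word (p ^ ℓ) = m * word (p ^ ℓ) + word (p ^ ℓ) := by ring
    have e3 : (m + 1 + 1) * word (p ^ ℓ) = m * word (p ^ ℓ) + 2 * word (p ^ ℓ) := by ring
    have e4 : word (p ^ ℓ) ≤ m * word (p ^ ℓ) := Nat.le_mul_of_pos_left _ hm
    simp only [len_zero, len_one]
    omega
  · have : ∀ k < 30, r ≠ k := fun k hk => by omega
    simp [this, ha4.1 r (by omega), ha3.1 r (by omega), ha2.1 r (by omega), ha1.1 r (by omega)]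
  · simp only [List.mem_cons, List.not_mem_nil, or_false, not_or] at hA
    simp [hA, ha4.2, ha3.2, ha2.2, ha1.2]
  · rw [h4, if_pos (by omega), Memory.arr_setReg, ← h3 i hi]
    simp
  · rw [h4, if_neg (by omega), Memory.arr_setReg, ha3.2 8 (by simp)]
    simp [f8]

/-- Put in array `10` the coefficients of the derivative of the polynomial in array `7`. -/
def derivative : Prog :=
  block [.const 18 0, .op .add 19 30 46,
    forLoop 18 19 (block [.op .add 10 18 44, .load 11 7 10, mulMod 10 11, .store 10 18 9]),
    .store 10 30 46]

theorem wp_derivative {env : ℕ → Behaviour} {p ℓ n : ℕ} [Fact p.Prime] {T : ℕ → ℕ}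
    (hT : CanMultiply env p ℓ T) (hℓ : 1 ≤ ℓ) {s : Memory} (hg : Globals p ℓ n s) {m : ℕ}
    (hm : 1 ≤ m) (hmq : m < p ^ ℓ) (hm30 : s.reg 30 = m) {u : (ZMod (p ^ ℓ))⟦X⟧}
    (hu : Holds s 7 m u) (hum : PowerSeries.coeff (m + 1) u = 0) :
    wp env derivative s fun s' c => c ≤ m * T 1 + 100 * ((m + 1) * word (p ^ ℓ)) ∧
      Agree 20 [10, 1, 2] s s' ∧ Holds s' 10 m (PowerSeries.derivative _ u) := by
  have : NeZero (p ^ ℓ) := ⟨pow_ne_zero _ (Fact.out : p.Prime).ne_zero⟩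
  obtain ⟨hq2, hqp, hql⟩ := bounds_pow (p := p) hℓ
  have hw := four_le_word (p ^ ℓ)
  simp only [derivative, wp_block_cons, wp_block_nil, wp_op, wp_const, Op.eval, Op.cost,
    Memory.reg_setReg]
  norm_num only [if_true, if_false, hm30, hg.7]
  refine (wp_forLoop_fill (q := p ^ ℓ) (B := 10) (a := 0) (N := m) (by omega)
    (fun x => (PowerSeries.coeff x (PowerSeries.derivative _ u)).val)
    (fun _ => T 1 + 70 * word (p ^ ℓ)) _ [1, 2] ?_ ?_ ?_ ?_).mono ?_
  · intro j hj s1 ha1 e18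
    have hg1 : Globals p ℓ n s1 := by
      constructor <;> rw [ha1.1 _ (by norm_num)] <;>
        simp [hg.1, hg.2, hg.3, hg.4, hg.5, hg.6, hg.7]
    have e7 : s1.arr 7 = s.arr 7 := by simp [ha1.2]
    have hlt := hu.le (i := j + 1) (by omega)
    simp only [wp_block_cons, wp_block_nil, wp_load, wp_op, Op.eval, Op.cost,
      Memory.reg_setReg, Memory.arr_setReg]
    norm_num only [if_true, if_false, e18, hg1.5, e7, zero_add]
    refine (wp_mulMod hT hℓ (n := n) ?_ (by norm_num) (by norm_num) ?_ ?_).mono ?_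
    · constructor <;> simp [hg1.1, hg1.2, hg1.3, hg1.4, hg1.5, hg1.6, hg1.7]
    · simp
      omega
    · simpa using hlt
    intro s2 c2 ⟨hc2, h9, ha2⟩
    simp only [Memory.reg_setReg] at h9
    norm_num only [if_true, if_false] at h9
    have h9' : s2.reg 9 = (PowerSeries.coeff j (PowerSeries.derivative _ u)).val := by
      rw [h9, hu (j + 1) (by omega), ← ZMod.val_natCast, PowerSeries.coeff_derivative]
      congr 1
      push_cast
      rw [ZMod.natCast_zmod_val]
      ring
    have f18 : s2.reg 18 = j := by simp [ha2.1, e18]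
    simp only [wp_store, f18, h9']
    refine ⟨?_, ⟨fun r hr => ?_, fun A hA => ?_⟩, ?_⟩
    · have l1 := len_le_word (q := p ^ ℓ) (x := j) (by omega)
      have l2 := len_le_word (q := p ^ ℓ) (x := j + 1) (by omega)
      have l3 := len_le_word (q := p ^ ℓ) (x := s.arr 7 (j + 1)) (by omega)
      have l4 := len_le_word (q := p ^ ℓ)
        (x := (PowerSeries.coeff j (PowerSeries.derivative _ u)).val)
        ((ZMod.val_lt _).le.trans (by omega))
      simp only [len_one]
      omega
    · have : ∀ k < 18, r ≠ k := fun k hk => by omega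
      simp [this, ha2.1 r (by omega)]
    · simp only [List.mem_cons, List.not_mem_nil, or_false, not_or] at hA
      simp [hA, ha2.2]
    · simp [ha2.2]
  · simp [hg.5]
  · simp
  · simp
  · intro s1 c1 ⟨hc1, ha1, h1⟩
    have e30 : s1.reg 30 = m := by simp [ha1.1, hm30]
    have e46 : s1.reg 46 = 0 := by simp [ha1.1, hg.7]
    simp only [wp_store, e30, e46]
    refine ⟨?_, ⟨fun r hr => ?_, fun A hA => ?_⟩, fun i hi => ?_⟩
    · have l1 := len_le_word (q := p ^ ℓ) (x := m) (by omega)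
      rw [Finset.sum_const, Finset.card_range, smul_eq_mul] at hc1
      have e1 : m * (T 1 + 70 * word (p ^ ℓ) + 7 * word (p ^ ℓ)) =
        m * T 1 + 77 * (m * word (p ^ ℓ)) := by ring
      have e2 : (m + 1) * word (p ^ ℓ) = m * word (p ^ ℓ) + word (p ^ ℓ) := by ring
      simp only [len_zero]
      omega
    · have : ∀ k < 20, r ≠ k := fun k hk => by omega
      simp [this, ha1.1 r (by omega)]
    · have hA' := ha1.2 A hA
      simp only [List.mem_cons, List.not_mem_nil, or_false, not_or] at hA
      simp [hA, hA']
    · simp only [Memory.arr_setArr, if_true, Function.update_apply]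
      split_ifs with him
      -- The last entry would need the coefficient of degree `m + 1` of `u`, which is zero; this
      -- justifies the stored zero.
      · rw [him, PowerSeries.coeff_derivative, hum, zero_mul, ZMod.val_zero]
      · rw [h1, if_pos (by omega)]

/-- Put in array `12` the differences of the entries of array `2` and of the coefficients given in
array `0` from the index `4` on. -/
def residual : Prog :=
  block [.const 18 0, .op .add 19 30 46,
    forLoop 18 19 (block [.load 1 2 18, .const 2 4, .op .add 2 2 18, .load 2 0 2, .op .sub 2 42 2,
      .op .add 1 1 2, .op .mod 1 1 42, .store 12 18 1])]

theorem wp_residual {env : ℕ → Behaviour} {p ℓ n : ℕ} [Fact p.Prime] (hℓ : 1 ≤ ℓ)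
    {s : Memory} (hg : Globals p ℓ n s) {m : ℕ} (hm : 1 ≤ m) (hmq : m < p ^ ℓ)
    (hm30 : s.reg 30 = m) {F G : (ZMod (p ^ ℓ))⟦X⟧} (hF : Holds s 2 m F)
    (hG : ∀ i < m, s.arr 0 (4 + i) = (PowerSeries.coeff i G).val) :
    wp env residual s fun s' c => c ≤ 50 * ((m + 1) * word (p ^ ℓ)) ∧
      Agree 20 [12] s s' ∧ ∀ i < m, s'.arr 12 i = (PowerSeries.coeff i (F - G)).val := by
  have : NeZero (p ^ ℓ) := ⟨pow_ne_zero _ (Fact.out : p.Prime).ne_zero⟩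
  obtain ⟨hq2, hqp, hql⟩ := bounds_pow (p := p) hℓ
  have hw := four_le_word (p ^ ℓ)
  simp only [residual, wp_block_cons, wp_block_nil, wp_op, wp_const, Op.eval, Op.cost,
    Memory.reg_setReg]
  norm_num only [if_true, if_false, hm30, hg.7]
  refine (wp_forLoop_fill (q := p ^ ℓ) (B := 12) (a := 0) (N := m) (by omega)
    (fun x => (PowerSeries.coeff x (F - G)).val)
    (fun _ => 25 * word (p ^ ℓ)) _ [] ?_ ?_ ?_ ?_).mono ?_
  · intro j hj s1 ha1 e18
    have e42 : s1.reg 42 = p ^ ℓ := by rw [ha1.1 _ (by norm_num)]; simp [hg.3]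
    have e2 : s1.arr 2 = s.arr 2 := by simp [ha1.2]
    have e0 : s1.arr 0 = s.arr 0 := by simp [ha1.2]
    have hlt := ZMod.val_lt (PowerSeries.coeff j F)
    have hlt' := ZMod.val_lt (PowerSeries.coeff j G)
    have hv : ((PowerSeries.coeff j F).val + (p ^ ℓ - (PowerSeries.coeff j G).val)) % p ^ ℓ =
        (PowerSeries.coeff j (F - G)).val := by
      rw [← ZMod.val_natCast, Nat.cast_add, Nat.cast_sub hlt'.le, ZMod.natCast_self,
        ZMod.natCast_zmod_val, ZMod.natCast_zmod_val, map_sub]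
      congr 1
      ring
    simp only [wp_block_cons, wp_block_nil, wp_load, wp_store, wp_op, wp_const, Op.eval, Op.cost,
      Memory.reg_setReg, Memory.arr_setReg]
    norm_num only [if_true, if_false, e18, e2, e0, e42, zero_add, hF j hj.le, hG j hj, hv]
    refine ⟨?_, ⟨fun r hr => ?_, fun A hA => ?_⟩, by simp⟩
    · have l1 := len_le_word (q := p ^ ℓ) (x := j) (by omega)
      have l2 := len_le_word (q := p ^ ℓ) (x := 4 + j) (by omega)
      have l3 := len_le_word (q := p ^ ℓ) (x := 4) (by omega)
      have l4 := len_le_word (q := p ^ ℓ) (x := p ^ ℓ) (by omega)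
      have l5 := len_le_word (q := p ^ ℓ) (x := (PowerSeries.coeff j F).val) (by omega)
      have l6 := len_le_word (q := p ^ ℓ) (x := (PowerSeries.coeff j G).val) (by omega)
      have l7 := len_le_word (q := p ^ ℓ) (x := p ^ ℓ - (PowerSeries.coeff j G).val) (by omega)
      have l8 := len_le_word (q := p ^ ℓ)
        (x := (PowerSeries.coeff j F).val + (p ^ ℓ - (PowerSeries.coeff j G).val)) (by omega)
      have l9 := len_le_word (q := p ^ ℓ) (x := (PowerSeries.coeff j (F - G)).val)
        ((ZMod.val_lt _).le.trans (by omega))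
      have l10 : len (p ^ ℓ) * len (((PowerSeries.coeff j F).val +
          (p ^ ℓ - (PowerSeries.coeff j G).val)) / p ^ ℓ) ≤ 3 * word (p ^ ℓ) := by
        have h : ((PowerSeries.coeff j F).val +
            (p ^ ℓ - (PowerSeries.coeff j G).val)) / p ^ ℓ ≤ 3 :=
          Nat.le_of_lt_succ (Nat.div_lt_of_lt_mul (by omega))
        have := Nat.mul_le_mul l4 (len_mono h)
        rw [show len 3 = 3 by decide] at this
        omega
      omega
    · have : ∀ k < 18, r ≠ k := fun k hk => by omega
      simp [this]
    · simp only [List.mem_cons, List.not_mem_nil, or_false] at hA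
      simp [hA]
  · simp [hg.5]
  · simp
  · simp
  · intro s1 c1 ⟨hc1, ha1, h1⟩
    refine ⟨?_, ⟨fun r hr => ?_, fun A hA => ?_⟩, fun i hi => ?_⟩
    · have l1 := len_le_word (q := p ^ ℓ) (x := m) (by omega)
      rw [Finset.sum_const, Finset.card_range, smul_eq_mul] at hc1
      have e1 : m * (25 * word (p ^ ℓ) + 7 * word (p ^ ℓ)) = 32 * (m * word (p ^ ℓ)) := by ring
      have e2 : (m + 1) * word (p ^ ℓ) = m * word (p ^ ℓ) + word (p ^ ℓ) := by ring
      simp only [len_zero]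
      omega
    · have : ∀ k < 20, r ≠ k := fun k hk => by omega
      simp [this, ha1.1 r (by omega)]
    · simp [ha1.2 A hA]
    · rw [h1, if_pos (by omega)]

/-- Integrate the polynomial in array `12`: divide its coefficients by `1, 2, 3, ...`, and put the
results in array `11`. -/
def integrate : Prog :=
  block [.const 18 1, .op .add 19 30 46,
    forLoop 18 19 (block [.op .sub 1 18 44, .load 1 12 1, .load 2 6 18, .op .div 10 1 2,
      .load 11 5 18, mulMod 10 11, .store 11 18 9])]

/-- Only the `p`-part of `i` is really divided out, at a cost of about `len (ordProj[p] i)` words,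
which is bounded on average; the other part is handled by the tabulated inverse. Entry `0` is left
alone and serves as the constant of integration. -/
theorem wp_integrate {env : ℕ → Behaviour} {p ℓ n : ℕ} [Fact p.Prime] {T : ℕ → ℕ}
    (hT : CanMultiply env p ℓ T) (hℓ : 1 ≤ ℓ) (hn : n < p ^ ℓ) {s : Memory}
    (hg : Globals p ℓ n s) {m : ℕ} (hm : 1 ≤ m) (hmn : m ≤ n) (hm30 : s.reg 30 = m)
    (h12 : ∀ i < m, s.arr 12 i < p ^ ℓ)
    (htab : ∀ i, 1 ≤ i → i ≤ n → s.arr 5 i < p ^ ℓ ∧ s.arr 6 i = ordProj[p] i) :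
    wp env integrate s fun s' c => c ≤ m * T 1 + 150 * ((m + 1) * word (p ^ ℓ)) ∧
      Agree 20 [11, 1, 2] s s' ∧ s'.arr 11 0 = s.arr 11 0 ∧ ∀ i < m, s'.arr 11 (i + 1) =
        s.arr 12 i / ordProj[p] (i + 1) * s.arr 5 (i + 1) % p ^ ℓ := by
  have : NeZero (p ^ ℓ) := ⟨pow_ne_zero _ (Fact.out : p.Prime).ne_zero⟩
  obtain ⟨hq2, hqp, hql⟩ := bounds_pow (p := p) hℓ
  have hw := four_le_word (p ^ ℓ)
  simp only [integrate, wp_block_cons, wp_block_nil, wp_op, wp_const, Op.eval, Op.cost,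
    Memory.reg_setReg]
  norm_num only [if_true, if_false, hm30, hg.7]
  refine (wp_forLoop_fill (q := p ^ ℓ) (B := 11) (a := 1) (N := m) (by omega)
    (fun x => s.arr 12 (x - 1) / ordProj[p] x * s.arr 5 x % p ^ ℓ)
    (fun j => T 1 + 80 * word (p ^ ℓ) + len (ordProj[p] (j + 1)) * word (p ^ ℓ)) _ [1, 2]
    ?_ ?_ ?_ ?_).mono ?_
  · intro j hj s1 ha1 e18
    have hg1 : Globals p ℓ n s1 := by
      constructor <;> rw [ha1.1 _ (by norm_num)] <;>
        simp [hg.1, hg.2, hg.3, hg.4, hg.5, hg.6, hg.7]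
    have e12 : s1.arr 12 = s.arr 12 := by simp [ha1.2]
    have e5 : s1.arr 5 = s.arr 5 := by simp [ha1.2]
    have e6 : s1.arr 6 = s.arr 6 := by simp [ha1.2]
    obtain ⟨ht5, ht6⟩ := htab (1 + j) (by omega) (by omega)
    have hr := h12 j hj
    have hdiv : s.arr 12 j / ordProj[p] (1 + j) ≤ s.arr 12 j := Nat.div_le_self _ _
    simp only [wp_block_cons, wp_block_nil, wp_load, wp_op, Op.eval, Op.cost,
      Memory.reg_setReg, Memory.arr_setReg]
    norm_num only [if_true, if_false, e18, hg1.5, e12, e5, e6, Nat.add_sub_cancel_left, ht6]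
    refine (wp_mulMod hT hℓ (n := n) ?_ (by norm_num) (by norm_num) ?_ ?_).mono ?_
    · constructor <;> simp [hg1.1, hg1.2, hg1.3, hg1.4, hg1.5, hg1.6, hg1.7]
    · simp only [Memory.reg_setReg]
      norm_num only [if_true, if_false]
      omega
    · simpa using ht5
    intro s2 c2 ⟨hc2, h9, ha2⟩
    simp only [Memory.reg_setReg] at h9
    norm_num only [if_true, if_false] at h9
    have f18 : s2.reg 18 = 1 + j := by simp [ha2.1, e18]
    have hmod : s2.reg 9 < p ^ ℓ := h9 ▸ Nat.mod_lt _ (by omega)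
    simp only [wp_store, f18]
    refine ⟨?_, ⟨fun r hr => ?_, fun A hA => ?_⟩, ?_⟩
    · have l1 := len_le_word (q := p ^ ℓ) (x := 1 + j) (by omega)
      have l2 := len_le_word (q := p ^ ℓ) (x := j) (by omega)
      have l3 := len_le_word (q := p ^ ℓ) (x := s.arr 12 j) (by omega)
      have l4 := len_le_word (q := p ^ ℓ) (x := ordProj[p] (1 + j))
        ((Nat.ordProj_le p (by omega)).trans (by omega))
      have l5 := len_le_word (q := p ^ ℓ) (x := s.arr 5 (1 + j)) (by omega)
      have l6 := len_le_word (q := p ^ ℓ) (x := s2.reg 9) (by omega)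
      have l7 := Nat.mul_le_mul_left (len (ordProj[p] (1 + j)))
        (len_le_word (q := p ^ ℓ) (x := s.arr 12 j / ordProj[p] (1 + j)) (by omega))
      rw [add_comm j 1]
      simp only [len_one]
      omega
    · have : ∀ k < 18, r ≠ k := fun k hk => by omega
      simp [this, ha2.1 r (by omega)]
    · simp only [List.mem_cons, List.not_mem_nil, or_false, not_or] at hA
      simp [hA, ha2.2]
    · simp only [Memory.arr_setArr, if_true, h9]
      simp [ha2.2]
  · simp [hg.5]
  · simp
  · simp
  · intro s1 c1 ⟨hc1, ha1, h1⟩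
    refine ⟨?_, ⟨fun r hr => ?_, fun A hA => ?_⟩, ?_, fun i hi => ?_⟩
    · have l1 := len_le_word (q := p ^ ℓ) (x := m) (by omega)
      have hsum := Nat.mul_le_mul_right (word (p ^ ℓ)) (sum_len_ordProj_le p m)
      simp only [Finset.sum_add_distrib, Finset.sum_const, Finset.card_range, smul_eq_mul,
        ← Finset.sum_mul] at hc1
      have e1 : m * (80 * word (p ^ ℓ)) = 80 * (m * word (p ^ ℓ)) := by ring
      have e2 : (m + 1) * word (p ^ ℓ) = m * word (p ^ ℓ) + word (p ^ ℓ) := by ring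
      have e3 : 3 * m * word (p ^ ℓ) = 3 * (m * word (p ^ ℓ)) := by ring
      have e4 : m * (7 * word (p ^ ℓ)) = 7 * (m * word (p ^ ℓ)) := by ring
      simp only [len_zero, len_one]
      omega
    · have : ∀ k < 20, r ≠ k := fun k hk => by omega
      simp [this, ha1.1 r (by omega)]
    · simp [ha1.2 A hA]
    · rw [h1, if_neg (by omega)]
      simp
    · rw [h1, if_pos (by omega), Nat.add_sub_cancel]

/-! ### The invariant of the Newton iteration and one level. -/

/-- The series whose coefficients are in array `7`. -/
noncomputable def solutionSeries (p : ℕ) [Fact p.Prime] (s : Memory) : ℤ_[p]⟦X⟧ :=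
  PowerSeries.mk fun i => (s.arr 7 i : ℤ_[p])

/-- The series whose coefficients are in array `8`. -/
noncomputable def inverseSeries (q : ℕ) (s : Memory) : (ZMod q)⟦X⟧ :=
  PowerSeries.mk fun i => (s.arr 8 i : ZMod q)

/-- The part of the memory that does not change during the Newton iteration. -/
structure Prepared {p : ℕ} [Fact p.Prime] (ℓ n : ℕ) (g h : ℤ_[p]⟦X⟧) (s : Memory) : Prop where
  globals : Globals p ℓ n s
  arr_g : ∀ i < n, s.arr 0 (4 + i) = (PadicInt.toZModPow ℓ (PowerSeries.coeff i g)).val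
  arr_h : ∀ i < n, s.arr 0 (4 + n + i) = (PadicInt.toZModPow ℓ (PowerSeries.coeff i h)).val
  table : ∀ i, 1 ≤ i → i ≤ n → s.arr 5 i < p ^ ℓ ∧
    (s.arr 5 i : ZMod (p ^ ℓ)) * (ordCompl[p] i : ℕ) = 1 ∧ s.arr 6 i = ordProj[p] i
  arr_zero : s.arr 11 0 = 0

theorem Prepared.of_agree {p ℓ n r : ℕ} [Fact p.Prime] {g h : ℤ_[p]⟦X⟧} {l : List ℕ}
    {s s' : Memory} (hs : Prepared ℓ n g h s) (ha : Agree r l s s') (hr : r ≤ 40 := by norm_num)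
    (hl : ∀ A ∈ [0, 5, 6, 11], A ∉ l := by simp) : Prepared ℓ n g h s' := by
  constructor
  · exact hs.globals.of_agree ha hr
  · rw [ha.2 0 (hl 0 (by simp))]
    exact hs.arr_g
  · rw [ha.2 0 (hl 0 (by simp))]
    exact hs.arr_h
  · rw [ha.2 5 (hl 5 (by simp)), ha.2 6 (hl 6 (by simp))]
    exact hs.table
  · rw [ha.2 11 (hl 11 (by simp))]
    exact hs.arr_zero

/-- Array `7` contains an approximation of `y` modulo `(p ^ κ, t ^ (m + 1))`, and array `8` an
inverse of its image by `h` at half this precision. -/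
structure NewtonState {p : ℕ} [Fact p.Prime] (κ ℓ n : ℕ) (g h y : ℤ_[p]⟦X⟧) (m : ℕ)
    (s : Memory) : Prop where
  prepared : Prepared ℓ n g h s
  arr_lt : ∀ i, s.arr 7 i < p ^ ℓ
  arr_eq_zero : ∀ i, m < i → s.arr 7 i = 0
  arr_zero : s.arr 7 0 = 0
  inverse_lt : ∀ i, s.arr 8 i < p ^ ℓ
  approx : y - solutionSeries p s ∈ congrIdeal ((p : ℤ_[p]) ^ κ) (m + 1)
  inverse : PowerSeries.map (PadicInt.toZModPow ℓ) (h.subst (solutionSeries p s)) *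
    inverseSeries (p ^ ℓ) s - 1 ∈ congrIdeal (0 : ZMod (p ^ ℓ)) (m / 2 + 1)

theorem NewtonState.of_agree {p κ ℓ n r m : ℕ} [Fact p.Prime] {g h y : ℤ_[p]⟦X⟧} {l : List ℕ}
    {s s' : Memory} (hs : NewtonState κ ℓ n g h y m s) (ha : Agree r l s s')
    (hr : r ≤ 40 := by norm_num) (hl : ∀ A ∈ [0, 5, 6, 7, 8, 11], A ∉ l := by simp) :
    NewtonState κ ℓ n g h y m s' := by
  have h7 := ha.2 7 (hl 7 (by simp))
  have h8 := ha.2 8 (hl 8 (by simp))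
  have e1 : solutionSeries p s' = solutionSeries p s := by simp only [solutionSeries, h7]
  have e2 : inverseSeries (p ^ ℓ) s' = inverseSeries (p ^ ℓ) s := by simp only [inverseSeries, h8]
  refine ⟨hs.prepared.of_agree ha hr fun A hA => hl A ?_, ?_, ?_, ?_, ?_, ?_, ?_⟩
  · simp only [List.mem_cons, List.not_mem_nil, or_false] at hA ⊢
    tauto
  · rw [h7]; exact hs.arr_lt
  · rw [h7]; exact hs.arr_eq_zero
  · rw [h7]; exact hs.arr_zero
  · rw [h8]; exact hs.inverse_lt
  · rw [e1]; exact hs.approx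
  · rw [e1, e2]; exact hs.inverse

/-- Quadratic convergence: `1 - f v (2 - f v) = (1 - f v) ^ 2`. -/
theorem mul_sub_one_mem_congrIdeal {R : Type*} [CommRing R] {f v w : R⟦X⟧} {a N : ℕ}
    (h : f * v - 1 ∈ congrIdeal (0 : R) a) (hw : w - v * (2 - f * v) ∈ congrIdeal (0 : R) N) :
    f * w - 1 ∈ congrIdeal (0 : R) (min (2 * a) N) := by
  have h1 : (f * v - 1) * (f * v - 1) ∈ congrIdeal (0 : R) (2 * a) := by
    rw [mem_congrIdeal_zero_iff_dvd] at h ⊢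
    rw [two_mul, pow_add]
    exact mul_dvd_mul h h
  have h2 := congrIdeal_mono dvd_rfl (min_le_left (2 * a) N) h1
  have h3 := congrIdeal_mono dvd_rfl (min_le_right (2 * a) N) (Ideal.mul_mem_left _ f hw)
  convert sub_mem h3 h2 using 1
  ring

theorem map_mem_congrIdeal_zero {R S : Type*} [CommRing R] [CommRing S] (φ : R →+* S) {f : R⟦X⟧}
    {N : ℕ} (h : f ∈ congrIdeal (0 : R) N) : PowerSeries.map φ f ∈ congrIdeal (0 : S) N := by
  rw [mem_congrIdeal_zero] at h ⊢
  intro i hi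
  rw [PowerSeries.coeff_map, h i hi, map_zero]

/-- One level of the Newton iteration, for the precision in register `30`. -/
def level : Prog :=
  block [compose, inverseStep, inverseStep, derivative, polyMul 10 8, residual, integrate,
    polyMul 9 11, .op .div 18 30 45, .op .add 18 18 44, .op .add 19 30 44, .op .sub 19 19 18,
    negate 7]

-- On entry the inverse of `h(u)` is correct modulo `t ^ (m/2/2 + 1)` only, as it was computed for
-- the previous approximation. Two inverse steps are therefore needed, and they suffice because `4
-- (m/4 + 1) > m`. The update fills degrees `m/2 + 1` to `m`, where `u` is zero, and leaves the
-- lower ones untouched. So `h(u)` does not change modulo `t ^ (m/2 + 1)`, and the inverse just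
-- computed remains valid at that precision.
set_option maxHeartbeats 1000000 in
theorem wp_level {env : ℕ → Behaviour} {p κ ℓ n : ℕ} [Fact p.Prime] {T TC : ℕ → ℕ}
    {g h y : ℤ_[p]⟦X⟧} (hT : CanMultiply env p ℓ T) (hTC : CanCompose env ℓ h TC)
    (hκ : 0 < κ) (hℓκ : ℓ = κ + Nat.log p n) (hn : n < p ^ ℓ)
    (h0 : PowerSeries.constantCoeff h = 1) (hy0 : PowerSeries.constantCoeff y = 0)
    (hy : PowerSeries.derivative ℤ_[p] y = g * h.subst y) {m : ℕ} (hm : 1 ≤ m) (hmn : m ≤ n)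
    {s : Memory} (hs : NewtonState κ ℓ n g h y (m / 2) s) (hm30 : s.reg 30 = m) :
    wp env level s fun s' c => c ≤ 6 * T m + TC m + 2 * (m * T 1) +
        1500 * ((m + 1) * word (p ^ ℓ)) ∧
      NewtonState κ ℓ n g h y m s' ∧ ∀ r, 30 ≤ r → s'.reg r = s.reg r := by
  have hp : p.Prime := Fact.out
  have : NeZero (p ^ ℓ) := ⟨pow_ne_zero _ hp.ne_zero⟩
  have hℓ : 1 ≤ ℓ := by omega
  obtain ⟨hq2, hqp, hql⟩ := bounds_pow (p := p) hℓ
  have hw := four_le_word (p ^ ℓ)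
  set q := p ^ ℓ with hqdef
  set π := PadicInt.toZModPow (p := p) ℓ with hπ
  set u := solutionSeries p s with hudef
  have hu0 : PowerSeries.constantCoeff u = 0 := by
    rw [← PowerSeries.coeff_zero_eq_constantCoeff_apply, hudef, solutionSeries,
      PowerSeries.coeff_mk, hs.arr_zero, Nat.cast_zero]
  have huval : ∀ i, (π (PowerSeries.coeff i u)).val = s.arr 7 i := fun i => by
    rw [hudef, solutionSeries, PowerSeries.coeff_mk, map_natCast, ZMod.val_natCast,
      Nat.mod_eq_of_lt (hs.arr_lt i)]
  rw [level, wp_block_cons]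
  refine (wp_compose hTC hℓ hn hs.prepared.globals hm hmn hm30 hs.prepared.arr_h hu0
    fun i _ => (huval i).symm).mono ?_
  intro s1 c1 ⟨hc1, ha1, h1⟩
  have hP1 := hs.prepared.of_agree ha1
  have hr1 : ∀ r, 30 ≤ r → s1.reg r = s.reg r := fun r hr => ha1.1 r hr
  have hm1 : s1.reg 30 = m := (hr1 30 le_rfl).trans hm30
  have h17 : s1.arr 7 = s.arr 7 := ha1.2 7 (by simp)
  have h18 : s1.arr 8 = s.arr 8 := ha1.2 8 (by simp)
  have hlt9 : ∀ i ≤ m, s1.arr 9 i < q := fun i hi => by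
    rw [h1 i hi]
    split_ifs
    · exact ZMod.val_lt _
    · omega
  have hF1 := holds_mk (A := 9) (m := m) hlt9
  set f : (ZMod q)⟦X⟧ := PowerSeries.mk fun i => (s1.arr 9 i : ZMod q) with hf
  have hfu : PowerSeries.map π (h.subst u) - f ∈ congrIdeal (0 : ZMod q) m := by
    rw [mem_congrIdeal_zero]
    intro i hi
    rw [map_sub, PowerSeries.coeff_map, hf, PowerSeries.coeff_mk, h1 i hi.le, if_pos hi,
      ZMod.natCast_zmod_val, sub_self]
  have hV1 : Holds s1 8 m (inverseSeries q s) := by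
    have := holds_mk (s := s1) (A := 8) (m := m) (q := q) fun i _ => by
      rw [h18]; exact hs.inverse_lt i
    rwa [h18] at this
  have hinv0 : f * inverseSeries q s - 1 ∈ congrIdeal (0 : ZMod q) (m / 2 / 2 + 1) := by
    have h2 := congrIdeal_mono dvd_rfl (show m / 2 / 2 + 1 ≤ m by omega)
      (Ideal.mul_mem_right (inverseSeries q s) _ hfu)
    convert sub_mem hs.inverse h2 using 1
    ring
  rw [wp_block_cons]
  refine (wp_inverseStep hT hℓ hP1.globals hm (hmn.trans_lt hn) hm1 hF1 hV1).mono ?_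
  intro s2 c2 ⟨hc2, ha2, hV2, hV2'⟩
  have hP2 := hP1.of_agree ha2
  have hr2 : ∀ r, 30 ≤ r → s2.reg r = s.reg r := fun r hr => (ha2.1 r hr).trans (hr1 r hr)
  have hm2 : s2.reg 30 = m := (hr2 30 le_rfl).trans hm30
  have hF2 : Holds s2 9 m f := by rw [Holds, ha2.2 9 (by simp)]; exact hF1
  have hV2lt : ∀ i, s2.arr 8 i < q := fun i => by
    rcases le_or_gt i m with hi | hi
    · exact hV2.le hi
    · rw [hV2' i hi, h18]
      exact hs.inverse_lt i
  have hinv1 := mul_sub_one_mem_congrIdeal hinv0 hV2.mk_sub_mem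
  have hV2'' : Holds s2 8 m (inverseSeries q s2) := holds_mk fun i _ => hV2lt i
  rw [wp_block_cons]
  refine (wp_inverseStep hT hℓ hP2.globals hm (hmn.trans_lt hn) hm2 hF2 hV2'').mono ?_
  intro s3 c3 ⟨hc3, ha3, hV3, hV3'⟩
  have hP3 := hP2.of_agree ha3
  have hr3 : ∀ r, 30 ≤ r → s3.reg r = s.reg r := fun r hr => (ha3.1 r hr).trans (hr2 r hr)
  have hm3 : s3.reg 30 = m := (hr3 30 le_rfl).trans hm30
  have hF3 : Holds s3 9 m f := by rw [Holds, ha3.2 9 (by simp)]; exact hF2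
  have hV3lt : ∀ i, s3.arr 8 i < q := fun i => by
    rcases le_or_gt i m with hi | hi
    · exact hV3.le hi
    · rw [hV3' i hi]
      exact hV2lt i
  have hinv2 := mul_sub_one_mem_congrIdeal hinv1 hV3.mk_sub_mem
  have hV3'' : Holds s3 8 m (inverseSeries q s3) := holds_mk fun i _ => hV3lt i
  set v := inverseSeries q s3 with hv
  have hfv : f * v - 1 ∈ congrIdeal (0 : ZMod q) m :=
    congrIdeal_mono dvd_rfl (by omega) hinv2
  have h37 : s3.arr 7 = s.arr 7 := by
    rw [ha3.2 7 (by simp), ha2.2 7 (by simp), h17]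
  have hU3 : Holds s3 7 m (PowerSeries.map π u) := fun i _ => by
    rw [PowerSeries.coeff_map, huval, h37]
  rw [wp_block_cons]
  refine (wp_derivative hT hℓ hP3.globals hm (hmn.trans_lt hn) hm3 hU3 ?_).mono ?_
  · rw [PowerSeries.coeff_map, ← ZMod.val_eq_zero, huval]
    exact hs.arr_eq_zero _ (by omega)
  intro s4 c4 ⟨hc4, ha4, h4⟩
  have hP4 := hP3.of_agree ha4
  have hr4 : ∀ r, 30 ≤ r → s4.reg r = s.reg r := fun r hr =>
    (ha4.1 r (by omega)).trans (hr3 r hr)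
  have hm4 : s4.reg 30 = m := (hr4 30 le_rfl).trans hm30
  have hV4 : Holds s4 8 m v := by rw [Holds, ha4.2 8 (by simp)]; exact hV3''
  rw [wp_block_cons]
  refine (wp_polyMul hT hℓ hP4.globals (by norm_num) (by norm_num) hm (hmn.trans_lt hn) hm4
    h4 hV4).mono ?_
  intro s5 c5 ⟨hc5, ha5, h5⟩
  have hP5 := hP4.of_agree ha5
  have hr5 : ∀ r, 30 ≤ r → s5.reg r = s.reg r := fun r hr => (ha5.1 r hr).trans (hr4 r hr)
  have hm5 : s5.reg 30 = m := (hr5 30 le_rfl).trans hm30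
  rw [wp_block_cons]
  refine (wp_residual hℓ hP5.globals hm (hmn.trans_lt hn) hm5 h5 (G := PowerSeries.map π g)
    fun i hi => ?_).mono ?_
  · rw [PowerSeries.coeff_map]
    exact hP5.arr_g i (by omega)
  intro s6 c6 ⟨hc6, ha6, h6⟩
  have hP6 := hP5.of_agree ha6
  have hr6 : ∀ r, 30 ≤ r → s6.reg r = s.reg r := fun r hr =>
    (ha6.1 r (by omega)).trans (hr5 r hr)
  have hm6 : s6.reg 30 = m := (hr6 30 le_rfl).trans hm30
  rw [wp_block_cons]
  refine (wp_integrate hT hℓ hn hP6.globals hm hmn hm6 (fun i hi => ?_)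
    fun i hi hin => ⟨(hP6.table i hi hin).1, (hP6.table i hi hin).2.2⟩).mono ?_
  · rw [h6 i hi]
    exact ZMod.val_lt _
  intro s7 c7 ⟨hc7, ha7, h70, h7⟩
  have hr7 : ∀ r, 30 ≤ r → s7.reg r = s.reg r := fun r hr =>
    (ha7.1 r (by omega)).trans (hr6 r hr)
  have hm7 : s7.reg 30 = m := (hr7 30 le_rfl).trans hm30
  have h70' : s7.arr 11 0 = 0 := h70.trans hP6.arr_zero
  have hP7 : Prepared ℓ n g h s7 := by
    constructor
    · exact hP6.globals.of_agree ha7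
    · rw [ha7.2 0 (by simp)]; exact hP6.arr_g
    · rw [ha7.2 0 (by simp)]; exact hP6.arr_h
    · rw [ha7.2 5 (by simp), ha7.2 6 (by simp)]; exact hP6.table
    · exact h70'
  have hZ7 := holds_mk (s := s7) (A := 11) (m := m) (q := q) fun i hi => by
    rcases i with _ | i
    · rw [h70']; omega
    · rw [h7 i (by omega)]
      exact Nat.mod_lt _ (by omega)
  set z : (ZMod q)⟦X⟧ := PowerSeries.mk fun i => (s7.arr 11 i : ZMod q) with hz
  have h79 : s7.arr 9 = s3.arr 9 := by
    rw [ha7.2 9 (by simp), ha6.2 9 (by simp), ha5.2 9 (by simp), ha4.2 9 (by simp)]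
  have hF7 : Holds s7 9 m f := by rw [Holds, h79]; exact hF3
  rw [wp_block_cons]
  refine (wp_polyMul hT hℓ hP7.globals (by norm_num) (by norm_num) hm (hmn.trans_lt hn) hm7
    hF7 hZ7).mono ?_
  intro s8 c8 ⟨hc8, ha8, h8⟩
  have hP8 := hP7.of_agree ha8
  have hr8 : ∀ r, 30 ≤ r → s8.reg r = s.reg r := fun r hr => (ha8.1 r hr).trans (hr7 r hr)
  have hm8 : s8.reg 30 = m := (hr8 30 le_rfl).trans hm30
  have hg8 := hP8.globals
  have h87 : s8.arr 7 = s.arr 7 := by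
    rw [ha8.2 7 (by simp), ha7.2 7 (by simp), ha6.2 7 (by simp), ha5.2 7 (by simp),
      ha4.2 7 (by simp), h37]
  have h88 : s8.arr 8 = s3.arr 8 := by
    rw [ha8.2 8 (by simp), ha7.2 8 (by simp), ha6.2 8 (by simp), ha5.2 8 (by simp),
      ha4.2 8 (by simp)]
  have hcorr := newton_correction_residues (r := fun i => PowerSeries.coeff i
      (PowerSeries.derivative _ (PowerSeries.map π u) * v - PowerSeries.map π g))
    (inv := fun i => (s6.arr 5 i : ZMod q)) (z := z) hκ hℓκ hmn h0 hy0 hu0 hy hs.approx hfu hfv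
    (fun i _ => rfl) (fun i hi him => (hP6.table i hi (by omega)).2.1)
    (by rw [hz, PowerSeries.coeff_mk, h70', Nat.cast_zero])
    (fun i hi => by
      rw [hz, PowerSeries.coeff_mk, h7 i hi, h6 i hi, ZMod.natCast_mod, Nat.cast_mul])
  simp only [wp_block_cons, wp_block_nil, wp_op, Op.eval, Op.cost, Memory.reg_setReg]
  norm_num only [if_true, if_false, hm8, hg8.5, hg8.6]
  refine (wp_negate (n := n) (B := 7) (a := m / 2 + 1) (N := m + 1 - (m / 2 + 1)) (m := m)
    (F := f * z) hℓ ?_ (by norm_num) (by omega) (hmn.trans_lt hn) ?_ ?_ ?_).mono ?_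
  · constructor <;> simp [hg8.1, hg8.2, hg8.3, hg8.4, hg8.5, hg8.6, hg8.7]
  · simp
  · simp
  · exact h8
  intro s9 c9 ⟨hc9, ha9, h9⟩
  have hl9 : s9.arr 8 = s3.arr 8 := by rw [ha9.2 8 (by simp)]; exact h88
  have h9' : ∀ x, s9.arr 7 x = if m / 2 + 1 ≤ x ∧ x < m + 1 then
      (-PowerSeries.coeff x (f * z)).val else s.arr 7 x := fun x => by
    rw [h9, show m / 2 + 1 + (m + 1 - (m / 2 + 1)) = m + 1 by omega]
    simp only [Memory.arr_setReg, h87]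
  have hdiff : solutionSeries p s9 - u ∈ congrIdeal (0 : ℤ_[p]) (m / 2 + 1) := by
    rw [mem_congrIdeal_zero]
    intro i hi
    rw [map_sub, hudef, solutionSeries, solutionSeries, PowerSeries.coeff_mk, PowerSeries.coeff_mk,
      h9', if_neg (by omega), sub_self]
  have h90 : s9.arr 7 0 = 0 := by rw [h9', if_neg (by omega), hs.arr_zero]
  refine ⟨?_, ⟨?_, fun i => ?_, fun i hi => ?_, h90, ?_, ?_, ?_⟩, fun r hr => ?_⟩
  · have l1 := len_le_word (q := q) (x := m) (by omega)
    have l2 := len_le_word (q := q) (x := m + 1) (by omega)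
    have l3 := len_le_word (q := q) (x := m / 2) (by omega)
    have l4 := len_le_word (q := q) (x := m / 2 + 1) (by omega)
    have l5 : len 2 * len (m / 2) ≤ 3 * word q := by
      rw [show len 2 = 3 by decide]
      omega
    have e2 : (m + 1) * word q = m * word q + word q := by ring
    have e4 : word q ≤ m * word q := Nat.le_mul_of_pos_left _ hm
    simp only [← hqdef] at hc1 hc2 hc3 hc4 hc5 hc6 hc7 hc8 hc9 ⊢
    simp only [len_one]
    omega
  · constructor
    · constructor <;> rw [ha9.1 _ (by norm_num)] <;>
        simp [hg8.1, hg8.2, hg8.3, hg8.4, hg8.5, hg8.6, hg8.7]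
    · simpa [ha9.2] using hP8.arr_g
    · simpa [ha9.2] using hP8.arr_h
    · simpa [ha9.2] using hP8.table
    · simpa [ha9.2] using hP8.arr_zero
  · rw [h9']
    split_ifs
    · exact ZMod.val_lt _
    · exact hs.arr_lt i
  · rw [h9', if_neg (by omega)]
    exact hs.arr_eq_zero i (by omega)
  · rw [hl9]
    exact hV3lt
  · intro i hi
    rw [map_sub, solutionSeries, PowerSeries.coeff_mk, h9']
    split_ifs with hcase
    · have h10 := hcorr i (by omega)
      have hui : PowerSeries.coeff i u = 0 := by
        rw [hudef, solutionSeries, PowerSeries.coeff_mk, hs.arr_eq_zero i (by omega),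
          Nat.cast_zero]
      rw [hui, sub_zero] at h10
      have h11 := pow_dvd_sub_val (p := p) (ℓ := ℓ)
        (a := -((PowerSeries.coeff i (f * z)).val : ℤ_[p])) (x := -PowerSeries.coeff i (f * z))
        (by rw [map_neg, map_natCast, ZMod.natCast_zmod_val])
      have h12 : (p : ℤ_[p]) ^ κ ∣ (p : ℤ_[p]) ^ ℓ := pow_dvd_pow _ (by omega)
      convert dvd_add h10 (h12.trans h11) using 1
      ring
    · have := hs.approx i (by omega)
      rwa [map_sub, solutionSeries, PowerSeries.coeff_mk] at this
  · have hinv9 : inverseSeries q s9 = v := by rw [hv, inverseSeries, inverseSeries, hl9]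
    have hu9 : PowerSeries.constantCoeff (solutionSeries p s9) = 0 := by
      rw [← PowerSeries.coeff_zero_eq_constantCoeff_apply, solutionSeries,
        PowerSeries.coeff_mk, h90, Nat.cast_zero]
    rw [hinv9]
    have h10 := map_mem_congrIdeal_zero π (subst_sub_subst_mem_congrIdeal h hu9 hu0 hdiff)
    rw [map_sub] at h10
    have h11 := congrIdeal_mono dvd_rfl (show m / 2 + 1 ≤ m by omega) hfu
    have h12 := congrIdeal_mono dvd_rfl (show m / 2 + 1 ≤ m by omega) hfv
    convert add_mem (Ideal.mul_mem_right v _ (add_mem h10 h11)) h12 using 1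
    ring
  · have : ∀ k < 20, r ≠ k := fun k hk => by omega
    rw [ha9.1 r (by omega)]
    simp [this, hr8 r hr]

/-! ## The main loop -/

/-- Each term is at most half of the preceding one, as in a geometric series. The bound on `2 ^ j`
keeps the sizes at least `1`, so that each halving starts from a size at least `2`. -/
theorem _root_.Doubling.sum_le {T : ℕ → ℕ} (hT : Doubling T) :
    ∀ j n : ℕ, 2 ^ j ≤ 2 * n → ∑ i ∈ Finset.range j, T (n / 2 ^ i) ≤ 2 * T n := by
  intro j
  induction j with
  | zero => simp
  | succ j ih =>
    intro n hn
    rw [Finset.sum_range_succ']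
    simp only [pow_zero, Nat.div_one]
    rcases j with _ | j
    · simp
      omega
    have h1 : 2 ^ (j + 1) ≤ 2 * (n / 2) := by
      rw [pow_succ] at hn ⊢
      omega
    have h2 := ih (n / 2) h1
    simp only [Nat.div_div_eq_div_mul, ← pow_succ'] at h2
    have h3 := hT n (by have := Nat.one_le_two_pow (n := j); rw [pow_succ] at hn; omega)
    omega

/-- Induction by halving, with `m + 1 ≤ 2 (m / 2 + 1)`. This pays for the coefficientwise modular
products at size `m`. -/
theorem _root_.Doubling.succ_mul_le {T : ℕ → ℕ} (hT : Doubling T) {m : ℕ} (hm : 1 ≤ m) :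
    (m + 1) * T 1 ≤ 2 * T m := by
  induction m using Nat.strong_induction_on with
  | _ m ih =>
    rcases (show m = 1 ∨ 2 ≤ m by omega) with rfl | h
    · omega
    have h1 := ih (m / 2) (by omega) (by omega)
    have h2 := hT m h
    have h3 : (m + 1) * T 1 ≤ 2 * (m / 2 + 1) * T 1 := Nat.mul_le_mul_right _ (by omega)
    have h4 : 2 * (m / 2 + 1) * T 1 = 2 * ((m / 2 + 1) * T 1) := by ring
    omega

theorem NewtonState.setReg {p κ ℓ n m : ℕ} [Fact p.Prime] {g h y : ℤ_[p]⟦X⟧} {s : Memory}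
    (hs : NewtonState κ ℓ n g h y m s) {r : ℕ} (hr : r < 40) (v : ℕ) :
    NewtonState κ ℓ n g h y m (s.setReg r v) :=
  hs.of_agree (r := 40) (l := []) ⟨fun r' hr' => by
    rw [Memory.reg_setReg, if_neg (by omega)], fun _ _ => rfl⟩

/-- Put in register `32` a power of `2` that is larger than the content of register `43`. -/
def largePower : Prog :=
  block [.const 32 1, .op .add 18 43 44, .op .sub 33 18 32,
    .loop 33 (block [.op .add 32 32 32, .op .sub 33 18 32])]

theorem wp_largePower {env : ℕ → Behaviour} {p ℓ n : ℕ} [Fact p.Prime] (hℓ : 1 ≤ ℓ) (hn0 : 1 ≤ n)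
    (hn : n < p ^ ℓ) {s : Memory} (hg : Globals p ℓ n s) :
    wp env largePower s fun s' c => c ≤ 20 * ((n + 1) * word (p ^ ℓ)) ∧
      (∃ j, s'.reg 32 = 2 ^ j ∧ n < 2 ^ j ∧ 2 ^ j ≤ 2 * n) ∧ Agree 40 [] s s' := by
  obtain ⟨hq2, hqp, hql⟩ := bounds_pow (p := p) hℓ
  have hw := four_le_word (p ^ ℓ)
  -- Induction on the deficit `d` bounds the number of rounds linearly; the true logarithmic bound
  -- is not needed.
  have H : ∀ d j, n + 1 - 2 ^ j = d → 2 ^ j ≤ 2 * n → ∀ s : Memory, s.reg 18 = n + 1 →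
      s.reg 32 = 2 ^ j → s.reg 33 = d →
      wp env (.loop 33 (block [.op .add 32 32 32, .op .sub 33 18 32])) s fun s' c =>
        c ≤ (d + 1) * (10 * word (p ^ ℓ)) ∧
        (∃ j, s'.reg 32 = 2 ^ j ∧ n < 2 ^ j ∧ 2 ^ j ≤ 2 * n) ∧ Agree 40 [] s s' := by
    intro d
    induction d using Nat.strong_induction_on with
    | _ d ih =>
      intro j hd hj s h18 h32 h33
      rcases Nat.eq_zero_or_pos d with rfl | hd0
      · refine wp_loop_of_eq_zero h33 ⟨?_, ⟨j, h32, by omega, hj⟩, Agree.refl _ _ _⟩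
        rw [len_zero]
        omega
      refine wp_loop_of_ne_zero (by omega) ?_
      simp only [wp_block_cons, wp_block_nil, wp_op, Op.eval, Op.cost, Memory.reg_setReg]
      norm_num only [if_true, if_false, h18, h32, h33]
      have hpos : 1 ≤ 2 ^ j := Nat.one_le_two_pow
      have hjj : 2 ^ (j + 1) = 2 ^ j + 2 ^ j := by ring
      refine (ih (n + 1 - (2 ^ j + 2 ^ j)) (by omega) (j + 1) (by omega) (by omega) _ ?_ ?_ ?_).mono
        ?_
      · simp [h18]
      · simp [hjj]
      · simp
      · intro s' c ⟨hc, hj', ha⟩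
        refine ⟨?_, hj', fun r hr => ?_, ha.2⟩
        · have l1 := len_le_word (q := p ^ ℓ) (x := d) (by omega)
          have l2 := len_le_word (q := p ^ ℓ) (x := 2 ^ j) (by omega)
          have l3 := len_le_word (q := p ^ ℓ) (x := n + 1) (by omega)
          have l4 := len_le_word (q := p ^ ℓ) (x := 2 ^ j + 2 ^ j) (by omega)
          have l5 : (n + 1 - (2 ^ j + 2 ^ j) + 1) * (10 * word (p ^ ℓ)) ≤ d * (10 * word (p ^ ℓ)) :=
            Nat.mul_le_mul_right _ (by omega)
          have l6 : (d + 1) * (10 * word (p ^ ℓ)) = d * (10 * word (p ^ ℓ)) + 10 * word (p ^ ℓ) := by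
            ring
          omega
        · have : ∀ k < 40, r ≠ k := fun k hk => by omega
          rw [ha.1 r hr]
          simp [this]
  simp only [largePower, wp_block_cons, wp_block_nil, wp_op, wp_const, Op.eval, Op.cost,
    Memory.reg_setReg]
  norm_num only [if_true, if_false, hg.4, hg.5]
  refine (H n 0 (by simp) (by omega) _ ?_ ?_ ?_).mono ?_
  · simp
  · simp
  · simp
  · intro s' c ⟨hc, hj, ha⟩
    refine ⟨?_, hj, fun r hr => ?_, ha.2⟩
    · have l1 := len_le_word (q := p ^ ℓ) (x := n) (by omega)
      have l3 := len_le_word (q := p ^ ℓ) (x := n + 1) (by omega)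
      have l4 : (n + 1) * (10 * word (p ^ ℓ)) = 10 * (n * word (p ^ ℓ)) + 10 * word (p ^ ℓ) := by
        ring
      have l5 : (n + 1) * word (p ^ ℓ) = n * word (p ^ ℓ) + word (p ^ ℓ) := by ring
      have l6 : word (p ^ ℓ) ≤ n * word (p ^ ℓ) := Nat.le_mul_of_pos_left _ hn0
      simp only [len_one]
      omega
    · have : ∀ k < 40, r ≠ k := fun k hk => by omega
      rw [ha.1 r hr]
      simp [this]

/-- All levels of the Newton iteration, from the precision `n / D` on, where `n` is in register `43`
and `D` in register `32`; register `33` contains `D - 1`. -/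
def iterate : Prog :=
  .loop 33 (block [.op .div 32 32 45, .op .div 30 43 32, level, .op .sub 33 32 44])

/-- Since `n / 2 ^ (j+1) = (n / 2 ^ j) / 2`, the precision reached at one level is the one required
at the next. The condition `2 ^ j ≤ 2 n` makes every level have size at least `1`. -/
theorem wp_iterate {env : ℕ → Behaviour} {p κ ℓ n : ℕ} [Fact p.Prime] {T TC : ℕ → ℕ}
    {g h y : ℤ_[p]⟦X⟧} (hT : CanMultiply env p ℓ T) (hTC : CanCompose env ℓ h TC)
    (hκ : 0 < κ) (hℓκ : ℓ = κ + Nat.log p n) (hn : n < p ^ ℓ)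
    (h0 : PowerSeries.constantCoeff h = 1) (hy0 : PowerSeries.constantCoeff y = 0)
    (hy : PowerSeries.derivative ℤ_[p] y = g * h.subst y) :
    ∀ j, 2 ^ j ≤ 2 * n → ∀ s : Memory, s.reg 32 = 2 ^ j → s.reg 33 = 2 ^ j - 1 →
      NewtonState κ ℓ n g h y (n / 2 ^ j) s →
      wp env iterate s fun s' c => c ≤ ∑ i ∈ Finset.range j, (6 * T (n / 2 ^ i) + TC (n / 2 ^ i) +
          2 * (n / 2 ^ i * T 1) + 1520 * ((n / 2 ^ i + 1) * word (p ^ ℓ))) + 1 ∧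
        NewtonState κ ℓ n g h y n s' := by
  have hℓ : 1 ≤ ℓ := by omega
  obtain ⟨hq2, hqp, hql⟩ := bounds_pow (p := p) hℓ
  have hw := four_le_word (p ^ ℓ)
  intro j
  induction j with
  | zero =>
    intro _ s _ h33 hs
    refine wp_loop_of_eq_zero (by simpa using h33) ⟨by simp, by simpa using hs⟩
  | succ j ih =>
    intro hj s h32 h33 hs
    have hpos : 1 ≤ 2 ^ j := Nat.one_le_two_pow
    have hjj : 2 ^ (j + 1) = 2 ^ j * 2 := pow_succ _ _
    have hm1 : 1 ≤ n / 2 ^ j := (Nat.one_le_div_iff hpos).2 (by omega)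
    have hg := hs.prepared.globals
    have hdiv : n / 2 ^ (j + 1) = n / 2 ^ j / 2 := by rw [hjj, Nat.div_div_eq_div_mul]
    have hhalf : 2 ^ (j + 1) / 2 = 2 ^ j := by omega
    rw [hdiv] at hs
    refine wp_loop_of_ne_zero (by omega) ?_
    simp only [wp_block_cons, wp_block_nil, wp_op, Op.eval, Op.cost, Memory.reg_setReg]
    norm_num only [if_true, if_false, h32, h33, hg.4, hg.6, hhalf]
    refine (wp_level hT hTC hκ hℓκ hn h0 hy0 hy hm1 (Nat.div_le_self _ _)
      ((hs.setReg (by norm_num) _).setReg (by norm_num) _) ?_).mono ?_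
    · simp
    intro s1 c1 ⟨hc1, hs1, hr1⟩
    have e32 : s1.reg 32 = 2 ^ j := by simp [hr1]
    have e44 := hs1.prepared.globals.5
    rw [e32, e44]
    refine (ih (by omega) _ ?_ ?_ (hs1.setReg (by norm_num) _)).mono ?_
    · simp [e32]
    · simp
    intro s2 c2 ⟨hc2, hs2⟩
    refine ⟨?_, hs2⟩
    rw [Finset.sum_range_succ]
    have l1 := len_le_word (q := p ^ ℓ) (x := 2 ^ j) (by omega)
    have l2 := len_le_word (q := p ^ ℓ) (x := 2 ^ (j + 1)) (by omega)
    have l3 := len_le_word (q := p ^ ℓ) (x := 2 ^ (j + 1) - 1) (by omega)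
    have l4 := len_le_word (q := p ^ ℓ) (x := n) (by omega)
    have l5 : len 2 * len (2 ^ j) ≤ 3 * word (p ^ ℓ) := by
      rw [show len 2 = 3 by decide]
      omega
    -- The crude bound of the length of the quotient by its value suffices: this division is charged
    -- to the linear part of the level.
    have l6 : len (2 ^ j) * len (n / 2 ^ j) ≤ word (p ^ ℓ) * (n / 2 ^ j + 2) :=
      Nat.mul_le_mul l1 (len_le_add_two _)
    have e1 : word (p ^ ℓ) * (n / 2 ^ j + 2) = n / 2 ^ j * word (p ^ ℓ) + 2 * word (p ^ ℓ) := by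
      ring
    have e2 : (n / 2 ^ j + 1) * word (p ^ ℓ) = n / 2 ^ j * word (p ^ ℓ) + word (p ^ ℓ) := by ring
    have e3 : word (p ^ ℓ) ≤ n / 2 ^ j * word (p ^ ℓ) := Nat.le_mul_of_pos_left _ hm1
    simp only [len_one]
    omega

/-! ## The program -/

/-- Set the global constants, and read the parameters from the input. -/
def setup : Prog :=
  block [.const 44 1, .const 45 2, .const 46 0, .const 1 0, .load 40 0 1, .const 1 1, .load 41 0 1,
    .const 1 2, .load 42 0 1, .const 1 3, .load 43 0 1]

/-- Solve the differential equation by Newton iteration. -/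
def solve : Prog :=
  block [setup, sieve, .store 8 46 44, largePower, .op .sub 33 32 44, iterate, .op .add 30 43 44,
    copy 7 46 0 46 30, .op .add 0 30 46]

theorem wp_setup {env : ℕ → Behaviour} {p ℓ n : ℕ} [Fact p.Prime] (hℓ : 1 ≤ ℓ) (hn : n < p ^ ℓ)
    {s : Memory} (h0 : ∀ x < 4, s.arr 0 x = (precisionData p ℓ n).getD x 0) :
    wp env setup s fun s' c => c ≤ 20 * word (p ^ ℓ) ∧ Globals p ℓ n s' ∧ s'.arr = s.arr := by
  obtain ⟨hq2, hqp, hql⟩ := bounds_pow (p := p) hℓ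
  have hw := four_le_word (p ^ ℓ)
  have a0 : s.arr 0 0 = p := h0 0 (by norm_num)
  have a1 : s.arr 0 1 = ℓ := h0 1 (by norm_num)
  have a2 : s.arr 0 2 = p ^ ℓ := h0 2 (by norm_num)
  have a3 : s.arr 0 3 = n := h0 3 (by norm_num)
  simp only [setup, wp_block_cons, wp_block_nil, wp_const, wp_load, Memory.reg_setReg,
    Memory.arr_setReg]
  norm_num only [if_true, if_false, a0, a1, a2, a3]
  refine ⟨?_, ?_, trivial⟩
  · have l1 := len_le_word (q := p ^ ℓ) (x := p) (by omega)
    have l2 := len_le_word (q := p ^ ℓ) (x := ℓ) (by omega)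
    have l3 := len_le_word (q := p ^ ℓ) (x := p ^ ℓ) (by omega)
    have l4 := len_le_word (q := p ^ ℓ) (x := n) (by omega)
    rw [show len 2 = 3 by decide, show len 3 = 3 by decide, len_zero, len_one]
    omega
  · constructor <;> simp

theorem wp_solve {env : ℕ → Behaviour} {p κ ℓ n : ℕ} [Fact p.Prime] {T TC : ℕ → ℕ}
    {g h y : ℤ_[p]⟦X⟧} (hT : CanMultiply env p ℓ T) (hTC : CanCompose env ℓ h TC) (hn0 : 0 < n)
    (hκ : 0 < κ) (hℓκ : ℓ = κ + Nat.log p n)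
    (h0 : PowerSeries.constantCoeff h = 1) (hy0 : PowerSeries.constantCoeff y = 0)
    (hy : PowerSeries.derivative ℤ_[p] y = g * h.subst y) :
    wp env solve (initial (precisionData p ℓ n ++ truncation ℓ n g ++ truncation ℓ n h))
      fun s' c => ∃ j, 2 ^ j ≤ 2 * n ∧ c ≤ 600 * (n * T 1) + 800 * ((n + 1) * word (p ^ ℓ)) +
          ∑ i ∈ Finset.range j, (6 * T (n / 2 ^ i) + TC (n / 2 ^ i) +
            2 * (n / 2 ^ i * T 1) + 1520 * ((n / 2 ^ i + 1) * word (p ^ ℓ))) ∧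
        s'.reg 0 = n + 1 ∧ (∀ i ≤ n, s'.arr 0 i < p ^ ℓ) ∧
        ∀ i ≤ n, (p : ℤ_[p]) ^ κ ∣ PowerSeries.coeff i y - (s'.arr 0 i : ℤ_[p]) := by
  have hp : p.Prime := Fact.out
  have : NeZero (p ^ ℓ) := ⟨pow_ne_zero _ hp.ne_zero⟩
  have hℓ : 1 ≤ ℓ := by omega
  -- As `κ ≥ 1`, all indices and sizes fit in words.
  have hn : n < p ^ ℓ := (Nat.lt_pow_succ_log_self hp.one_lt n).trans_le
    (Nat.pow_le_pow_right hp.pos (by omega))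
  obtain ⟨hq2, hqp, hql⟩ := bounds_pow (p := p) hℓ
  have hw := four_le_word (p ^ ℓ)
  have hlen : (precisionData p ℓ n).length = 4 := rfl
  set inp := precisionData p ℓ n ++ truncation ℓ n g ++ truncation ℓ n h with hinp
  have harr : ∀ x, (initial inp).arr 0 x = inp.getD x 0 := fun x => rfl
  rw [solve, wp_block_cons]
  refine (wp_setup hℓ hn fun x hx => ?_).mono ?_
  · rw [harr, hinp, List.append_assoc, List.getD_append _ _ _ _ (by omega)]
  intro s1 c1 ⟨hc1, hg1, ha1⟩
  rw [wp_block_cons]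
  refine (wp_sieve hT hℓ hn0 hn hg1 fun m => ?_).mono ?_
  · rw [ha1]; rfl
  intro s2 c2 ⟨hc2, hg2, ha2, htable⟩
  rw [wp_block_cons, wp_store, wp_block_cons]
  refine (wp_largePower hℓ hn0 hn (by constructor <;> simp [hg2.1, hg2.2, hg2.3, hg2.4, hg2.5,
    hg2.6, hg2.7])).mono ?_
  intro s3 c3 ⟨hc3, ⟨j, h32, hj1, hj2⟩, ha3⟩
  have hg3 : Globals p ℓ n s3 := by
    constructor <;> rw [ha3.1 _ (by norm_num)] <;>
      simp [hg2.1, hg2.2, hg2.3, hg2.4, hg2.5, hg2.6, hg2.7]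
  have hkeep : ∀ A, A ∉ [1, 2, 3, 4, 5, 6, 8] → s3.arr A = (initial inp).arr A := fun A hA => by
    simp only [List.mem_cons, List.not_mem_nil, or_false, not_or] at hA
    rw [ha3.2 A (by simp), Memory.arr_setArr, if_neg hA.2.2.2.2.2.2, ha2 A (by simp [hA]), ha1]
  have hP3 : Prepared ℓ n g h s3 := by
    constructor
    · exact hg3
    · intro i hi
      rw [hkeep 0 (by simp), harr, hinp, List.append_assoc,
        List.getD_append_right _ _ _ _ (by omega), hlen, Nat.add_sub_cancel_left,
        List.getD_append _ _ _ _ (by simpa [truncation] using hi), truncation, residues_getD,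
        if_pos hi]
    · intro i hi
      rw [hkeep 0 (by simp), harr, hinp,
        List.getD_append_right _ _ _ _ (by simp [truncation, hlen]), List.length_append, hlen,
        truncation, truncation, length_residues, Nat.add_sub_cancel_left, residues_getD, if_pos hi]
    · intro i hi hin
      rw [ha3.2 5 (by simp), ha3.2 6 (by simp)]
      exact htable i hi hin
    · rw [hkeep 11 (by simp)]; rfl
  have h37 : s3.arr 7 = fun _ => 0 := by rw [hkeep 7 (by simp)]; rfl
  have h38 : s3.arr 8 = Function.update (fun _ => 0) 0 1 := by
    rw [ha3.2 8 (by simp), Memory.arr_setArr, if_pos rfl, hg2.5, hg2.7, ha2 8 (by simp), ha1]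
    rfl
  have hu3 : solutionSeries p s3 = 0 := by
    ext i
    simp [solutionSeries, h37]
  have hv3 : inverseSeries (p ^ ℓ) s3 = 1 := by
    ext i
    rw [inverseSeries, PowerSeries.coeff_mk, h38, PowerSeries.coeff_one, Function.update_apply]
    split_ifs <;> simp
  -- Since `n < 2 ^ j` the initial precision is `0`: modulo `t`, the solution is `0` and `h(0) = 1`
  -- has inverse `1`.
  have hs3 : NewtonState κ ℓ n g h y (n / 2 ^ j) s3 := by
    rw [Nat.div_eq_of_lt hj1]
    refine ⟨hP3, ?_, ?_, ?_, ?_, ?_, ?_⟩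
    · simp [h37]; omega
    · simp [h37]
    · simp [h37]
    · intro i
      rw [h38, Function.update_apply]
      split_ifs <;> omega
    · rw [hu3, sub_zero, mem_congrIdeal]
      intro i hi
      obtain rfl : i = 0 := by omega
      rw [PowerSeries.coeff_zero_eq_constantCoeff_apply, hy0]
      exact dvd_zero _
    · rw [hu3, hv3, mul_one, mem_congrIdeal_zero]
      intro i hi
      obtain rfl : i = 0 := by omega
      have h1 := subst_sub_sum_mem_congrIdeal h (a := 0) (map_zero _) 1 0 one_pos
      simp only [Finset.range_one, Finset.sum_singleton, pow_zero, mul_one, map_sub,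
        PowerSeries.coeff_zero_C, zero_dvd_iff] at h1
      rw [map_sub, PowerSeries.coeff_map, sub_eq_zero.1 h1,
        PowerSeries.coeff_zero_eq_constantCoeff_apply, h0, map_one, PowerSeries.coeff_zero_one,
        sub_self]
  rw [wp_block_cons, wp_op, wp_block_cons]
  refine (wp_iterate hT hTC hκ hℓκ hn h0 hy0 hy j hj2 _ ?_ ?_
    (hs3.setReg (by norm_num) _)).mono ?_
  · simp [h32]
  · simp [h32, hg3.5, Op.eval]
  intro s4 c4 ⟨hc4, hs4⟩
  have hg4 := hs4.prepared.globals
  rw [wp_block_cons, wp_op, wp_block_cons]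
  refine (wp_copy (q := p ^ ℓ) (by norm_num) (by norm_num) (by norm_num) (by norm_num)
    ?_ ?_ ?_ ?_ ?_).mono ?_
  · simp [hg4.5]
  · simp [hg4.7]
  · simp [hg4.4, hg4.5, hg4.7, Op.eval]; omega
  · simp [hg4.4, hg4.5, hg4.7, Op.eval]; omega
  · intro x _
    exact (hs4.arr_lt _).le.trans (by omega)
  intro s5 c5 ⟨hc5, ha5, h5⟩
  simp only [Memory.reg_setReg, Memory.arr_setReg, Op.eval] at hc5 h5
  norm_num only [if_true, if_false, hg4.4, hg4.5, hg4.7, zero_add, Nat.sub_zero] at hc5 h5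
  have h30 : s5.reg 30 = n + 1 := by simp [ha5.1, hg4.4, hg4.5, Op.eval]
  have h46 : s5.reg 46 = 0 := by simp [ha5.1, hg4.7]
  simp only [wp_block_cons, wp_block_nil, wp_op, Op.eval, Op.cost, h30, h46, h32, hg2.5, hg2.7,
    hg3.5, hg4.4, hg4.5]
  refine ⟨j, hj2, ?_, by simp, fun i hi => ?_, fun i hi => ?_⟩
  · have l1 := len_le_word (q := p ^ ℓ) (x := 2 ^ j) (by omega)
    have l2 := len_le_word (q := p ^ ℓ) (x := n) (by omega)
    have l3 := len_le_word (q := p ^ ℓ) (x := n + 1) (by omega)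
    have e1 : (n + 1 + 1) * word (p ^ ℓ) = n * word (p ^ ℓ) + 2 * word (p ^ ℓ) := by ring
    have e2 : (n + 1) * word (p ^ ℓ) = n * word (p ^ ℓ) + word (p ^ ℓ) := by ring
    have e3 : word (p ^ ℓ) ≤ n * word (p ^ ℓ) := Nat.le_mul_of_pos_left _ hn0
    simp only [len_one, len_zero]
    omega
  · rw [Memory.arr_setReg, h5, if_pos (by omega)]
    exact hs4.arr_lt i
  · rw [Memory.arr_setReg, h5, if_pos (by omega)]
    have := (mem_congrIdeal.1 hs4.approx) i (by omega)
    rwa [map_sub, solutionSeries, PowerSeries.coeff_mk] at this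

/-! ## Bounds for the costs of the procedures -/

theorem listLen_append (l l' : List ℕ) : listLen (l ++ l') = listLen l + listLen l' := by
  simp [listLen]

theorem listLen_le {l : List ℕ} {w : ℕ} (h : ∀ x ∈ l, len x ≤ w) : listLen l ≤ l.length * w := by
  simpa [listLen] using List.sum_le_card_nsmul (l.map len) w (by simpa using h)

theorem listLen_truncation_le {p : ℕ} [Fact p.Prime] (ℓ m : ℕ) (f : ℤ_[p]⟦X⟧) :
    listLen (truncation ℓ m f) ≤ m * word (p ^ ℓ) := by
  have : NeZero (p ^ ℓ) := ⟨pow_ne_zero _ (Fact.out : p.Prime).ne_zero⟩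
  have h := listLen_le (l := truncation ℓ m f) (w := word (p ^ ℓ)) fun x hx => by
    simp only [truncation, residues, List.mem_map, List.mem_range] at hx
    obtain ⟨i, -, rfl⟩ := hx
    exact len_le_word ((ZMod.val_lt _).le.trans (by omega))
  rwa [truncation, length_residues] at h

end BitRAM

/-! ### Lower bound for the cost of multiplication, and the final count. -/

open BitRAM

/-- Reading is charged. Two polynomials with all `m + 1` coefficients equal to `-1`, represented by
`q - 1`, make any multiplication cost at least `2 (m + 1) len (q - 1)`, and `word q ≤ 3 len (q - 1)`
because `q ≥ 2`. -/
theorem MultipliesWithCost.word_le {p : ℕ} [Fact p.Prime] {P : Prog} {M : ℕ → ℕ → ℕ}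
    (hP : MultipliesWithCost p P M) {ℓ m : ℕ} (hℓ : 1 ≤ ℓ) (hm : 1 ≤ m) :
    (m + 1) * word (p ^ ℓ) ≤ 2 * M (p ^ ℓ) m := by
  obtain ⟨hq2, -, -⟩ := bounds_pow (p := p) hℓ
  have : NeZero (p ^ ℓ) := ⟨by omega⟩
  set q := p ^ ℓ with hq
  set F : (ZMod q)⟦X⟧ := PowerSeries.mk fun _ => -1 with hF
  set a := PowerSeries.trunc (m + 1) F with ha
  have hdeg : a.natDegree ≤ m := Nat.lt_succ_iff.1 (PowerSeries.natDegree_trunc_lt F m)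
  obtain ⟨c, hc, s, c', -, -, hcost⟩ := hP ℓ m hℓ hm a a hdeg hdeg
  have hval : (-1 : ZMod q).val = q - 1 := by
    obtain ⟨k, hk⟩ : ∃ k, q = k + 1 := ⟨q - 1, by omega⟩
    rw [hk]
    simp
  have hres : residues (m + 1) a.coeff = List.replicate (m + 1) (q - 1) := by
    refine List.eq_replicate_iff.2 ⟨length_residues _ _, fun x hx => ?_⟩
    simp only [residues, List.mem_map, List.mem_range] at hx
    obtain ⟨i, hi, rfl⟩ := hx
    rw [ha, PowerSeries.coeff_trunc, if_pos hi, hF, PowerSeries.coeff_mk, hval]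
  have hsize : Nat.size q ≤ len (q - 1) := by
    rw [Nat.size_le]
    have h1 := Nat.lt_size_self (q - 1)
    have h2 : 1 ≤ 2 ^ Nat.size (q - 1) := Nat.one_le_two_pow
    rw [len, pow_succ]
    omega
  have hsize2 : 2 ≤ Nat.size q := Nat.lt_size.2 (by simpa using hq2)
  have hl : listLen (residues (m + 1) a.coeff) = (m + 1) * len (q - 1) := by
    simp [hres, listLen]
  rw [listLen_append, listLen_append, hl] at hcost
  rw [← hq] at hc
  have h1 : (m + 1) * word q ≤ (m + 1) * (3 * len (q - 1)) :=
    Nat.mul_le_mul_left _ (by unfold word; omega)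
  have h2 : (m + 1) * (3 * len (q - 1)) = 3 * ((m + 1) * len (q - 1)) := by ring
  omega

/-- The program sees its series only modulo `(p ^ ℓ, t ^ n)`, so the given approximations may be
replaced by `g` and `h` themselves. -/
theorem truncation_congr {p ℓ n : ℕ} [Fact p.Prime] {f f' : ℤ_[p]⟦X⟧}
    (h : IsApproximation ℓ n f f') : truncation ℓ n f' = truncation ℓ n f :=
  residues_congr fun i hi => by
    rw [eq_comm, ← sub_eq_zero, ← map_sub, toZModPow_eq_zero_iff]
    exact h i hi

theorem theorem1 :
    ∃ (main : BitRAM.Prog) (K : ℕ),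
      ∀ (p : ℕ) [Fact p.Prime]
        (mulP : BitRAM.Prog) (M : ℕ → ℕ → ℕ), MultipliesWithCost p mulP M →
      ∀ (h : ℤ_[p]⟦X⟧), PowerSeries.constantCoeff h = 1 →
      ∀ (compP : BitRAM.Prog) (C : ℕ → ℕ → ℕ), ComposesWithCost h compP C →
      ∀ (n κ ℓ : ℕ), 0 < n → 0 < κ → (p = 2 → 1 < κ) → ℓ = κ + Nat.log p n →
        Doubling (M (p ^ ℓ)) → Doubling (C (p ^ ℓ)) →
      ∀ (g y : ℤ_[p]⟦X⟧), PowerSeries.constantCoeff g ≠ 0 →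
        PowerSeries.constantCoeff y = 0 →
        PowerSeries.derivative ℤ_[p] y = g * h.subst y →
      ∀ (g' h' : ℤ_[p]⟦X⟧), IsApproximation ℓ n g g' → IsApproximation ℓ n h h' →
        ∃ (out : List ℕ) (cost : ℕ),
          BitRAM.behaviour (BitRAM.twoProcs mulP compP) main
            (precisionData p ℓ n ++ truncation ℓ n g' ++ truncation ℓ n h') out cost ∧
          out.length = n + 1 ∧
          IsApproximation κ (n + 1) y (ofList p out) ∧
          cost ≤ K * (M (p ^ ℓ) n + C (p ^ ℓ) n) := by
  -- The levels contribute `2 · 3050`, the sieve and the other linear work `2 · 600 + 2 · 800`;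
  -- input and output are covered by the rest.
  refine ⟨solve, 12000, ?_⟩
  intro p _ mulP M hM h h0 compP C hC n κ ℓ hn0 hκ _ hℓκ hMd hCd g y _ hy0 hy g' h' hg' hh'
  have hp : p.Prime := Fact.out
  have hℓ : 1 ≤ ℓ := by omega
  obtain ⟨hq2, hqp, hql⟩ := bounds_pow (p := p) hℓ
  have hn : n < p ^ ℓ := (Nat.lt_pow_succ_log_self hp.one_lt n).trans_le
    (Nat.pow_le_pow_right hp.pos (by omega))
  rw [truncation_congr hg', truncation_congr hh']
  have hT : CanMultiply (twoProcs mulP compP) p ℓ (M (p ^ ℓ)) := fun m hm => hM ℓ m hℓ hm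
  have hTC : CanCompose (twoProcs mulP compP) ℓ h (C (p ^ ℓ)) := fun m hm => hC ℓ m hℓ hm
  obtain ⟨s, c, hexec, j, hj, hc, hs0, hlt, hs⟩ := wp_solve hT hTC hn0 hκ hℓκ h0 hy0 hy
  have hlen : (s.getList 0 (s.reg 0)).length = n + 1 := by simp [Memory.getList, hs0]
  refine ⟨_, _, ⟨s, c, hexec, rfl, rfl⟩, hlen, fun i hi => ?_, ?_⟩
  · have := hs i (by omega)
    simpa [ofList, Memory.getList, hs0, List.getD_eq_getElem?_getD, hi] using this
  · have hw := hM.word_le hℓ hn0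
    have hone := hMd.succ_mul_le hn0
    have hout := listLen_le (l := s.getList 0 (s.reg 0)) (w := word (p ^ ℓ)) fun x hx => by
      simp only [Memory.getList, hs0, List.mem_map, List.mem_range] at hx
      obtain ⟨i, hi, rfl⟩ := hx
      exact len_le_word ((hlt i (by omega)).le.trans (by omega))
    rw [hlen] at hout
    have hdata := listLen_le (l := precisionData p ℓ n) (w := word (p ^ ℓ)) fun x hx => by
      simp only [precisionData, List.mem_cons, List.not_mem_nil, or_false] at hx
      exact len_le_word (by omega)
    have hdata4 : (precisionData p ℓ n).length = 4 := rfl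
    rw [hdata4] at hdata
    have hlg := listLen_truncation_le ℓ n g
    have hlh := listLen_truncation_le ℓ n h
    rw [listLen_append, listLen_append]
    -- `3050 = 6 + 2 · 2 + 1520 · 2`: modular products and words are both converted into
    -- multiplications at the size of the level, with a factor `2`.
    have hsum : ∑ i ∈ Finset.range j, (6 * M (p ^ ℓ) (n / 2 ^ i) + C (p ^ ℓ) (n / 2 ^ i) +
        2 * (n / 2 ^ i * M (p ^ ℓ) 1) + 1520 * ((n / 2 ^ i + 1) * word (p ^ ℓ))) ≤
        ∑ i ∈ Finset.range j, (3050 * M (p ^ ℓ) (n / 2 ^ i) + C (p ^ ℓ) (n / 2 ^ i)) := by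
      refine Finset.sum_le_sum fun i hi => ?_
      have h1 : 2 ^ (i + 1) ≤ 2 ^ j := Nat.pow_le_pow_right (by norm_num) (Finset.mem_range.1 hi)
      have h2 : 1 ≤ n / 2 ^ i := (Nat.one_le_div_iff (by positivity)).2 (by
        rw [pow_succ] at h1; omega)
      have h3 := hM.word_le hℓ h2
      have h4 := hMd.succ_mul_le h2
      rw [add_mul, one_mul] at h4
      omega
    have hsplit : ∑ i ∈ Finset.range j, (3050 * M (p ^ ℓ) (n / 2 ^ i) + C (p ^ ℓ) (n / 2 ^ i)) =
        3050 * ∑ i ∈ Finset.range j, M (p ^ ℓ) (n / 2 ^ i) +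
          ∑ i ∈ Finset.range j, C (p ^ ℓ) (n / 2 ^ i) := by
      rw [Finset.sum_add_distrib, Finset.mul_sum]
    have hMs := hMd.sum_le j n hj
    have hCs := hCd.sum_le j n hj
    rw [add_mul, one_mul] at hone
    have e1 : (n + 1) * word (p ^ ℓ) = n * word (p ^ ℓ) + word (p ^ ℓ) := by ring
    have e2 : word (p ^ ℓ) ≤ n * word (p ^ ℓ) := Nat.le_mul_of_pos_left _ hn0
    omega
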